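/- **Setting.** Let $\lambda\in[0,1)$, $Q(x)=\tfrac32\cosh^{-2}(x/2)$, and, for $\mu>-1$, $Q_\mu(x)=(1+\mu)\,Q\Big(\sqrt{\tfrac{1+\mu}{1+\lambda\mu}}\,x\Big)$. Let $\mathcal Y$ be the set of $f\in C^\infty(\mathbb R,\mathbb R)$ such that for every $j\in\mathbb N$ there are $C_j,r_j>0$ with $|f^{(j)}(x)|\le C_j(1+|x|)^{r_j}e^{-|x|}$ for all $x$. Put $$\theta_A=\frac{36(5-\lambda^2)}{15+10\lambda-\lambda^2},\qquad \theta_B=\frac{144\lambda^2}{15+10\lambda-\lambda^2},\qquad \theta=\frac{(1+\lambda)(5-10\lambda+\lambda^2)}{15+10\lambda-\lambda^2}.$$ For $\mu_0>0$ put $Y_0=\big|\ln\big(\mu_0^2(15+10\lambda-\lambda^2)/240\big)\big|$. Given functions $A_j,B_j,D_j:\mathbb R\to\mathbb R$ and real constants $\alpha,\beta,\delta,a,b_j,d_j$ ($j=1,2$), define, for $\Gamma=(\mu_1,\mu_2,y_1,y_2)$, $$\begin{aligned}V_0(x;\Gamma)={}&Q_{\mu_1}(x-y_1)+Q_{\mu_2}(x-y_2)+e^{-(y_1-y_2)}\big(A_1(x-y_1)+A_2(x-y_2)\big)\\&+\theta(\mu_1-\mu_2)\,x\,Q(x-y_1)Q(x-y_2)\\&+(y_1-y_2)e^{-(y_1-y_2)}\big(\mu_1B_1(x-y_1)+\mu_2B_2(x-y_2)\big)\\&+e^{-(y_1-y_2)}\big(\mu_1D_1(x-y_1)+\mu_2D_2(x-y_2)\big),\end{aligned}$$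 and, with $y=y_1-y_2$, $$\mathcal M_1=\alpha e^{-y}+\beta\mu_1ye^{-y}+\delta\mu_1e^{-y},\qquad \mathcal M_2=-\alpha e^{-y}-\beta\mu_2ye^{-y}-\delta\mu_2e^{-y},$$ $$\mathcal N_j=ae^{-y}+b_j\mu_jye^{-y}+d_j\mu_je^{-y}\qquad(j=1,2).$$ **Statement.** For every $\lambda\in[0,1)$ there exist unique functions $A_j,B_j,D_j$ and real constants $\alpha,\beta,\delta,a,b_j,d_j$ ($j=1,2$) with the following properties (i) and (ii). (i) *Profiles.* $A_j,B_j,D_j$ are $C^\infty$ and belong to $L^\infty(\mathbb R)$; $A_j',B_j',D_j'\in\mathcal Y$; $$-\lim_{\pm\infty}A_1=\lim_{\pm\infty}A_2=\pm\theta_A,\qquad \lim_{+\infty}B_j=\lim_{+\infty}D_j=0,\qquad \lim_{-\infty}B_1=-\lim_{-\infty}B_2=\frac{288\lambda^2}{15+10\lambda-\lambda^2}=2\theta_B;$$ for some real $\theta_D$, $\lim_{-\infty}D_1=-\lim_{-\infty}D_2=2\theta_D$; and $$\int f\,(1-\lambda\partial_x^2)Q'=0\quad\text{for each }f\in\{A_1,A_2,B_1,B_2,D_1,D_2\},$$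 $$\int(A_j+\theta_A)(1-\lambda\partial_x^2)Q=0\ (j=1,2),\qquad\int B_1(1-\lambda\partial_x^2)Q=\int(B_2-2\theta_B)(1-\lambda\partial_x^2)Q=0,$$ $$\int D_1(1-\lambda\partial_x^2)Q=\int(D_2-2\theta_D)(1-\lambda\partial_x^2)Q=0.$$ (ii) *Equation.* There exist $\sigma\ge3$ and $0<\mu_*<1/10$ such that for every $K>1$ there is $C=C(K)>0$ for which the following holds for every $0<\mu_0<\mu_*$, every non-degenerate interval $I\subset\mathbb R$ and every $C^1$ function $\Gamma=(\mu_1,\mu_2,y_1,y_2):I\to\mathbb R^4$ such that, on $I$, $$Y_0-1\le y_1-y_2\le KY_0,\quad|\mu_1|\le2\mu_0,\quad|\mu_2|\le2\mu_0,\quad|\mu_1+\mu_2|\le Y_0^2e^{-Y_0},\quad|y_1+y_2|\le Y_0^4e^{-\frac12Y_0}.$$ With $V_0(t,x)=V_0(x;\Gamma(t))$ and $y(t)=y_1(t)-y_2(t)$, one has, for $t\in I$ and $x\in\mathbb R$, $$(1-\lambda\partial_x^2)\partial_tV_0+\partial_x(\partial_x^2V_0-V_0+V_0^2)=\sum_{j=1,2}(\dot\mu_j-\mathcal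 M_j)(1-\lambda\partial_x^2)\frac{\partial V_0}{\partial\mu_j}-\sum_{j=1,2}(\mu_j-\dot y_j-\mathcal N_j)(1-\lambda\partial_x^2)\frac{\partial V_0}{\partial y_j}+E_0(t,x),$$ where $$\sup_{x\in\mathbb R}\Big\{\big(1+e^{\frac12(x-y_1(t))}\big)|E_0(t,x)|\Big\}\le C\,Y_0^\sigma e^{-Y_0}e^{-y(t)}\qquad\text{for all }t\in I.$$ Moreover, $\alpha=\dfrac{240}{15+10\lambda-\lambda^2}$, and $b_1=b_2$ if and only if $\lambda=0$. -/

import Mathlib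

open MeasureTheory Filter Topology
open scoped ContDiff

noncomputable section

namespace BBM

/-- The class `𝒴` of smooth functions all of whose derivatives are bounded by a polynomial
times `e^{-|x|}`. -/
def classY : Set (ℝ → ℝ) :=
  {f | ContDiff ℝ ∞ f ∧ ∀ j : ℕ, ∃ C r : ℝ, 0 < C ∧ 0 < r ∧
    ∀ x : ℝ, |iteratedDeriv j f x| ≤ C * (1 + |x|) ^ r * Real.exp (-|x|)}

/-- The operator `1 - λ ∂ₓ²`. -/
def helm (lam : ℝ) (f : ℝ → ℝ) : ℝ → ℝ := fun x => f x - lam * iteratedDeriv 2 f x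

/-- The ground state `Q(x) = (3/2) / cosh²(x/2)`. -/
def Q (x : ℝ) : ℝ := 3 / 2 / Real.cosh (x / 2) ^ 2

/-- The soliton profile `Q_μ`, for `μ > -1`. -/
def Qmu (lam mu : ℝ) (x : ℝ) : ℝ :=
  (1 + mu) * Q (Real.sqrt ((1 + mu) / (1 + lam * mu)) * x)

/-- The common denominator `15 + 10 λ - λ²`, positive for `λ ∈ [0,1)`. -/
def den (lam : ℝ) : ℝ := 15 + 10 * lam - lam ^ 2

def alphaVal (lam : ℝ) : ℝ := 240 / den lam

def thetaA (lam : ℝ) : ℝ := 36 * (5 - lam ^ 2) / den lam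

def thetaB (lam : ℝ) : ℝ := 144 * lam ^ 2 / den lam

def theta (lam : ℝ) : ℝ := (1 + lam) * (5 - 10 * lam + lam ^ 2) / den lam

/-- The profiles and the constants entering the approximate solution. -/
@[ext]
structure ApproxData where
  A₁ : ℝ → ℝ
  A₂ : ℝ → ℝ
  B₁ : ℝ → ℝ
  B₂ : ℝ → ℝ
  D₁ : ℝ → ℝ
  D₂ : ℝ → ℝ
  α : ℝ
  β : ℝ
  δ : ℝ
  a : ℝ
  b₁ : ℝ
  b₂ : ℝ
  d₁ : ℝ
  d₂ : ℝ

/-- A smooth function in `L^∞(ℝ)` whose derivative belongs to `𝒴`. -/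
def IsProfile (f : ℝ → ℝ) : Prop :=
  ContDiff ℝ ∞ f ∧ MemLp f ⊤ (volume : Measure ℝ) ∧ deriv f ∈ classY

/-- Orthogonality of `f` to `(1 - λ ∂ₓ²) Q'` and of `f + c` to `(1 - λ ∂ₓ²) Q`. -/
def Orth (lam c : ℝ) (f : ℝ → ℝ) : Prop :=
  ∫ x : ℝ, f x * helm lam (deriv Q) x = 0 ∧ ∫ x : ℝ, (f x + c) * helm lam Q x = 0

namespace ApproxData

/-- Regularity, limits at `±∞` and orthogonality conditions of the profiles. -/
structure ProfileProperties (lam : ℝ) (P : ApproxData) : Prop where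
  profile_A₁ : IsProfile P.A₁
  profile_A₂ : IsProfile P.A₂
  profile_B₁ : IsProfile P.B₁
  profile_B₂ : IsProfile P.B₂
  profile_D₁ : IsProfile P.D₁
  profile_D₂ : IsProfile P.D₂
  A₁_top : Tendsto P.A₁ atTop (𝓝 (-thetaA lam))
  A₁_bot : Tendsto P.A₁ atBot (𝓝 (thetaA lam))
  A₂_top : Tendsto P.A₂ atTop (𝓝 (thetaA lam))
  A₂_bot : Tendsto P.A₂ atBot (𝓝 (-thetaA lam))
  B₁_top : Tendsto P.B₁ atTop (𝓝 0)
  B₁_bot : Tendsto P.B₁ atBot (𝓝 (288 * lam ^ 2 / den lam))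
  B₂_top : Tendsto P.B₂ atTop (𝓝 0)
  B₂_bot : Tendsto P.B₂ atBot (𝓝 (-(288 * lam ^ 2 / den lam)))
  D₁_top : Tendsto P.D₁ atTop (𝓝 0)
  D₂_top : Tendsto P.D₂ atTop (𝓝 0)
  orth_A₁ : Orth lam (thetaA lam) P.A₁
  orth_A₂ : Orth lam (thetaA lam) P.A₂
  orth_B₁ : Orth lam 0 P.B₁
  orth_B₂ : Orth lam (-2 * thetaB lam) P.B₂
  /-- As for `B_j`, with `2 θ_D` the limit of `D₁` and of `-D₂` at `-∞`. -/
  orth_D : ∃ thetaD : ℝ,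
    Tendsto P.D₁ atBot (𝓝 (2 * thetaD)) ∧ Tendsto P.D₂ atBot (𝓝 (-2 * thetaD)) ∧
    Orth lam 0 P.D₁ ∧ Orth lam (-2 * thetaD) P.D₂

/-- The approximate solution `V₀(x; Γ)`, `Γ = (μ₁, μ₂, y₁, y₂)`. -/
def V₀ (P : ApproxData) (lam mu₁ mu₂ y₁ y₂ : ℝ) (x : ℝ) : ℝ :=
  Qmu lam mu₁ (x - y₁) + Qmu lam mu₂ (x - y₂)
  + Real.exp (-(y₁ - y₂)) * (P.A₁ (x - y₁) + P.A₂ (x - y₂))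
  + theta lam * (mu₁ - mu₂) * x * Q (x - y₁) * Q (x - y₂)
  + (y₁ - y₂) * Real.exp (-(y₁ - y₂)) * (mu₁ * P.B₁ (x - y₁) + mu₂ * P.B₂ (x - y₂))
  + Real.exp (-(y₁ - y₂)) * (mu₁ * P.D₁ (x - y₁) + mu₂ * P.D₂ (x - y₂))

def M₁ (P : ApproxData) (mu₁ y : ℝ) : ℝ :=
  P.α * Real.exp (-y) + P.β * mu₁ * y * Real.exp (-y) + P.δ * mu₁ * Real.exp (-y)

def M₂ (P : ApproxData) (mu₂ y : ℝ) : ℝ :=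
  -P.α * Real.exp (-y) - P.β * mu₂ * y * Real.exp (-y) - P.δ * mu₂ * Real.exp (-y)

def N₁ (P : ApproxData) (mu₁ y : ℝ) : ℝ :=
  P.a * Real.exp (-y) + P.b₁ * mu₁ * y * Real.exp (-y) + P.d₁ * mu₁ * Real.exp (-y)

def N₂ (P : ApproxData) (mu₂ y : ℝ) : ℝ :=
  P.a * Real.exp (-y) + P.b₂ * mu₂ * y * Real.exp (-y) + P.d₂ * mu₂ * Real.exp (-y)

/-- The modulation term `Ẽ(V₀)` at time `t ∈ I` and position `x`, along `Γ(t)`. -/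
def modTerm (P : ApproxData) (lam : ℝ) (I : Set ℝ) (mu₁ mu₂ y₁ y₂ : ℝ → ℝ) (t x : ℝ) : ℝ :=
  (derivWithin mu₁ I t - P.M₁ (mu₁ t) (y₁ t - y₂ t)) *
      helm lam (fun z => deriv (fun m => P.V₀ lam m (mu₂ t) (y₁ t) (y₂ t) z) (mu₁ t)) x
  + (derivWithin mu₂ I t - P.M₂ (mu₂ t) (y₁ t - y₂ t)) *
      helm lam (fun z => deriv (fun m => P.V₀ lam (mu₁ t) m (y₁ t) (y₂ t) z) (mu₂ t)) x
  - (mu₁ t - derivWithin y₁ I t - P.N₁ (mu₁ t) (y₁ t - y₂ t)) *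
      helm lam (fun z => deriv (fun s => P.V₀ lam (mu₁ t) (mu₂ t) s (y₂ t) z) (y₁ t)) x
  - (mu₂ t - derivWithin y₂ I t - P.N₂ (mu₂ t) (y₁ t - y₂ t)) *
      helm lam (fun z => deriv (fun s => P.V₀ lam (mu₁ t) (mu₂ t) (y₁ t) s z) (y₂ t)) x

end ApproxData

/-- The left-hand side `(1 - λ ∂ₓ²) ∂ₜ v + ∂ₓ (∂ₓ² v - v + v²)` of the equation, for `t` in the
time interval `I` (one-sided time derivatives at end points of `I`). -/
def bbmLhs (lam : ℝ) (I : Set ℝ) (v : ℝ → ℝ → ℝ) (t x : ℝ) : ℝ :=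
  helm lam (fun z => derivWithin (fun s => v s z) I t) x
  + deriv (fun z => iteratedDeriv 2 (v t) z - v t z + v t z ^ 2) x

/-- `Y₀ = |ln (μ₀² / α)|`, with the explicit `α = 240 / (15 + 10 λ - λ²)`. -/
def Y₀ (lam mu0 : ℝ) : ℝ := |Real.log (mu0 ^ 2 / alphaVal lam)|

/-- `Γ = (μ₁, μ₂, y₁, y₂)` is of class `C¹` on the time interval `I` and satisfies the size
conditions with constants `K` and `μ₀`. -/
structure Admissible (lam K mu0 : ℝ) (I : Set ℝ) (mu₁ mu₂ y₁ y₂ : ℝ → ℝ) : Prop where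
  c1_mu₁ : ContDiffOn ℝ 1 mu₁ I
  c1_mu₂ : ContDiffOn ℝ 1 mu₂ I
  c1_y₁ : ContDiffOn ℝ 1 y₁ I
  c1_y₂ : ContDiffOn ℝ 1 y₂ I
  dist_lower : ∀ t ∈ I, Y₀ lam mu0 - 1 ≤ y₁ t - y₂ t
  dist_upper : ∀ t ∈ I, y₁ t - y₂ t ≤ K * Y₀ lam mu0
  mu₁_le : ∀ t ∈ I, |mu₁ t| ≤ 2 * mu0
  mu₂_le : ∀ t ∈ I, |mu₂ t| ≤ 2 * mu0
  mu_sum : ∀ t ∈ I, |mu₁ t + mu₂ t| ≤ Y₀ lam mu0 ^ 2 * Real.exp (-Y₀ lam mu0)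
  y_sum : ∀ t ∈ I, |y₁ t + y₂ t| ≤ Y₀ lam mu0 ^ 4 * Real.exp (-(1 / 2) * Y₀ lam mu0)

/-- `V₀(x; Γ(t))` solves the equation up to the modulation term and an error `E₀` of size
`C(K) Y₀^σ e^{-Y₀} e^{-y(t)}`. -/
def ApproxData.SolvesApprox (lam : ℝ) (P : ApproxData) : Prop :=
  ∃ sigma muStar : ℝ, 3 ≤ sigma ∧ 0 < muStar ∧ muStar < 1 / 10 ∧
    ∀ K : ℝ, 1 < K → ∃ C : ℝ, 0 < C ∧
      ∀ mu0 : ℝ, 0 < mu0 → mu0 < muStar →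
      ∀ I : Set ℝ, I.OrdConnected → I.Nontrivial →
      ∀ mu₁ mu₂ y₁ y₂ : ℝ → ℝ, Admissible lam K mu0 I mu₁ mu₂ y₁ y₂ →
        ∃ E₀ : ℝ → ℝ → ℝ,
          (∀ t ∈ I, ∀ x : ℝ,
            bbmLhs lam I (fun s z => P.V₀ lam (mu₁ s) (mu₂ s) (y₁ s) (y₂ s) z) t x
              = P.modTerm lam I mu₁ mu₂ y₁ y₂ t x + E₀ t x) ∧
          (∀ t ∈ I, ∀ x : ℝ,
            (1 + Real.exp ((x - y₁ t) / 2)) * |E₀ t x|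
              ≤ C * Y₀ lam mu0 ^ sigma * Real.exp (-Y₀ lam mu0) * Real.exp (-(y₁ t - y₂ t)))

end BBM

end

/-! Notation: `H = 1 - λ∂²`, `L = -∂² + 1 - 2Q`, `Λ = ∂_μ Q_μ` at `μ = 0`, `φ = tanh(·/2)`, `z_j = x
- y_j`, and a subscript `j` on a function means evaluation at `z_j`. Smooth functions form an
algebra `Sm` with a derivation `D`. Since `Q = (3/2)(1 - φ²)` and `φ' = Q/3`, the explicit
identities needed reduce to polynomial identities in `z`, `φ` and constants.

Reduction to profile equations. The time derivatives of the parameters cancel exactly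
(`SData.bbmLhs_eq`), so the residual is a function `SData.E0` of `Γ` alone. On the allowed parameter
set `μ_j = O(e^{-Y₀/2})`, `μ₁ + μ₂` and `e^{-y}` are `O(e^{-Y₀})`, and `y₁ + y₂` is `O(e^{-Y₀/2})`,
up to powers of `Y₀`. Hence, modulo admissible errors, `μ₂` may be replaced by `-μ₁` and `y₁`, `-y₂`
by `y/2` in first order terms. The interaction is controlled by the exact identity `(1 - e^{-y})²
Q₁Q₂ = 9 e^{-y}(φ₂ - φ₁)²` (`Par.Ψ_eq`) and by the fact that `(1 + φ₁)(1 - φ₂)` is itself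
`O(e^{-y})` up to powers of `Y₀` (`O_pair`). Modulo that product a polynomial in `φ₁, φ₂` splits
into a function of `z₁` plus a function of `z₂`. The terms that do not decay between the solitons
cancel because of the value of `θ` (`thetaA_eq`). The outcome is `SData.Good.eqv_E0`: the residual
is `e^{-y}` times a combination of six functions, with coefficients `1`, `yμ_j`, `μ_j`, each
function localized near one soliton.

Equivalence. If the six functions vanish, the bound on the error follows at once. Conversely, the
bound tested on constant symmetric parameters at distance `Y → ∞`, viewed from one soliton,
separates the orders `1`, `Y e^{-Y/2}`, `e^{-Y/2}` and forces all six to vanish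
(`SData.Good.equations`).

The linear problem. Each equation reads `(L f)' = source + p HΛ + q HQ'`. Here `L` is symmetric, its
solutions vanishing at `+∞` are the multiples of `Q'`, `LΛ = -HQ`, and `∫ ΛHQ = (3/10)(15 + 10λ -
λ²) > 0`. Solvability is orthogonality of the right side to `Q`, which determines `p` and in
particular `α`. The limit at `-∞` is minus the integral of the right side. The multiple of `Q'` and
the constant `q` (which adds `-qΛ` to `f`) are fixed by the two orthogonality conditions. The same
facts give uniqueness (`profile_unique`).

The constants `b_j`. The profiles of the second soliton come from those of the first by reflection.
Since `B₁` tends to `2θ_B ≠ 0` at `-∞` when `λ ≠ 0`, the reflected profile must be shifted by a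
constant, and restoring orthogonality gives `b₂ - b₁ = 40 θ_B (1 + λ)/(15 + 10λ - λ²)`
(`reflect_profile`), which vanishes exactly for `λ = 0`. -/

noncomputable section

namespace BBM

/-! ### The differential algebra of smooth functions, with translations and reflection. -/

/-- The algebra of smooth real functions. -/
def Sm : Subalgebra ℝ (ℝ → ℝ) where
  carrier := {f | ContDiff ℝ ∞ f}
  mul_mem' {f g} (ha : ContDiff ℝ ∞ f) (hb : ContDiff ℝ ∞ g) := ha.mul hb
  add_mem' {f g} (ha : ContDiff ℝ ∞ f) (hb : ContDiff ℝ ∞ g) := ha.add hb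
  algebraMap_mem' c := (contDiff_const : ContDiff ℝ ∞ fun _ : ℝ => c)

namespace Sm

theorem contDiff (f : Sm) : ContDiff ℝ ∞ f.1 := f.2

theorem differentiable (f : Sm) : Differentiable ℝ f.1 := (contDiff f).differentiable (by simp)

theorem continuous (f : Sm) : Continuous f.1 := (contDiff f).continuous

theorem contDiff_deriv {f : ℝ → ℝ} (hf : ContDiff ℝ ∞ f) : ContDiff ℝ ∞ (deriv f) :=
  (contDiff_infty_iff_deriv.1 hf).2

@[simp] theorem coe_add' (f g : Sm) (x : ℝ) : (f + g).1 x = f.1 x + g.1 x := rfl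
@[simp] theorem coe_sub' (f g : Sm) (x : ℝ) : (f - g).1 x = f.1 x - g.1 x := rfl
@[simp] theorem coe_neg' (f : Sm) (x : ℝ) : (-f).1 x = -f.1 x := rfl
@[simp] theorem coe_mul' (f g : Sm) (x : ℝ) : (f * g).1 x = f.1 x * g.1 x := rfl
@[simp] theorem coe_pow' (f : Sm) (n : ℕ) (x : ℝ) : (f ^ n).1 x = f.1 x ^ n := rfl
@[simp] theorem coe_zero' (x : ℝ) : (0 : Sm).1 x = 0 := rfl
@[simp] theorem coe_one' (x : ℝ) : (1 : Sm).1 x = 1 := rfl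

theorem ext' {f g : Sm} (h : ∀ x, f.1 x = g.1 x) : f = g := Subtype.ext (funext h)

end Sm

/-- Differentiation of smooth functions. -/
def D : Derivation ℝ Sm Sm :=
  Derivation.mk'
    { toFun := fun f => ⟨deriv f.1, Sm.contDiff_deriv f.2⟩
      map_add' := fun f g => Sm.ext' fun x => by
        simpa using deriv_add (Sm.differentiable f x) (Sm.differentiable g x)
      map_smul' := fun c f => Sm.ext' fun x => by
        exact deriv_const_mul c (Sm.differentiable f x) }
    (fun f g => Sm.ext' fun x => by
      have := deriv_mul (Sm.differentiable f x) (Sm.differentiable g x)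
      simp only [LinearMap.coe_mk, AddHom.coe_mk, smul_eq_mul, Sm.coe_add', Sm.coe_mul']
      refine Eq.trans this ?_
      ring)

theorem D_apply (f : Sm) (x : ℝ) : (D f).1 x = deriv f.1 x := rfl

theorem D_coe (f : Sm) : (D f).1 = deriv f.1 := rfl

theorem hasDerivAt (f : Sm) (x : ℝ) : HasDerivAt f.1 ((D f).1 x) x :=
  (Sm.differentiable f x).hasDerivAt

theorem D_eq_of_hasDerivAt {f g : Sm} (h : ∀ x, HasDerivAt f.1 (g.1 x) x) : D f = g :=
  Sm.ext' fun x => (h x).deriv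

@[simp] theorem D_mul (f g : Sm) : D (f * g) = f * D g + g * D f := by
  simp [Derivation.leibniz]

theorem iter_D_coe (k : ℕ) (f : Sm) : (D^[k] f).1 = iteratedDeriv k f.1 := by
  induction k generalizing f with
  | zero => simp
  | succ k ih => rw [Function.iterate_succ_apply, ih, iteratedDeriv_succ', D_coe]

/-- Constants as smooth functions. -/
def cst (c : ℝ) : Sm := algebraMap ℝ Sm c

@[simp] theorem cst_apply (c x : ℝ) : (cst c).1 x = c := rfl
@[simp] theorem D_cst (c : ℝ) : D (cst c) = 0 := Derivation.map_algebraMap D c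
theorem cst_add (a b : ℝ) : cst (a + b) = cst a + cst b := map_add _ _ _
theorem cst_sub (a b : ℝ) : cst (a - b) = cst a - cst b := map_sub _ _ _
theorem cst_mul (a b : ℝ) : cst (a * b) = cst a * cst b := map_mul _ _ _
theorem cst_neg (a : ℝ) : cst (-a) = -cst a := map_neg _ _
theorem cst_pow (a : ℝ) (n : ℕ) : cst (a ^ n) = cst a ^ n := map_pow _ _ _
@[simp] theorem cst_zero : cst 0 = 0 := map_zero _
@[simp] theorem cst_one : cst 1 = 1 := map_one _
@[simp] theorem cst_ofNat (n : ℕ) [n.AtLeastTwo] : cst ofNat(n) = ofNat(n) :=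
  map_ofNat (algebraMap ℝ Sm) n

@[simp] theorem D_ofNat (n : ℕ) [n.AtLeastTwo] : D (ofNat(n) : Sm) = 0 := by
  rw [← cst_ofNat, D_cst]

@[simp] theorem Sm.coe_ofNat' (n : ℕ) [n.AtLeastTwo] (x : ℝ) :
    (ofNat(n) : Sm).1 x = ofNat(n) := by
  rw [← cst_ofNat, cst_apply]

theorem Sm.map_ofNat' (T : Sm →ₐ[ℝ] Sm) (n : ℕ) [n.AtLeastTwo] : T (ofNat(n) : Sm) = ofNat(n) :=
  map_ofNat T n

/-- Translation by `y`. -/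
def sh (y : ℝ) : Sm →ₐ[ℝ] Sm where
  toFun f := ⟨fun x => f.1 (x - y), (Sm.contDiff f).comp (contDiff_id.sub contDiff_const)⟩
  map_one' := rfl
  map_mul' _ _ := rfl
  map_zero' := rfl
  map_add' _ _ := rfl
  commutes' _ := rfl

@[simp] theorem sh_apply (y : ℝ) (f : Sm) (x : ℝ) : (sh y f).1 x = f.1 (x - y) := rfl
@[simp] theorem sh_cst (y c : ℝ) : sh y (cst c) = cst c := rfl
@[simp] theorem D_sh (y : ℝ) (f : Sm) : D (sh y f) = sh y (D f) :=
  Sm.ext' fun x => by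
    simp only [D_apply, sh_apply]
    exact deriv_comp_sub_const (f := f.1) (a := y) (x := x)

/-- Reflection. -/
def rfl' : Sm →ₐ[ℝ] Sm where
  toFun f := ⟨fun x => f.1 (-x), (Sm.contDiff f).comp contDiff_neg⟩
  map_one' := rfl
  map_mul' _ _ := rfl
  map_zero' := rfl
  map_add' _ _ := rfl
  commutes' _ := rfl

@[simp] theorem rfl'_apply (f : Sm) (x : ℝ) : (rfl' f).1 x = f.1 (-x) := rfl
@[simp] theorem rfl'_cst (c : ℝ) : rfl' (cst c) = cst c := rfl
@[simp] theorem D_rfl' (f : Sm) : D (rfl' f) = -rfl' (D f) :=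
  Sm.ext' fun x => by
    simp only [D_apply, Sm.coe_neg', rfl'_apply]
    exact deriv_comp_neg f.1 x

/-- The identity function. -/
def zz : Sm := ⟨fun x => x, (contDiff_id : ContDiff ℝ ∞ id)⟩

@[simp] theorem zz_apply (x : ℝ) : zz.1 x = x := rfl
@[simp] theorem D_zz : D zz = 1 := D_eq_of_hasDerivAt fun x => hasDerivAt_id x
theorem sh_zz (y : ℝ) : sh y zz = zz - cst y := rfl
@[simp] theorem rfl'_zz : rfl' zz = -zz := rfl

/-! ### The ground state in terms of `tanh (x / 2)`. -/

/-- `tanh (x / 2)`. -/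
def ph : Sm := ⟨fun x => Real.sinh (x / 2) / Real.cosh (x / 2), by
  change ContDiff ℝ ∞ _
  refine ContDiff.div ?_ ?_ (fun x => (Real.cosh_pos _).ne')
  · exact Real.contDiff_sinh.comp (contDiff_id.div_const 2)
  · exact Real.contDiff_cosh.comp (contDiff_id.div_const 2)⟩

/-- The ground state as a smooth function. -/
def qq : Sm := ⟨Q, by
  change ContDiff ℝ ∞ _
  refine ContDiff.div contDiff_const ?_ (fun x => (pow_pos (Real.cosh_pos _) 2).ne')
  exact (Real.contDiff_cosh.comp (contDiff_id.div_const 2)).pow 2⟩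

theorem qq_apply (x : ℝ) : qq.1 x = Q x := rfl

/-- With `D_ph` this makes `φ` generate a differential ring containing `Q`. Later identities are
proved by rewriting everything in `φ` and calling `ring`. -/
theorem qq_eq : qq = cst (3 / 2) * (1 - ph ^ 2) := Sm.ext' fun x => by
  have h := Real.cosh_pos (x / 2)
  have h2 := Real.cosh_sq (x / 2)
  simp only [qq, Q, ph, Sm.coe_mul', cst_apply, Sm.coe_sub', Sm.coe_one', Sm.coe_pow']
  field_simp
  linarith

theorem D_ph : D ph = cst (1 / 3) * qq := D_eq_of_hasDerivAt fun x => by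
  have h := Real.cosh_pos (x / 2)
  have h2 := Real.cosh_sq (x / 2)
  have h1 : HasDerivAt (fun x : ℝ => x / 2) (1 / 2) x := (hasDerivAt_id x).div_const 2
  have := (h1.sinh).div h1.cosh h.ne'
  refine this.congr_deriv ?_
  simp only [qq, Q, Sm.coe_mul', cst_apply]
  field_simp
  linarith

theorem D_qq : D qq = -(ph * qq) := by
  have h : D qq = cst (3 / 2) * (-(2 * ph * D ph)) := by
    conv_lhs => rw [qq_eq]
    simp [pow_two]; ring
  rw [h, D_ph]
  apply Sm.ext'; intro x; simp; ring

@[simp] theorem rfl'_qq : rfl' qq = qq := Sm.ext' fun x => by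
  simp [qq, Q, neg_div]
@[simp] theorem rfl'_ph : rfl' ph = -ph := Sm.ext' fun x => by
  simp [ph, neg_div]

theorem qq_pos (x : ℝ) : 0 < qq.1 x := by
  simp only [qq, Q]; positivity

theorem ph_eq (x : ℝ) : ph.1 x = 1 - 2 / (Real.exp x + 1) := by
  have e : Real.exp x = Real.exp (x / 2) * Real.exp (x / 2) := by
    rw [← Real.exp_add]; congr 1; ring
  have h1 := Real.exp_pos (x / 2)
  simp only [ph, Real.sinh_eq, Real.cosh_eq, Real.exp_neg, e]
  field_simp
  ring

theorem ph_lt_one (x : ℝ) : ph.1 x < 1 := by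
  rw [ph_eq]; have := Real.exp_pos x
  have : 0 < 2 / (Real.exp x + 1) := by positivity
  linarith

theorem neg_one_lt_ph (x : ℝ) : -1 < ph.1 x := by
  have := ph_lt_one (-x)
  rw [show ph.1 (-x) = -ph.1 x from congrArg (fun f : Sm => f.1 x) rfl'_ph] at this
  linarith

theorem one_sub_ph_le (x : ℝ) : 1 - ph.1 x ≤ 2 * Real.exp (-x) := by
  rw [ph_eq, Real.exp_neg]; have := Real.exp_pos x
  rw [show (1 : ℝ) - (1 - 2 / (Real.exp x + 1)) = 2 * (Real.exp x + 1)⁻¹ by ring]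
  gcongr; linarith

theorem one_add_ph_le (x : ℝ) : 1 + ph.1 x ≤ 2 * Real.exp x := by
  have := one_sub_ph_le (-x)
  rw [show ph.1 (-x) = -ph.1 x from congrArg (fun f : Sm => f.1 x) rfl'_ph, neg_neg] at this
  linarith

theorem qq_eq_apply (x : ℝ) : qq.1 x = 3 / 2 * (1 + ph.1 x) * (1 - ph.1 x) := by
  have := congrArg (fun f : Sm => f.1 x) qq_eq
  simp at this; rw [this]; ring

theorem qq_le (x : ℝ) : qq.1 x ≤ 6 * Real.exp (-|x|) := by
  have h1 := one_sub_ph_le x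
  have h2 := one_add_ph_le x
  have h3 := ph_lt_one x
  have h4 := neg_one_lt_ph x
  rw [qq_eq_apply]
  rcases le_total 0 x with h | h
  · rw [abs_of_nonneg h]; nlinarith
  · rw [abs_of_nonpos h, neg_neg]; nlinarith

/-! ### Bounds on all derivatives up to a class of harmless factors, used both in `x` (polynomials)
and in the parameters (powers of `Y₀`). -/

/-- A class of nonnegative factors, up to which bounds are understood. -/
structure Slack (ι : Type*) where
  mem : (ι → ℝ → ℝ) → Prop
  nonneg : ∀ s, mem s → ∀ i x, 0 ≤ s i x
  add : ∀ s t, mem s → mem t → mem (fun i x => s i x + t i x)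
  mul : ∀ s t, mem s → mem t → mem (fun i x => s i x * t i x)
  const : ∀ c : ℝ, 0 ≤ c → mem (fun _ _ => c)

/-- All derivatives of the smooth functions `E i` are bounded by the gauge `g`, up to factors
in `Λ`. -/
def Slack.Bdd {ι : Type*} (Λ : Slack ι) (g : ι → ℝ → ℝ) (E : ι → Sm) : Prop :=
  ∀ k : ℕ, ∃ s, Λ.mem s ∧ ∀ i x, |((D^[k]) (E i)).1 x| ≤ s i x * g i x

theorem iter_D_add (k : ℕ) (f g : Sm) : D^[k] (f + g) = D^[k] f + D^[k] g := by
  induction k generalizing f g with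
  | zero => rfl
  | succ k ih => simp only [Function.iterate_succ_apply, map_add, ih]

theorem iter_D_neg (k : ℕ) (f : Sm) : D^[k] (-f) = -D^[k] f := by
  induction k generalizing f with
  | zero => rfl
  | succ k ih => simp only [Function.iterate_succ_apply, map_neg, ih]

theorem iter_D_cst_mul (k : ℕ) (c : ℝ) (f : Sm) : D^[k] (cst c * f) = cst c * D^[k] f := by
  induction k generalizing f with
  | zero => rfl
  | succ k ih =>
    rw [Function.iterate_succ_apply, Function.iterate_succ_apply, ← ih]; simp

theorem iter_D_sh (k : ℕ) (y : ℝ) (f : Sm) : D^[k] (sh y f) = sh y (D^[k] f) := by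
  induction k generalizing f with
  | zero => rfl
  | succ k ih => simp only [Function.iterate_succ_apply, D_sh, ih]

theorem iter_D_cst (k : ℕ) (c : ℝ) : D^[k + 1] (cst c) = 0 := by
  induction k with
  | zero => simp
  | succ k ih => rw [Function.iterate_succ_apply', ih, map_zero]

namespace Slack
namespace Bdd

variable {ι : Type*} {Λ : Slack ι} {g h : ι → ℝ → ℝ} {E F : ι → Sm}

theorem deriv (hE : Λ.Bdd g E) : Λ.Bdd g (fun i => D (E i)) := fun k => by
  simpa only [Function.iterate_succ_apply] using hE (k + 1)

theorem mono (hE : Λ.Bdd g E) {r : ι → ℝ → ℝ} (hr : Λ.mem r)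
    (hg : ∀ i x, g i x ≤ r i x * h i x) : Λ.Bdd h E := fun k => by
  obtain ⟨s, hs, hb⟩ := hE k
  refine ⟨_, Λ.mul _ _ hs hr, fun i x => (hb i x).trans ?_⟩
  have := mul_le_mul_of_nonneg_left (hg i x) (Λ.nonneg _ hs i x)
  linarith

theorem mono' (hE : Λ.Bdd g E) (hg : ∀ i x, g i x ≤ h i x) : Λ.Bdd h E :=
  hE.mono (Λ.const 1 zero_le_one) (fun i x => by simpa using hg i x)

theorem add (hg : ∀ i x, 0 ≤ g i x) (hE : Λ.Bdd g E) (hF : Λ.Bdd g F) :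
    Λ.Bdd g (fun i => E i + F i) := fun k => by
  obtain ⟨s, hs, hb⟩ := hE k
  obtain ⟨t, ht, hc⟩ := hF k
  refine ⟨_, Λ.add _ _ hs ht, fun i x => ?_⟩
  have := hg i x
  rw [iter_D_add, Sm.coe_add', add_mul]
  exact (abs_add_le _ _).trans (add_le_add (hb i x) (hc i x))

theorem neg (hE : Λ.Bdd g E) : Λ.Bdd g (fun i => -E i) := fun k => by
  obtain ⟨s, hs, hb⟩ := hE k
  exact ⟨s, hs, fun i x => by rw [iter_D_neg, Sm.coe_neg', abs_neg]; exact hb i x⟩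

theorem sub (hg : ∀ i x, 0 ≤ g i x) (hE : Λ.Bdd g E) (hF : Λ.Bdd g F) :
    Λ.Bdd g (fun i => E i - F i) := by
  simpa only [sub_eq_add_neg] using add hg hE hF.neg

theorem mul (hE : Λ.Bdd g E) (hF : Λ.Bdd h F) :
    Λ.Bdd (fun i x => g i x * h i x) (fun i => E i * F i) := fun k => by
  -- The induction runs over all pairs at once, since Leibniz replaces `E * F` by `E * D F + D E *
  -- F`.
  induction k generalizing E F with
  | zero =>
    obtain ⟨s, hs, hb⟩ := hE 0
    obtain ⟨t, ht, hc⟩ := hF 0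
    refine ⟨_, Λ.mul _ _ hs ht, fun i x => ?_⟩
    have h1 := hb i x
    have h2 := hc i x
    simp only [Function.iterate_zero, id_eq, Sm.coe_mul'] at h1 h2 ⊢
    rw [abs_mul]
    calc _ ≤ (s i x * g i x) * (t i x * h i x) :=
          mul_le_mul h1 h2 (abs_nonneg _) ((abs_nonneg _).trans h1)
      _ = _ := by ring
  | succ k ih =>
    obtain ⟨s, hs, hb⟩ := ih hE hF.deriv
    obtain ⟨t, ht, hc⟩ := ih hE.deriv hF
    refine ⟨_, Λ.add _ _ hs ht, fun i x => ?_⟩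
    rw [Function.iterate_succ_apply, D_mul, mul_comm (F i), iter_D_add, Sm.coe_add', add_mul]
    exact (abs_add_le _ _).trans (add_le_add (hb i x) (hc i x))

theorem const {c : ι → ℝ} {r : ι → ℝ → ℝ} (hr : Λ.mem r) (hg : ∀ i x, 0 ≤ g i x)
    (hc : ∀ i x, |c i| ≤ r i x * g i x) : Λ.Bdd g (fun i => cst (c i)) := fun k => by
  refine ⟨r, hr, fun i x => ?_⟩
  cases k with
  | zero => simpa using hc i x
  | succ k =>
    rw [iter_D_cst]
    simpa using mul_nonneg (Λ.nonneg _ hr i x) (hg i x)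

theorem const_mul (c : ℝ) (hE : Λ.Bdd g E) :
    Λ.Bdd g (fun i => cst c * E i) := fun k => by
  obtain ⟨s, hs, hb⟩ := hE k
  refine ⟨_, Λ.mul _ _ (Λ.const |c| (abs_nonneg c)) hs, fun i x => ?_⟩
  rw [iter_D_cst_mul, Sm.coe_mul', cst_apply, abs_mul, mul_assoc]
  exact mul_le_mul_of_nonneg_left (hb i x) (abs_nonneg c)

end Bdd
end Slack

/-! ### Decay weights on the line. -/

/-- Factors of polynomial growth. -/
def polySlack : Slack Unit where
  mem s := (∀ i x, 0 ≤ s i x) ∧ ∃ (C : ℝ) (n : ℕ), 0 ≤ C ∧ ∀ i x, s i x ≤ C * (1 + |x|) ^ n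
  nonneg s hs := hs.1
  add s t hs ht := by
    obtain ⟨h1, C, n, hC, hs⟩ := hs
    obtain ⟨h2, C', n', hC', ht⟩ := ht
    refine ⟨fun i x => add_nonneg (h1 i x) (h2 i x), C + C', n + n', by positivity, fun i x => ?_⟩
    have h0 : (1 : ℝ) ≤ 1 + |x| := by have := abs_nonneg x; linarith
    have e1 : (1 + |x|) ^ n ≤ (1 + |x|) ^ (n + n') := pow_le_pow_right₀ h0 (by omega)
    have e2 : (1 + |x|) ^ n' ≤ (1 + |x|) ^ (n + n') := pow_le_pow_right₀ h0 (by omega)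
    have := mul_le_mul_of_nonneg_left e1 hC
    have := mul_le_mul_of_nonneg_left e2 hC'
    have := hs i x
    have := ht i x
    linarith
  mul s t hs ht := by
    obtain ⟨h1, C, n, hC, hs⟩ := hs
    obtain ⟨h2, C', n', hC', ht⟩ := ht
    refine ⟨fun i x => mul_nonneg (h1 i x) (h2 i x), C * C', n + n', by positivity, fun i x => ?_⟩
    calc _ ≤ (C * (1 + |x|) ^ n) * (C' * (1 + |x|) ^ n') :=
          mul_le_mul (hs i x) (ht i x) (h2 i x) ((h1 i x).trans (hs i x))
      _ = _ := by ring
  const c hc := ⟨fun _ _ => hc, c, 0, hc, fun i x => by simp⟩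

/-- Smooth functions bounded, with all derivatives, by the weight `w` up to polynomials. -/
def Gr (w : ℝ → ℝ) (f : Sm) : Prop := polySlack.Bdd (fun _ => w) (fun _ => f)

theorem gr_iff {w : ℝ → ℝ} (hw : ∀ x, 0 ≤ w x) {f : Sm} : Gr w f ↔
    ∀ k : ℕ, ∃ (C : ℝ) (n : ℕ), 0 ≤ C ∧ ∀ x, |((D^[k]) f).1 x| ≤ C * (1 + |x|) ^ n * w x := by
  constructor
  · intro h k
    obtain ⟨s, ⟨_, C, n, hC, hs⟩, hb⟩ := h k
    exact ⟨C, n, hC, fun x => (hb () x).trans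
      (mul_le_mul_of_nonneg_right (hs () x) (hw x))⟩
  · intro h k
    obtain ⟨C, n, hC, hb⟩ := h k
    exact ⟨fun _ x => C * (1 + |x|) ^ n, ⟨fun i x => by positivity, C, n, hC, fun _ _ => le_rfl⟩,
      fun _ x => hb x⟩

/-- Weight of functions decaying at `-∞`. -/
def wL (x : ℝ) : ℝ := min 1 (Real.exp x)
/-- Weight of functions decaying at `+∞`. -/
def wR (x : ℝ) : ℝ := min 1 (Real.exp (-x))
/-- Weight of functions decaying at both ends. -/
def wY (x : ℝ) : ℝ := Real.exp (-|x|)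
/-- The trivial weight. -/
def w1 (_ : ℝ) : ℝ := 1

theorem wL_pos (x : ℝ) : 0 < wL x := lt_min one_pos (Real.exp_pos _)
theorem wR_pos (x : ℝ) : 0 < wR x := lt_min one_pos (Real.exp_pos _)
theorem wY_pos (x : ℝ) : 0 < wY x := Real.exp_pos _
theorem w1_pos (x : ℝ) : 0 < w1 x := one_pos

theorem wL_mul_wR (x : ℝ) : wL x * wR x = wY x := by
  unfold wL wR wY
  rcases le_total 0 x with h | h
  · rw [min_eq_left (Real.one_le_exp h), min_eq_right (Real.exp_le_one_iff.2 (by linarith)),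
      abs_of_nonneg h, one_mul]
  · rw [min_eq_right (Real.exp_le_one_iff.2 h), min_eq_left (Real.one_le_exp (by linarith)),
      abs_of_nonpos h, mul_one, neg_neg]

theorem wL_le (x : ℝ) : wL x ≤ 1 := min_le_left _ _
theorem wR_le (x : ℝ) : wR x ≤ 1 := min_le_left _ _
theorem wY_le_wL (x : ℝ) : wY x ≤ wL x := by
  rw [← wL_mul_wR]; exact mul_le_of_le_one_right (wL_pos x).le (wR_le x)
theorem wY_le_wR (x : ℝ) : wY x ≤ wR x := by
  rw [← wL_mul_wR]; exact mul_le_of_le_one_left (wR_pos x).le (wL_le x)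

namespace Gr

variable {w w' : ℝ → ℝ} {f g : Sm}

theorem deriv (h : Gr w f) : Gr w (D f) := Slack.Bdd.deriv h
theorem neg (h : Gr w f) : Gr w (-f) := Slack.Bdd.neg h
theorem add (hw : ∀ x, 0 < w x) (hf : Gr w f) (hg : Gr w g) : Gr w (f + g) :=
  Slack.Bdd.add (fun _ x => (hw x).le) hf hg
theorem sub (hw : ∀ x, 0 < w x) (hf : Gr w f) (hg : Gr w g) : Gr w (f - g) :=
  Slack.Bdd.sub (fun _ x => (hw x).le) hf hg
theorem mul (hf : Gr w f) (hg : Gr w' g) :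
    Gr (fun x => w x * w' x) (f * g) :=
  Slack.Bdd.mul hf hg
theorem mono (h : Gr w f) (hw : ∀ x, w x ≤ w' x) : Gr w' f :=
  Slack.Bdd.mono' h fun _ x => hw x

theorem one_mul (hf : Gr w1 f) (hg : Gr w g) : Gr w (f * g) :=
  (mul hf hg).mono fun x => by simp [w1]
theorem mul_one (hf : Gr w f) (hg : Gr w1 g) : Gr w (f * g) :=
  (mul hf hg).mono fun x => by simp [w1]

theorem toL (h : Gr wY f) : Gr wL f := h.mono wY_le_wL
theorem toR (h : Gr wY f) : Gr wR f := h.mono wY_le_wR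
theorem L1 (h : Gr wL f) : Gr w1 f := h.mono wL_le
theorem R1 (h : Gr wR f) : Gr w1 f := h.mono wR_le
theorem Y1 (h : Gr wY f) : Gr w1 f := h.toL.L1

theorem cst (c : ℝ) : Gr w1 (BBM.cst c) :=
  Slack.Bdd.const (Λ := polySlack) (r := fun _ _ => |c|) (polySlack.const _ (abs_nonneg c))
    (fun _ x => (w1_pos x).le) (fun _ x => by simp [w1])

theorem one : Gr w1 1 := by simpa using cst 1

theorem cst_mul (c : ℝ) (hf : Gr w f) : Gr w (BBM.cst c * f) :=
  one_mul (cst c) hf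

theorem ofNat (n : ℕ) [n.AtLeastTwo] : Gr w1 (OfNat.ofNat n) := by
  rw [← cst_ofNat]; exact cst _

theorem zero : Gr w 0 := fun k =>
  ⟨fun _ _ => 0, ⟨fun _ _ => le_rfl, 0, 0, le_rfl, by simp⟩, fun _ x => by
    have : D^[k] (0 : Sm) = 0 := by simp
    simp [this]⟩

/-- It suffices to bound the function and all derivatives of the derivative. -/
theorem of_deriv (hw : ∀ x, 0 ≤ w x) {C : ℝ} {n : ℕ} (hC : 0 ≤ C)
    (h0 : ∀ x, |f.1 x| ≤ C * (1 + |x|) ^ n * w x) (h1 : Gr w (D f)) : Gr w f := by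
  rw [gr_iff hw] at *
  intro k
  cases k with
  | zero => exact ⟨C, n, hC, h0⟩
  | succ k => exact h1 k

theorem bound (hw : ∀ x, 0 ≤ w x) (h : Gr w f) :
    ∃ (C : ℝ) (n : ℕ), 0 ≤ C ∧ ∀ x, |f.1 x| ≤ C * (1 + |x|) ^ n * w x :=
  (gr_iff hw).1 h 0

theorem pow (hf : Gr w1 f) (n : ℕ) : Gr w1 (f ^ n) := by
  induction n with
  | zero => simpa using one
  | succ n ih => rw [pow_succ]; exact mul_one ih hf

end Gr

theorem gr_zz : Gr w1 zz :=
  Gr.of_deriv (C := 1) (n := 1) (fun x => (w1_pos x).le) zero_le_one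
    (fun x => by simp [w1]) (by simp [Gr.one])

/-- Polynomials in `z` and `tanh (z/2)`. -/
inductive Poly : Sm → Prop
  | cst (c : ℝ) : Poly (cst c)
  | zz : Poly zz
  | ph : Poly ph
  | add {f g : Sm} : Poly f → Poly g → Poly (f + g)
  | mul {f g : Sm} : Poly f → Poly g → Poly (f * g)

theorem Poly.bound {f : Sm} (h : Poly f) :
    ∃ (C : ℝ) (n : ℕ), 0 ≤ C ∧ ∀ x, |f.1 x| ≤ C * (1 + |x|) ^ n := by
  induction h with
  | cst c => exact ⟨|c|, 0, abs_nonneg c, fun x => by simp⟩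
  | zz => exact ⟨1, 1, zero_le_one, fun x => by simp⟩
  | ph => exact ⟨1, 0, zero_le_one, fun x => by
      have := ph_lt_one x; have := neg_one_lt_ph x
      simpa using abs_le.2 ⟨by linarith, by linarith⟩⟩
  | @add f g _ _ hf hg =>
    obtain ⟨C, n, hC, h1⟩ := hf
    obtain ⟨C', n', hC', h2⟩ := hg
    obtain ⟨_, C₀, n₀, h0, h3⟩ := polySlack.add (fun _ x => C * (1 + |x|) ^ n)
      (fun _ x => C' * (1 + |x|) ^ n') ⟨fun _ _ => by positivity, C, n, hC, fun _ _ => le_rfl⟩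
      ⟨fun _ _ => by positivity, C', n', hC', fun _ _ => le_rfl⟩
    exact ⟨C₀, n₀, h0, fun x => (abs_add_le _ _).trans
      ((add_le_add (h1 x) (h2 x)).trans (h3 () x))⟩
  | @mul f g _ _ hf hg =>
    obtain ⟨C, n, hC, h1⟩ := hf
    obtain ⟨C', n', hC', h2⟩ := hg
    refine ⟨C * C', n + n', by positivity, fun x => ?_⟩
    rw [Sm.coe_mul', abs_mul]
    calc _ ≤ (C * (1 + |x|) ^ n) * (C' * (1 + |x|) ^ n') :=
          mul_le_mul (h1 x) (h2 x) (abs_nonneg _) (by positivity)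
      _ = _ := by ring

theorem Poly.deriv {f : Sm} (h : Poly f) : Poly (D f) := by
  induction h with
  | cst c => simpa using Poly.cst 0
  | zz => simpa using Poly.cst 1
  | ph =>
    have : D BBM.ph = BBM.cst (1 / 2) + BBM.cst (-(1 / 2)) * (BBM.ph * BBM.ph) := by
      rw [D_ph, qq_eq]; apply Sm.ext'; intro x; simp; ring
    rw [this]
    exact .add (.cst _) (.mul (.cst _) (.mul .ph .ph))
  | add _ _ hf hg => rw [map_add]; exact .add hf hg
  | mul h1 h2 hf hg => rw [D_mul]; exact .add (.mul h1 hg) (.mul h2 hf)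

/-- Because `Q' = -φQ`, one has `(fQ)' = (f' - fφ)Q`, and polynomials in `z` and `φ` are closed
under this operation. All derivatives are therefore covered by the undifferentiated bound. -/
theorem Poly.mul_qq {f : Sm} (h : Poly f) : Gr wY (f * qq) := by
  rw [gr_iff fun x => (wY_pos x).le]
  intro k
  induction k generalizing f with
  | zero =>
    obtain ⟨C, n, hC, hb⟩ := h.bound
    refine ⟨C * 6, n, by positivity, fun x => ?_⟩
    have := qq_le x
    have := (qq_pos x).le
    simp only [Function.iterate_zero, id_eq, Sm.coe_mul', abs_mul, abs_of_nonneg this, wY]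
    calc _ ≤ (C * (1 + |x|) ^ n) * (6 * Real.exp (-|x|)) :=
          mul_le_mul (hb x) (qq_le x) this (by positivity)
      _ = _ := by ring
  | succ k ih =>
    have : D (f * qq) = (D f + BBM.cst (-1) * (f * BBM.ph)) * qq := by
      rw [D_mul, D_qq, cst_neg, cst_one]; ring
    rw [Function.iterate_succ_apply, this]
    exact ih (.add h.deriv (.mul (.cst _) (.mul h Poly.ph)))

theorem gr_qq : Gr wY qq := by simpa using (Poly.cst 1).mul_qq

theorem gr_ph : Gr w1 ph :=
  Gr.of_deriv (C := 1) (n := 0) (fun x => (w1_pos x).le) zero_le_one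
    (fun x => by
      have := ph_lt_one x; have := neg_one_lt_ph x
      simpa [w1] using abs_le.2 ⟨by linarith, by linarith⟩)
    (by rw [D_ph]; exact (Gr.cst_mul _ gr_qq).Y1)

theorem gr_one_sub_ph : Gr wR (1 - ph) :=
  Gr.of_deriv (C := 2) (n := 0) (fun x => (wR_pos x).le) zero_le_two
    (fun x => by
      have h1 := ph_lt_one x; have h2 := neg_one_lt_ph x; have h3 := one_sub_ph_le x
      simp only [Sm.coe_sub', Sm.coe_one', pow_zero, _root_.mul_one, wR]
      rw [abs_of_pos (by linarith), mul_min_of_nonneg _ _ zero_le_two]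
      exact le_min (by linarith) h3)
    (by simpa [D_ph] using (Gr.cst_mul (1 / 3) gr_qq).toR.neg)

theorem gr_one_add_ph : Gr wL (1 + ph) :=
  Gr.of_deriv (C := 2) (n := 0) (fun x => (wL_pos x).le) zero_le_two
    (fun x => by
      have h1 := ph_lt_one x; have h2 := neg_one_lt_ph x; have h3 := one_add_ph_le x
      simp only [Sm.coe_add', Sm.coe_one', pow_zero, _root_.mul_one, wL]
      rw [abs_of_pos (by linarith), mul_min_of_nonneg _ _ zero_le_two]
      exact le_min (by linarith) h3)
    (by simpa [D_ph] using (Gr.cst_mul (1 / 3) gr_qq).toL)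

theorem mem_classY_iff (f : Sm) : f.1 ∈ classY ↔ Gr wY f := by
  rw [gr_iff fun x => (wY_pos x).le]
  constructor
  · rintro ⟨_, h⟩ k
    obtain ⟨C, r, hC, hr, hb⟩ := h k
    refine ⟨C, ⌈r⌉₊, hC.le, fun x => ?_⟩
    rw [iter_D_coe]
    refine (hb x).trans ?_
    unfold wY
    gcongr
    rw [← Real.rpow_natCast]
    exact Real.rpow_le_rpow_of_exponent_le (by linarith [abs_nonneg x]) (Nat.le_ceil r)
  · intro h
    refine ⟨Sm.contDiff f, fun k => ?_⟩
    obtain ⟨C, n, hC, hb⟩ := h k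
    -- The increments only serve the strict positivity of the constant and of the exponent in
    -- `classY`.
    refine ⟨C + 1, n + 1, by positivity, by positivity, fun x => ?_⟩
    rw [← iter_D_coe]
    refine (hb x).trans ?_
    unfold wY
    have h1 : (1 : ℝ) ≤ 1 + |x| := by linarith [abs_nonneg x]
    have : ((n : ℝ) + 1) = ((n + 1 : ℕ) : ℝ) := by push_cast; ring
    rw [this, Real.rpow_natCast]
    gcongr
    · linarith
    · omega

/-! ### Decay of a function from decay of its derivative. -/

theorem one_add_pow_le_exp (n : ℕ) :
    ∃ C : ℝ, 0 ≤ C ∧ ∀ t : ℝ, 0 ≤ t → (1 + t) ^ n ≤ C * Real.exp (t / 2) := by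
  refine ⟨n.factorial * 2 ^ n * Real.exp (1 / 2), by positivity, fun t ht => ?_⟩
  have h := Real.pow_div_factorial_le_exp ((1 + t) / 2) (by positivity) n
  have e : Real.exp ((1 + t) / 2) = Real.exp (1 / 2) * Real.exp (t / 2) := by
    rw [← Real.exp_add]; congr 1; ring
  rw [div_le_iff₀ (by positivity), div_pow, div_le_iff₀ (by positivity), e] at h
  linarith

/-- Comparison with the barrier `b(x) = 2C(N + x)ⁿe^{-x}`: its slope is at most `-C(1 + x)ⁿe^{-x}`,
so `±f + b` is nonincreasing with limit `0`, hence nonnegative. -/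
theorem abs_le_of_abs_deriv_le {f : ℝ → ℝ} {f' : ℝ → ℝ} (hf : ∀ x, HasDerivAt f (f' x) x)
    {C : ℝ} {n : ℕ} (hb : ∀ x, 0 ≤ x → |f' x| ≤ C * (1 + x) ^ n * Real.exp (-x))
    (h0 : Tendsto f atTop (𝓝 0)) {x : ℝ} (hx : 0 ≤ x) :
    |f x| ≤ 2 * C * (2 * n + 1) ^ n * (1 + x) ^ n * Real.exp (-x) := by
  have hC : 0 ≤ C := by simpa using (abs_nonneg _).trans (hb 0 le_rfl)
  -- With this shift `n(N + x)^{n-1} ≤ ½(N + x)ⁿ`, so differentiating the polynomial factor costs at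
  -- most half of the decay of the exponential.
  set N : ℝ := 2 * n + 1 with hN
  have hn : (0 : ℝ) ≤ n := n.cast_nonneg
  let b : ℝ → ℝ := fun x => 2 * C * ((N + x) ^ n * Real.exp (-x))
  have hbd : ∀ x, HasDerivAt b
      (2 * C * ((n * (N + x) ^ (n - 1)) * Real.exp (-x) - (N + x) ^ n * Real.exp (-x))) x := by
    intro x
    have h1 : HasDerivAt (fun x : ℝ => (N + x) ^ n) (n * (N + x) ^ (n - 1) * 1) x :=
      ((hasDerivAt_id x).const_add N).pow n
    have h2 : HasDerivAt (fun x : ℝ => Real.exp (-x)) (Real.exp (-x) * (-1)) x :=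
      (hasDerivAt_neg x).exp
    refine ((h1.mul h2).const_mul (2 * C)).congr_deriv ?_
    ring
  have hble : ∀ x, 0 ≤ x → 2 * C * ((n * (N + x) ^ (n - 1)) * Real.exp (-x)
      - (N + x) ^ n * Real.exp (-x)) ≤ -(C * (1 + x) ^ n * Real.exp (-x)) := by
    intro x hx
    have e1 : n * (N + x) ^ (n - 1) ≤ 1 / 2 * (N + x) ^ n := by
      rcases Nat.eq_zero_or_pos n with h | h
      · subst h; simp
      · obtain ⟨m, rfl⟩ := Nat.exists_eq_succ_of_ne_zero h.ne'
        have : (0 : ℝ) ≤ (N + x) ^ m := by positivity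
        simp only [Nat.succ_eq_add_one, Nat.add_sub_cancel, pow_succ] at *
        nlinarith
    have e2 : (1 + x) ^ n ≤ (N + x) ^ n := by gcongr; linarith
    have e3 := Real.exp_pos (-x)
    have : 2 * C * ((n * (N + x) ^ (n - 1)) * Real.exp (-x) - (N + x) ^ n * Real.exp (-x))
        = C * Real.exp (-x) * (2 * (n * (N + x) ^ (n - 1)) - 2 * (N + x) ^ n) := by ring
    rw [this, show -(C * (1 + x) ^ n * Real.exp (-x)) = C * Real.exp (-x) * (-(1 + x) ^ n) by ring]
    exact mul_le_mul_of_nonneg_left (by linarith) (by positivity)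
  have hlim : Tendsto b atTop (𝓝 0) := by
    obtain ⟨A, hA, hA'⟩ := one_add_pow_le_exp n
    have hz : Tendsto (fun x : ℝ => 2 * C * (N ^ n * A) * Real.exp (-(x / 2))) atTop (𝓝 0) := by
      rw [← mul_zero (2 * C * (N ^ n * A))]
      exact (Real.tendsto_exp_neg_atTop_nhds_zero.comp
        (tendsto_id.atTop_div_const two_pos)).const_mul _
    refine squeeze_zero' ?_ ?_ hz
    · filter_upwards [eventually_ge_atTop 0] with x hx
      positivity
    · filter_upwards [eventually_ge_atTop 0] with x hx
      have e1 : (N + x) ^ n ≤ N ^ n * (1 + x) ^ n := by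
        rw [← mul_pow]; gcongr; nlinarith
      have e2 := hA' x hx
      have e3 : Real.exp (x / 2) * Real.exp (-x) = Real.exp (-(x / 2)) := by
        rw [← Real.exp_add]; congr 1; ring
      calc b x ≤ 2 * C * ((N ^ n * (A * Real.exp (x / 2))) * Real.exp (-x)) := by
            simp only [b]; gcongr
            exact e1.trans (mul_le_mul_of_nonneg_left e2 (by positivity))
        _ = _ := by rw [← e3]; ring
  have key : ∀ g g' : ℝ → ℝ, (∀ x, HasDerivAt g (g' x) x) →
      (∀ x, 0 ≤ x → g' x ≤ C * (1 + x) ^ n * Real.exp (-x)) → Tendsto g atTop (𝓝 0) →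
      0 ≤ g x + b x := by
    intro g g' hg hg' hg0
    have hanti : AntitoneOn (fun t => g t + b t) (Set.Ici 0) := by
      refine antitoneOn_of_hasDerivWithinAt_nonpos (convex_Ici 0)
        (fun t _ => ((hg t).add (hbd t)).continuousAt.continuousWithinAt)
        (fun t _ => ((hg t).add (hbd t)).hasDerivWithinAt) (fun t ht => ?_)
      rw [interior_Ici] at ht
      have h1 := hg' t (le_of_lt ht)
      have h2 := hble t (le_of_lt ht)
      linarith
    have hl : Tendsto (fun t => g t + b t) atTop (𝓝 0) := by simpa using hg0.add hlim
    refine le_of_tendsto hl ?_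
    filter_upwards [eventually_ge_atTop x] with t ht
    exact hanti hx (hx.trans ht) ht
  have k1 := key f f' hf (fun x hx => (le_abs_self _).trans (hb x hx)) h0
  have k2 := key (fun t => -f t) (fun t => -f' t) (fun t => (hf t).neg)
    (fun x hx => (neg_le_abs _).trans (hb x hx)) (by simpa using h0.neg)
  have hfin : b x ≤ 2 * C * N ^ n * (1 + x) ^ n * Real.exp (-x) := by
    have e1 : (N + x) ^ n ≤ N ^ n * (1 + x) ^ n := by
      rw [← mul_pow]; gcongr; nlinarith
    calc b x ≤ 2 * C * ((N ^ n * (1 + x) ^ n) * Real.exp (-x)) := by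
          simp only [b]; gcongr
      _ = _ := by ring
  exact (abs_le.2 ⟨by linarith, by linarith⟩).trans hfin

theorem wR_of_nonneg {x : ℝ} (h : 0 ≤ x) : wR x = Real.exp (-x) :=
  min_eq_right (Real.exp_le_one_iff.2 (by linarith))
theorem wR_of_nonpos {x : ℝ} (h : x ≤ 0) : wR x = 1 := min_eq_left (Real.one_le_exp (by linarith))
theorem wL_neg (x : ℝ) : wL (-x) = wR x := rfl
theorem wR_neg (x : ℝ) : wR (-x) = wL x := by unfold wR wL; rw [neg_neg]
theorem wY_neg (x : ℝ) : wY (-x) = wY x := by unfold wY; rw [abs_neg]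
theorem wY_of_nonneg {x : ℝ} (h : 0 ≤ x) : wY x = wR x := by
  rw [wR_of_nonneg h, wY, abs_of_nonneg h]
theorem wY_of_nonpos {x : ℝ} (h : x ≤ 0) : wY x = wL x := by
  rw [← wY_neg, ← wR_neg, wY_of_nonneg (by linarith)]

theorem Gr.rfl' {w : ℝ → ℝ} {f : Sm} (h : Gr w f) : Gr (fun x => w (-x)) (BBM.rfl' f) := fun k => by
  obtain ⟨s, ⟨h1, C, n, hC, hs⟩, hb⟩ := h k
  refine ⟨fun i x => s i (-x), ⟨fun i x => h1 i (-x), C, n, hC, fun i x => ?_⟩, fun i x => ?_⟩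
  · simpa using hs i (-x)
  · have : ∀ k (f : Sm), |(D^[k] (BBM.rfl' f)).1 x| = |(D^[k] f).1 (-x)| := by
      intro k
      induction k with
      | zero => intro f; rfl
      | succ k ih =>
        intro f
        rw [Function.iterate_succ_apply, Function.iterate_succ_apply, D_rfl', iter_D_neg,
          Sm.coe_neg', abs_neg, ih]
    rw [this]
    exact hb i (-x)

theorem Gr.rflR {f : Sm} (h : Gr wL f) : Gr wR (BBM.rfl' f) := by
  simpa only [wL_neg] using h.rfl'
theorem Gr.rflL {f : Sm} (h : Gr wR f) : Gr wL (BBM.rfl' f) := by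
  simpa only [wR_neg] using h.rfl'
theorem Gr.rflY {f : Sm} (h : Gr wY f) : Gr wY (BBM.rfl' f) := by
  simpa only [wY_neg] using h.rfl'

theorem rfl'_rfl' (f : Sm) : rfl' (rfl' f) = f := Sm.ext' fun x => by simp

/-- To the right of the origin one compares from `+∞`. To the left the weight is `1` and the mean
value inequality from `0` costs one power of `1 + |x|`. -/
theorem gr_R_of_deriv {f : Sm} (h : Gr wR (D f)) (h0 : Tendsto f.1 atTop (𝓝 0)) : Gr wR f := by
  obtain ⟨C, n, hC, hb⟩ := h.bound fun x => (wR_pos x).le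
  have hn : (0 : ℝ) ≤ n := n.cast_nonneg
  refine Gr.of_deriv (C := 2 * C * (2 * n + 1) ^ n + (|f.1 0| + C)) (n := n + 1)
    (fun x => (wR_pos x).le) (by positivity) (fun x => ?_) h
  rcases le_total 0 x with hx | hx
  · rw [wR_of_nonneg hx, abs_of_nonneg hx]
    have := abs_le_of_abs_deriv_le (hasDerivAt f) (C := C) (n := n)
      (fun x hx => by simpa [wR_of_nonneg hx, abs_of_nonneg hx] using hb x) h0 hx
    refine this.trans ?_
    have e1 : (1 + x) ^ n ≤ (1 + x) ^ (n + 1) := pow_le_pow_right₀ (by linarith) (by omega)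
    have e2 : 0 ≤ |f.1 0| + C := by positivity
    gcongr
    linarith
  · rw [wR_of_nonpos hx, mul_one]
    have hmv : |f.1 x - f.1 0| ≤ C * (1 + |x|) ^ n * |x - 0| := by
      have := (convex_Icc x 0).norm_image_sub_le_of_norm_hasDerivWithin_le
        (f := f.1) (f' := (D f).1) (C := C * (1 + |x|) ^ n)
        (fun t _ => (hasDerivAt f t).hasDerivWithinAt) (fun t ht => ?_)
        (Set.right_mem_Icc.2 hx) (Set.left_mem_Icc.2 hx)
      · simpa [Real.norm_eq_abs] using this
      · rw [Real.norm_eq_abs]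
        refine (hb t).trans ?_
        have h1 : |t| ≤ |x| := by
          rw [abs_of_nonpos ht.2, abs_of_nonpos hx]; linarith [ht.1]
        calc C * (1 + |t|) ^ n * wR t ≤ C * (1 + |t|) ^ n * 1 := by
              gcongr; exact wR_le t
          _ ≤ C * (1 + |x|) ^ n := by rw [mul_one]; gcongr
    rw [sub_zero] at hmv
    have h1 : |f.1 x| ≤ |f.1 0| + C * (1 + |x|) ^ n * |x| := by
      have := abs_sub_abs_le_abs_sub (f.1 x) (f.1 0); linarith
    refine h1.trans ?_
    have hx0 := abs_nonneg x
    have e1 : (1 : ℝ) ≤ (1 + |x|) ^ (n + 1) := one_le_pow₀ (by linarith)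
    have e2 : C * (1 + |x|) ^ n * |x| ≤ C * (1 + |x|) ^ (n + 1) := by
      rw [pow_succ, ← mul_assoc]; gcongr; linarith
    have e3 : |f.1 0| * 1 ≤ |f.1 0| * (1 + |x|) ^ (n + 1) := by gcongr
    have e4 : 0 ≤ 2 * C * (2 * (n : ℝ) + 1) ^ n * (1 + |x|) ^ (n + 1) := by positivity
    linarith

theorem tendsto_rfl' {f : Sm} {l : Filter ℝ} (h : Tendsto f.1 atBot l) :
    Tendsto (rfl' f).1 atTop l := h.comp tendsto_neg_atTop_atBot
theorem tendsto_rfl'_bot {f : Sm} {l : Filter ℝ} (h : Tendsto f.1 atTop l) :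
    Tendsto (rfl' f).1 atBot l := h.comp tendsto_neg_atBot_atTop

theorem gr_L_of_deriv {f : Sm} (h : Gr wL (D f)) (h0 : Tendsto f.1 atBot (𝓝 0)) : Gr wL f := by
  rw [← rfl'_rfl' f]
  exact (gr_R_of_deriv (by simpa using h.rflR.neg) (tendsto_rfl' h0)).rflL

theorem gr_Y_of_LR {f : Sm} (hL : Gr wL f) (hR : Gr wR f) : Gr wY f := by
  rw [gr_iff fun x => (wY_pos x).le]
  rw [gr_iff fun x => (wL_pos x).le] at hL
  rw [gr_iff fun x => (wR_pos x).le] at hR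
  intro k
  obtain ⟨C, n, hC, hb⟩ := hL k
  obtain ⟨C', n', hC', hb'⟩ := hR k
  refine ⟨C + C', n + n', by positivity, fun x => ?_⟩
  have h0 : (1 : ℝ) ≤ 1 + |x| := by have := abs_nonneg x; linarith
  have e1 : (1 + |x|) ^ n ≤ (1 + |x|) ^ (n + n') := pow_le_pow_right₀ h0 (by omega)
  have e2 : (1 + |x|) ^ n' ≤ (1 + |x|) ^ (n + n') := pow_le_pow_right₀ h0 (by omega)
  have e0 := (wY_pos x).le
  rcases le_total 0 x with hx | hx
  · refine (hb' x).trans ?_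
    rw [← wY_of_nonneg hx]
    gcongr; linarith
  · refine (hb x).trans ?_
    rw [← wY_of_nonpos hx]
    gcongr; linarith

theorem gr_Y_of_deriv {f : Sm} (h : Gr wY (D f)) (h0 : Tendsto f.1 atBot (𝓝 0))
    (h1 : Tendsto f.1 atTop (𝓝 0)) : Gr wY f :=
  gr_Y_of_LR (gr_L_of_deriv h.toL h0) (gr_R_of_deriv h.toR h1)

theorem Gr.tendsto_top {f : Sm} (h : Gr wR f) : Tendsto f.1 atTop (𝓝 0) := by
  obtain ⟨C, n, hC, hb⟩ := h.bound fun x => (wR_pos x).le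
  obtain ⟨A, hA, hA'⟩ := one_add_pow_le_exp n
  have hz : Tendsto (fun x : ℝ => C * A * Real.exp (-(x / 2))) atTop (𝓝 0) := by
    rw [← mul_zero (C * A)]
    exact (Real.tendsto_exp_neg_atTop_nhds_zero.comp
      (tendsto_id.atTop_div_const two_pos)).const_mul _
  refine squeeze_zero_norm' ?_ hz
  filter_upwards [eventually_ge_atTop 0] with x hx
  rw [Real.norm_eq_abs]
  refine (hb x).trans ?_
  rw [wR_of_nonneg hx, abs_of_nonneg hx]
  have e3 : Real.exp (x / 2) * Real.exp (-x) = Real.exp (-(x / 2)) := by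
    rw [← Real.exp_add]; congr 1; ring
  calc _ ≤ C * (A * Real.exp (x / 2)) * Real.exp (-x) := by gcongr; exact hA' x hx
    _ = _ := by rw [← e3]; ring

theorem Gr.tendsto_bot {f : Sm} (h : Gr wL f) : Tendsto f.1 atBot (𝓝 0) := by
  have := tendsto_rfl'_bot h.rflR.tendsto_top
  rwa [rfl'_rfl'] at this

/-- Functions bounded, with all derivatives, by `min 1 (e^{-x/2})`. -/
def HalfDecay (f : Sm) : Prop :=
  ∀ k : ℕ, ∃ C : ℝ, 0 ≤ C ∧ ∀ x, |((D^[k]) f).1 x| ≤ C * min 1 (Real.exp (-(x / 2)))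

theorem poly_wY_le (n : ℕ) : ∃ C : ℝ, 0 ≤ C ∧ ∀ x : ℝ,
    (1 + |x|) ^ n * wY x ≤ C * min 1 (Real.exp (-(x / 2))) := by
  obtain ⟨A, hA, hA'⟩ := one_add_pow_le_exp n
  refine ⟨A, hA, fun x => ?_⟩
  have h1 : (1 + |x|) ^ n * wY x ≤ A * Real.exp (-(|x| / 2)) := by
    have e3 : Real.exp (|x| / 2) * Real.exp (-|x|) = Real.exp (-(|x| / 2)) := by
      rw [← Real.exp_add]; congr 1; ring
    rw [← e3, ← mul_assoc]
    exact mul_le_mul_of_nonneg_right (hA' _ (abs_nonneg x)) (wY_pos x).le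
  refine h1.trans (mul_le_mul_of_nonneg_left (le_min ?_ ?_) hA)
  · exact Real.exp_le_one_iff.2 (by have := abs_nonneg x; linarith)
  · exact Real.exp_le_exp.2 (by have := le_abs_self x; linarith)

theorem Gr.halfDecay {f : Sm} (h : Gr wY f) : HalfDecay f := fun k => by
  obtain ⟨C, n, hC, hb⟩ := (gr_iff fun x => (wY_pos x).le).1 h k
  obtain ⟨A, hA, hA'⟩ := poly_wY_le n
  refine ⟨C * A, by positivity, fun x => (hb x).trans ?_⟩
  rw [mul_assoc, mul_assoc]
  exact mul_le_mul_of_nonneg_left (hA' x) hC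

/-- Half of the exponential rate absorbs the polynomial factors. No decay is needed on the left,
which is why profiles with a nonzero limit at `-∞` fit the one-sided weight of the error bound. -/
theorem HalfDecay.of_gr {f : Sm} (hf : Gr wY (D f)) {l : ℝ} (h0 : Tendsto f.1 atBot (𝓝 l))
    (h1 : Tendsto f.1 atTop (𝓝 0)) : HalfDecay f := by
  have e : D (f - cst l) = D f := by simp
  have hL : Gr wL (f - cst l) := gr_L_of_deriv (by rw [e]; exact hf.toL)
    (by rw [← sub_self l]; exact h0.sub_const l)
  have hR : Gr wR f := gr_R_of_deriv hf.toR h1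
  obtain ⟨C, n, hC, hb⟩ := hL.bound fun x => (wL_pos x).le
  obtain ⟨C', n', hC', hb'⟩ := hR.bound fun x => (wR_pos x).le
  obtain ⟨A, hA, hA'⟩ := poly_wY_le n
  obtain ⟨A', hB, hB'⟩ := poly_wY_le n'
  intro k
  cases k with
  | zero =>
    refine ⟨C * A + |l| + C' * A', by positivity, fun x => ?_⟩
    have hm : 0 ≤ min 1 (Real.exp (-(x / 2))) := le_min zero_le_one (Real.exp_pos _).le
    simp only [Function.iterate_zero, id_eq]
    rcases le_total 0 x with hx | hx
    · have := hb' x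
      rw [← wY_of_nonneg hx, mul_assoc] at this
      have h2 := mul_le_mul_of_nonneg_left (hB' x) hC'
      have h3 : 0 ≤ (C * A + |l|) * min 1 (Real.exp (-(x / 2))) := by positivity
      linarith
    · have := hb x
      rw [← wY_of_nonpos hx, mul_assoc] at this
      have h2 := mul_le_mul_of_nonneg_left (hA' x) hC
      have h3 : 0 ≤ (C' * A') * min 1 (Real.exp (-(x / 2))) := by positivity
      have h4 : min 1 (Real.exp (-(x / 2))) = 1 := min_eq_left (Real.one_le_exp (by linarith))
      have h5 : |f.1 x| ≤ |(f - cst l).1 x| + |l| := by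
        have := abs_add_le ((f - cst l).1 x) l
        simpa using this
      have h6 : |l| * min 1 (Real.exp (-(x / 2))) = |l| := by rw [h4, mul_one]
      linarith
  | succ k => exact hf.halfDecay k

/-! ### Integrals -/

theorem Gr.integrable {f : Sm} (h : Gr wY f) : Integrable f.1 := by
  obtain ⟨C, n, hC, hb⟩ := h.bound fun x => (wY_pos x).le
  obtain ⟨A, hA, hA'⟩ := one_add_pow_le_exp (n + 2)
  have hi : Integrable (fun x : ℝ => C * A * (1 + x ^ 2)⁻¹) :=
    integrable_inv_one_add_sq.const_mul _
  refine hi.mono' (Sm.continuous f).aestronglyMeasurable (Eventually.of_forall fun x => ?_)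
  rw [Real.norm_eq_abs]
  refine (hb x).trans ?_
  have h1 := hA' |x| (abs_nonneg x)
  have h2 : Real.exp (|x| / 2) * wY x ≤ 1 := by
    rw [wY, ← Real.exp_add]; exact Real.exp_le_one_iff.2 (by have := abs_nonneg x; linarith)
  have h3 : 1 + x ^ 2 ≤ (1 + |x|) ^ 2 := by
    have := abs_nonneg x; rw [← sq_abs x]; nlinarith
  rw [mul_assoc, mul_assoc]
  refine mul_le_mul_of_nonneg_left ?_ hC
  rw [← div_eq_mul_inv, le_div_iff₀ (by positivity)]
  have hw := (wY_pos x).le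
  calc (1 + |x|) ^ n * wY x * (1 + x ^ 2) ≤ (1 + |x|) ^ n * wY x * (1 + |x|) ^ 2 := by gcongr
    _ = (1 + |x|) ^ (n + 2) * wY x := by ring
    _ ≤ A * Real.exp (|x| / 2) * wY x := by gcongr
    _ ≤ A * 1 := by rw [mul_assoc]; gcongr
    _ = A := by ring

/-- The integral over the line. -/
def intg (f : Sm) : ℝ := ∫ x, f.1 x

theorem intg_add {f g : Sm} (hf : Gr wY f) (hg : Gr wY g) : intg (f + g) = intg f + intg g :=
  integral_add hf.integrable hg.integrable
theorem intg_sub {f g : Sm} (hf : Gr wY f) (hg : Gr wY g) : intg (f - g) = intg f - intg g :=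
  integral_sub hf.integrable hg.integrable
theorem intg_cst_mul (c : ℝ) (f : Sm) : intg (cst c * f) = c * intg f :=
  integral_const_mul c _
theorem intg_neg (f : Sm) : intg (-f) = -intg f := integral_neg _

theorem intg_rfl' (f : Sm) : intg (rfl' f) = intg f := integral_neg_eq_self f.1 volume

theorem intg_odd {f : Sm} (h : rfl' f = -f) : intg f = 0 := by
  have := intg_rfl' f
  rw [h, intg_neg] at this
  linarith

theorem intg_D {f : Sm} {a b : ℝ} (h : Gr wY (D f)) (ha : Tendsto f.1 atBot (𝓝 a))
    (hb : Tendsto f.1 atTop (𝓝 b)) : intg (D f) = b - a :=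
  integral_of_hasDerivAt_of_tendsto (hasDerivAt f) h.integrable ha hb

theorem intg_D_zero {f : Sm} (h : Gr wY f) : intg (D f) = 0 := by
  rw [intg_D h.deriv h.toL.tendsto_bot h.toR.tendsto_top, sub_zero]

theorem intg_parts {f g : Sm} (h : Gr wY (f * g)) (h1 : Gr wY (f * D g)) :
    intg (f * D g) = -intg (D f * g) := by
  have h2 := intg_D_zero h
  have h3 : D f * g = D (f * g) - f * D g := by rw [D_mul]; ring
  rw [h3, intg_sub h.deriv h1, h2]; ring

set_option linter.unusedSimpArgs false

/-! ### The operators `H` and `L`, and explicit integrals. -/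

/-- The operator `1 - λ ∂ₓ²` on smooth functions. -/
def H (lam : ℝ) (f : Sm) : Sm := f - cst lam * D (D f)

/-- The linearized operator `-∂ₓ² + 1 - 2 Q`. -/
def Lo (f : Sm) : Sm := f - D (D f) - 2 * qq * f

theorem helm_coe (lam : ℝ) (f : Sm) : helm lam f.1 = (H lam f).1 := by
  funext x
  have := congrFun (iter_D_coe 2 f) x
  simp only [helm, H, Sm.coe_sub', Sm.coe_mul', cst_apply, ← this]
  rfl

/-- `Q + c x Q'`. -/
def lamQ (c : ℝ) : Sm := qq * (1 - cst c * (zz * ph))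

theorem qq_eval (x : ℝ) : qq.1 x = 3 / 2 * (1 - ph.1 x ^ 2) := by rw [qq_eq_apply]; ring

theorem D_one : D (1 : Sm) = 0 := by simp

theorem D_D_qq : D (D qq) = qq - qq ^ 2 := by
  simp only [D_qq, D_ph, D_mul, map_neg]
  apply Sm.ext'; intro x; simp [qq_eval]; ring

theorem H_add (lam : ℝ) (f g : Sm) : H lam (f + g) = H lam f + H lam g := by
  simp only [H, map_add]; ring
theorem H_sub (lam : ℝ) (f g : Sm) : H lam (f - g) = H lam f - H lam g := by
  simp only [H, map_sub]; ring
theorem H_neg (lam : ℝ) (f : Sm) : H lam (-f) = -H lam f := by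
  simp only [H, map_neg]; ring
theorem H_cst_mul (lam c : ℝ) (f : Sm) : H lam (cst c * f) = cst c * H lam f := by
  simp only [H, D_mul, D_cst, mul_zero, add_zero]; ring
theorem H_cst (lam c : ℝ) : H lam (cst c) = cst c := by simp [H]
theorem D_H (lam : ℝ) (f : Sm) : D (H lam f) = H lam (D f) := by simp [H]
theorem H_sh (lam y : ℝ) (f : Sm) : H lam (sh y f) = sh y (H lam f) := by simp [H]
theorem H_rfl' (lam : ℝ) (f : Sm) : H lam (rfl' f) = rfl' (H lam f) := by simp [H]

theorem Lo_add (f g : Sm) : Lo (f + g) = Lo f + Lo g := by simp only [Lo, map_add]; ring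
theorem Lo_sub (f g : Sm) : Lo (f - g) = Lo f - Lo g := by simp only [Lo, map_sub]; ring
theorem Lo_neg (f : Sm) : Lo (-f) = -Lo f := by simp only [Lo, map_neg]; ring
theorem Lo_cst_mul (c : ℝ) (f : Sm) : Lo (cst c * f) = cst c * Lo f := by
  simp only [Lo, D_mul, D_cst, mul_zero, add_zero]; ring
theorem Lo_rfl' (f : Sm) : Lo (rfl' f) = rfl' (Lo f) := by
  simp [Lo, Sm.map_ofNat']

theorem Lo_D_qq : Lo (D qq) = 0 := by
  have := congrArg D D_D_qq
  rw [Lo, this, map_sub, pow_two, D_mul]; ring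

/-- This is the derivative at `μ = 0` of the once integrated soliton equation `Q_μ'' - Q_μ + Q_μ² =
μ H Q_μ`. -/
theorem Lo_lamQ (lam : ℝ) : Lo (lamQ ((1 - lam) / 2)) = -H lam qq := by
  simp only [lamQ, Lo, H, D_mul, D_qq, D_ph, D_zz, map_sub, map_add, map_neg, D_cst, D_one]
  apply Sm.ext'; intro x; simp [qq_eval]; ring

theorem Lo_lamQ_half : Lo (lamQ (1 / 2)) = -qq := by
  simp only [lamQ, Lo, D_mul, D_qq, D_ph, D_zz, map_sub, map_add, map_neg, D_cst, D_one]
  apply Sm.ext'; intro x; simp [qq_eval]; ring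

theorem Lo_one : Lo 1 = 1 - 2 * qq := by simp [Lo]

theorem Gr.H {w : ℝ → ℝ} (hw : ∀ x, 0 < w x) {f : Sm} (lam : ℝ) (h : Gr w f) :
    Gr w (BBM.H lam f) :=
  Gr.sub hw h (Gr.cst_mul lam h.deriv.deriv)

theorem Gr.Lo {w : ℝ → ℝ} (hw : ∀ x, 0 < w x) {f : Sm} (h : Gr w f) : Gr w (BBM.Lo f) :=
  Gr.sub hw (Gr.sub hw h h.deriv.deriv)
    (Gr.one_mul (Gr.mul_one (Gr.ofNat 2) gr_qq.Y1) h)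

theorem gr_lamQ (c : ℝ) : Gr wY (lamQ c) :=
  Gr.mul_one gr_qq (Gr.sub w1_pos Gr.one (Gr.cst_mul c (Gr.mul_one gr_zz gr_ph)))

theorem gr_D_qq : Gr wY (D qq) := gr_qq.deriv

theorem tendsto_ph_top : Tendsto ph.1 atTop (𝓝 1) := by
  have := gr_one_sub_ph.tendsto_top.const_sub 1
  simpa using this

theorem tendsto_ph_bot : Tendsto ph.1 atBot (𝓝 (-1)) := by
  have := gr_one_add_ph.tendsto_bot.sub_const 1
  simpa using this

/-- A function whose derivative is a polynomial in `tanh (z/2)` with limits at `±∞`. -/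
theorem intg_of_poly {f g : Sm} {F : ℝ → ℝ} (hg : Gr wY g) 
    (hf : ∀ x, f.1 x = F (ph.1 x)) (hF : Continuous F) (h : Gr wY (D f)) :
    intg (D f + D g) = F 1 - F (-1) := by
  have h1 : Tendsto f.1 atTop (𝓝 (F 1)) := by
    rw [show f.1 = fun x => F (ph.1 x) from funext hf]
    exact (hF.tendsto 1).comp tendsto_ph_top
  have h2 : Tendsto f.1 atBot (𝓝 (F (-1))) := by
    rw [show f.1 = fun x => F (ph.1 x) from funext hf]
    exact (hF.tendsto (-1)).comp tendsto_ph_bot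
  rw [intg_add h hg.deriv, intg_D_zero hg, intg_D h h2 h1, add_zero]

theorem intg_qq : intg qq = 6 := by
  have e : qq = D (3 * ph) + D 0 := by
    simp only [D_mul, D_ph, D_ofNat, map_zero]
    apply Sm.ext'; intro x; simp
  have := intg_of_poly (f := 3 * ph) (g := 0) (F := fun t => 3 * t) Gr.zero
    (fun x => by simp) (by fun_prop)
    (by simpa [D_ph] using Gr.one_mul (Gr.ofNat 3) (Gr.cst_mul (1 / 3) gr_qq))
  rw [← e] at this
  rw [this]; norm_num

theorem intg_H_qq (lam : ℝ) : intg (H lam qq) = 6 := by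
  rw [H, intg_sub gr_qq (Gr.cst_mul _ gr_qq.deriv.deriv), intg_cst_mul,
    intg_D_zero gr_qq.deriv, intg_qq]; ring

/-- An explicit primitive exists: a polynomial in `φ`, which only contributes its values at `φ =
±1`, plus `z` times a decaying function, which contributes nothing. -/
theorem intg_lamQ_H (lam c : ℝ) : intg (lamQ c * H lam qq) =
    6 * (1 - lam) * (1 - c / 2) + lam * (1 - c / 3) * (36 / 5) := by
  set F : ℝ → ℝ := fun p => (1 - lam) * (1 - c / 2) * (9 / 2) * (p - p ^ 3 / 3)
    + lam * (1 - c / 3) * (27 / 4) * (p - 2 * p ^ 3 / 3 + p ^ 5 / 5) with hF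
  set f : Sm := cst ((1 - lam) * (1 - c / 2) * (9 / 2)) * (ph - cst (1 / 3) * ph ^ 3)
    + cst (lam * (1 - c / 3) * (27 / 4)) * (ph - cst (2 / 3) * ph ^ 3 + cst (1 / 5) * ph ^ 5) with hf
  set g : Sm := qq * (cst c * zz * (cst ((1 - lam) / 2) * qq + cst (lam / 3) * qq ^ 2)) with hg
  have e : lamQ c * H lam qq = D f + D g := by
    simp only [hf, hg, lamQ, H, D_D_qq]
    simp only [pow_succ, pow_zero, D_mul, D_qq, D_ph, D_zz, map_sub, map_add, map_neg, D_cst, D_one]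
    apply Sm.ext'; intro x; simp [qq_eval]; ring
  have e1 : D f = qq * (cst ((1 - lam) * (1 - c / 2)) * qq
      + cst (lam * (1 - c / 3)) * qq ^ 2) := by
    simp only [hf]
    simp only [pow_succ, pow_zero, D_mul, D_qq, D_ph, D_zz, map_sub, map_add, map_neg, D_cst, D_one]
    apply Sm.ext'; intro x; simp [qq_eval]; ring
  have hq := gr_qq.Y1
  have := intg_of_poly (f := f) (g := g) (F := F)
    (Gr.mul_one gr_qq (Gr.mul_one (Gr.cst_mul _ gr_zz)
      (Gr.add w1_pos (Gr.cst_mul _ hq) (Gr.cst_mul _ (hq.pow 2)))))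
    (fun x => by simp [hf, hF]; ring) (by fun_prop)
    (by rw [e1]; exact Gr.mul_one gr_qq
          (Gr.add w1_pos (Gr.cst_mul _ hq) (Gr.cst_mul _ (hq.pow 2))))
  rw [e, this, hF]; ring

theorem intg_lamQ_H_den (lam : ℝ) :
    intg (lamQ ((1 - lam) / 2) * H lam qq) = 3 / 10 * den lam := by
  rw [intg_lamQ_H, den]; ring

/-- The integrand is `Q` times a polynomial in `Q`, with a primitive that is a polynomial in `φ`. -/
theorem intg_D_qq_H (lam : ℝ) : intg (D qq * H lam (D qq)) =
    (1 - lam) * (6 / 5) + lam * (72 / 35) := by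
  set F : ℝ → ℝ := fun p => (1 - lam) * (9 / 2) * (p - p ^ 3 / 3)
    + (2 * lam - 2 / 3 * (1 - lam)) * (27 / 4) * (p - 2 * p ^ 3 / 3 + p ^ 5 / 5)
    - 4 / 3 * lam * (81 / 8) * (p - p ^ 3 + 3 / 5 * p ^ 5 - 1 / 7 * p ^ 7) with hF
  set f : Sm := cst ((1 - lam) * (9 / 2)) * (ph - cst (1 / 3) * ph ^ 3)
    + cst ((2 * lam - 2 / 3 * (1 - lam)) * (27 / 4)) *
      (ph - cst (2 / 3) * ph ^ 3 + cst (1 / 5) * ph ^ 5)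
    - cst (4 / 3 * lam * (81 / 8)) * (ph - ph ^ 3 + cst (3 / 5) * ph ^ 5 - cst (1 / 7) * ph ^ 7)
    with hf
  have e1 : D f = qq * (cst (1 - lam) * qq + cst (2 * lam - 2 / 3 * (1 - lam)) * qq ^ 2
      - cst (4 / 3 * lam) * qq ^ 3) := by
    simp only [hf]
    simp only [pow_succ, pow_zero, D_mul, D_qq, D_ph, D_zz, map_sub, map_add, map_neg, D_cst, D_one]
    apply Sm.ext'; intro x; simp [qq_eval]; ring
  have e : D qq * H lam (D qq) = D f + D 0 := by
    rw [e1, H, D_D_qq]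
    simp only [pow_succ, pow_zero, D_mul, D_qq, D_ph, D_zz, map_sub, map_add, map_neg, D_cst, D_one]
    apply Sm.ext'; intro x; simp [qq_eval]; ring
  have hq := gr_qq.Y1
  have := intg_of_poly (f := f) (g := 0) (F := F) Gr.zero
    (fun x => by simp [hf, hF]; ring) (by fun_prop)
    (by rw [e1]; exact Gr.mul_one gr_qq
          (Gr.sub w1_pos (Gr.add w1_pos (Gr.cst_mul _ hq) (Gr.cst_mul _ (hq.pow 2)))
            (Gr.cst_mul _ (hq.pow 3))))
  rw [e, this, hF]; ring

theorem rfl'_H_qq (lam : ℝ) : rfl' (H lam qq) = H lam qq := by rw [← H_rfl', rfl'_qq]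
theorem rfl'_D_qq : rfl' (D qq) = -D qq := by simp [D_qq]; ring
theorem rfl'_H_D_qq (lam : ℝ) : rfl' (H lam (D qq)) = -H lam (D qq) := by
  rw [← H_rfl', rfl'_D_qq, H_neg]
theorem rfl'_lamQ (c : ℝ) : rfl' (lamQ c) = lamQ c := by
  simp [lamQ]; ring

theorem eq_cst_of_D_eq_zero {f : Sm} (h : D f = 0) (a : ℝ) : f = cst (f.1 a) :=
  Sm.ext' fun x => by
    rw [cst_apply]
    exact is_const_of_deriv_eq_zero (Sm.differentiable f)
      (fun x => congrArg (fun f : Sm => f.1 x) h) x a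

/-- This is the symmetry of `L` together with `LQ' = 0`, written as a total derivative. In this form
it applies to `f` without decay, because every boundary term carries a factor `Q`, `Q'` or `Q''`. -/
theorem D_Lo_mul_qq (f : Sm) :
    D (Lo f) * qq = D (qq * Lo f + D qq * D f - D (D qq) * f) := by
  have h := Lo_D_qq
  rw [Lo, sub_sub, sub_eq_zero] at h
  have h' : D (D (D qq)) = D qq - 2 * qq * D qq := by linear_combination -h
  simp only [map_add, map_sub, D_mul, h']
  rw [Lo]; ring

theorem intg_D_Lo_mul_qq {f : Sm} (hf : Gr w1 f) : intg (D (Lo f) * qq) = 0 := by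
  rw [D_Lo_mul_qq]
  exact intg_D_zero (Gr.sub wY_pos (Gr.add wY_pos (Gr.mul_one gr_qq (hf.Lo w1_pos))
    (Gr.mul_one gr_D_qq hf.deriv)) (Gr.mul_one gr_D_qq.deriv hf))

theorem intg_H_symm (lam : ℝ) {f g : Sm} (hf : Gr wY f) (hg : Gr w1 g) :
    intg (H lam f * g) = intg (f * H lam g) := by
  have e : H lam f * g = f * H lam g + D (cst lam * (f * D g - D f * g)) := by
    simp only [H, D_mul, map_sub, D_cst]; ring
  rw [e, intg_add (Gr.mul_one hf (hg.H w1_pos lam)), intg_D_zero, add_zero]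
  · exact Gr.cst_mul _ (Gr.sub wY_pos (Gr.mul_one hf hg.deriv) (Gr.mul_one hf.deriv hg))
  · exact (Gr.cst_mul _ (Gr.sub wY_pos (Gr.mul_one hf hg.deriv) (Gr.mul_one hf.deriv hg))).deriv

/-! ### Fundamental solutions -/

/-- The hyperbolic cosine. -/
def chS : Sm := ⟨Real.cosh, (Real.contDiff_cosh : ContDiff ℝ ∞ Real.cosh)⟩
/-- The hyperbolic sine. -/
def shS : Sm := ⟨Real.sinh, (Real.contDiff_sinh : ContDiff ℝ ∞ Real.sinh)⟩
theorem D_chS : D chS = shS := D_eq_of_hasDerivAt fun x => Real.hasDerivAt_cosh x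
theorem D_shS : D shS = chS := D_eq_of_hasDerivAt fun x => Real.hasDerivAt_sinh x

theorem qq_mul_chS : qq * chS = 3 - qq := Sm.ext' fun x => by
  have h := Real.cosh_pos (x / 2)
  have h2 : Real.cosh x = 2 * Real.cosh (x / 2) ^ 2 - 1 := by
    have e := Real.cosh_two_mul (x / 2)
    have := Real.cosh_sq (x / 2)
    rw [show 2 * (x / 2) = x by ring] at e
    linarith
  simp only [Sm.coe_mul', qq, Q, chS, h2, Sm.coe_sub', Sm.coe_ofNat']
  field_simp

/-- The even growing solution of `L f = 0`. -/
def grow : Sm := chS + 6 - 10 * lamQ (1 / 2)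

/-- From `Q cosh = 3 - Q` one gets `L cosh = -6 + 2Q`. The constant `6` removes `-6` at the price of
`-12Q`, and `-10 lamQ (1/2)` contributes the missing `10Q`. -/
theorem Lo_grow : Lo grow = 0 := by
  have h1 : Lo chS = -(2 * (3 - qq)) := by
    rw [← qq_mul_chS, Lo, D_chS, D_shS]; ring
  have h2 : Lo 6 = 6 * (1 - 2 * qq) := by
    simp [Lo]; ring
  have h3 : Lo (10 * lamQ (1 / 2)) = 10 * -qq := by
    rw [← Lo_lamQ_half, ← cst_ofNat, Lo_cst_mul]
  rw [grow, Lo_sub, Lo_add, h1, h2, h3]; ring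

theorem wronskian_const {f g : Sm} (hf : Lo f = 0) (hg : Lo g = 0) (a x : ℝ) :
    f.1 x * (D g).1 x - (D f).1 x * g.1 x = f.1 a * (D g).1 a - (D f).1 a * g.1 a := by
  have h1 : D (D f) = f - 2 * qq * f := by
    rw [Lo, sub_sub, sub_eq_zero] at hf
    linear_combination -hf
  have h2 : D (D g) = g - 2 * qq * g := by
    rw [Lo, sub_sub, sub_eq_zero] at hg
    linear_combination -hg
  have : D (f * D g - D f * g) = 0 := by
    simp only [map_sub, D_mul, h1, h2]; ring
  have := eq_cst_of_D_eq_zero this a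
  simpa using congrArg (fun f : Sm => f.1 x) this

theorem ph_zero : ph.1 0 = 0 := by simp [ph]
theorem qq_zero : qq.1 0 = 3 / 2 := by rw [qq_eval, ph_zero]; norm_num
theorem D_qq_zero : (D qq).1 0 = 0 := by simp [D_qq, ph_zero]
theorem D_D_qq_zero : (D (D qq)).1 0 = -3 / 4 := by
  rw [D_D_qq]; simp [qq_zero]; norm_num
theorem grow_zero : grow.1 0 = -8 := by
  simp [grow, lamQ, chS, qq_zero]; norm_num
theorem D_grow_zero : (D grow).1 0 = 0 := by
  simp [grow, lamQ, D_chS, shS, D_qq, ph_zero]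

theorem wronskian_grow (x : ℝ) :
    (D qq).1 x * (D grow).1 x - (D (D qq)).1 x * grow.1 x = -6 := by
  rw [wronskian_const Lo_D_qq Lo_grow 0 x, D_qq_zero, D_D_qq_zero, grow_zero]; norm_num

/-- The denominators are `Q''(0) = -3/4` and `grow(0) = -8`; the two other Cauchy values at `0`
vanish by parity. The difference of the two sides has zero Cauchy data, so its Wronskians with `Q'`
and with `grow` vanish. As these two have Wronskian `-6`, the difference is zero. -/
theorem eq_of_Lo_eq_zero {f : Sm} (hf : Lo f = 0) :
    f = cst ((D f).1 0 / (-3 / 4)) * D qq + cst (f.1 0 / (-8)) * grow := by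
  set r := f - (cst ((D f).1 0 / (-3 / 4)) * D qq + cst (f.1 0 / (-8)) * grow) with hr
  have hL : Lo r = 0 := by
    rw [hr, Lo_sub, Lo_add, Lo_cst_mul, Lo_cst_mul, hf, Lo_D_qq, Lo_grow]; simp
  have h0 : r.1 0 = 0 := by
    simp [hr, D_qq_zero, grow_zero]; ring
  have h1 : (D r).1 0 = 0 := by
    simp [hr, D_D_qq_zero, D_grow_zero]
  have : r = 0 := Sm.ext' fun x => by
    have a1 := wronskian_const hL Lo_D_qq 0 x
    have a2 := wronskian_const hL Lo_grow 0 x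
    have a3 := wronskian_grow x
    rw [h0, h1] at a1 a2
    simp only [zero_mul, sub_zero] at a1 a2
    rw [Sm.coe_zero']
    linear_combination (1 / 6 * r.1 x) * a3 + 1 / 6 * (grow.1 x * a1 - (D qq).1 x * a2)
  rw [hr, sub_eq_zero] at this
  exact this

theorem tendsto_grow_top : Tendsto grow.1 atTop atTop := by
  have h1 : Tendsto (fun x : ℝ => x + (6 - 10 * (lamQ (1 / 2)).1 x)) atTop atTop := by
    refine tendsto_atTop_add_right_of_le' _ (-4) tendsto_id ?_
    have := (gr_lamQ (1 / 2)).toR.tendsto_top.eventually (gt_mem_nhds one_pos)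
    filter_upwards [this] with x hx
    linarith
  refine tendsto_atTop_mono' _ ?_ h1
  filter_upwards [eventually_ge_atTop 0] with x hx
  have h2 : x ≤ Real.cosh x :=
    (Real.self_le_sinh_iff.2 hx).trans (Real.sinh_lt_cosh x).le
  simp only [grow, Sm.coe_sub', Sm.coe_add', Sm.coe_mul', Sm.coe_ofNat', chS]
  linarith

/-- A nonzero `grow` component would be unbounded at `+∞`, while `Q'` decays. -/
theorem kernel_Lo {f : Sm} (hf : Lo f = 0) (h0 : Tendsto f.1 atTop (𝓝 0)) :
    ∃ k : ℝ, f = cst k * D qq := by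
  have e := eq_of_Lo_eq_zero hf
  refine ⟨(D f).1 0 / (-3 / 4), ?_⟩
  have hz : f.1 0 / (-8) = 0 := by
    set k := (D f).1 0 / (-3 / 4)
    set m := f.1 0 / (-8)
    have h1 : Tendsto (fun x => m * grow.1 x) atTop (𝓝 0) := by
      have := h0.sub (gr_D_qq.toR.tendsto_top.const_mul k)
      rw [mul_zero, sub_zero] at this
      refine this.congr fun x => ?_
      have := congrArg (fun f : Sm => f.1 x) e
      simp only [Sm.coe_add', Sm.coe_mul', cst_apply] at this
      linarith
    by_contra hm
    have h2 := h1.const_mul (1 / m)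
    rw [mul_zero] at h2
    refine not_tendsto_nhds_of_tendsto_atTop tendsto_grow_top 0 (h2.congr fun x => ?_)
    field_simp
  rw [hz, cst_zero, zero_mul, add_zero] at e
  exact e

theorem intg_lamQ_D_qq (lam c : ℝ) : intg (lamQ c * H lam (D qq)) = 0 :=
  intg_odd (by rw [map_mul, rfl'_lamQ, rfl'_H_D_qq]; ring)

theorem intg_D_qq_H_qq (lam : ℝ) : intg (D qq * H lam qq) = 0 :=
  intg_odd (by rw [map_mul, rfl'_D_qq, rfl'_H_qq]; ring)

theorem intg_H_D_qq (lam : ℝ) : intg (H lam (D qq)) = 0 :=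
  intg_odd (rfl'_H_D_qq lam)

theorem den_pos {lam : ℝ} (h0 : 0 ≤ lam) (h1 : lam < 1) : 0 < den lam := by
  unfold den; nlinarith [h0, h1]

theorem intg_D_qq_H_pos {lam : ℝ} (h0 : 0 ≤ lam) (h1 : lam < 1) :
    0 < intg (D qq * H lam (D qq)) := by
  rw [intg_D_qq_H]; nlinarith [h0, h1]

theorem gr_w1_of_deriv {f : Sm} (h : Gr w1 (D f)) : Gr w1 f := by
  obtain ⟨C, n, hC, hb⟩ := h.bound fun x => (w1_pos x).le
  refine Gr.of_deriv (C := |f.1 0| + C) (n := n + 1)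
    (fun x => (w1_pos x).le) (by positivity) (fun x => ?_) h
  have hmv : |f.1 x - f.1 0| ≤ C * (1 + |x|) ^ n * |x - 0| := by
    have := (convex_uIcc x 0).norm_image_sub_le_of_norm_hasDerivWithin_le
      (f := f.1) (f' := (D f).1) (C := C * (1 + |x|) ^ n)
      (fun t _ => (hasDerivAt f t).hasDerivWithinAt) (fun t ht => ?_)
      Set.right_mem_uIcc Set.left_mem_uIcc
    · simpa [Real.norm_eq_abs] using this
    · rw [Real.norm_eq_abs]
      refine (hb t).trans ?_
      have h1 : |t| ≤ |x| := by
        have := Set.abs_sub_right_of_mem_uIcc ht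
        simpa using this
      rw [w1, mul_one]
      gcongr
  rw [sub_zero] at hmv
  have h1 : |f.1 x| ≤ |f.1 0| + C * (1 + |x|) ^ n * |x| := by
    have := abs_sub_abs_le_abs_sub (f.1 x) (f.1 0); linarith
  refine h1.trans ?_
  have hx0 := abs_nonneg x
  have e1 : (1 : ℝ) ≤ (1 + |x|) ^ (n + 1) := one_le_pow₀ (by linarith)
  have e2 : C * (1 + |x|) ^ n * |x| ≤ C * (1 + |x|) ^ (n + 1) := by
    rw [pow_succ, ← mul_assoc]; gcongr; linarith
  have e3 : |f.1 0| * 1 ≤ |f.1 0| * (1 + |x|) ^ (n + 1) := by gcongr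
  rw [w1]
  linarith

/-- Solutions of the linear profile equation with homogeneous source vanish under the
orthogonality conditions. -/
theorem profile_unique {lam : ℝ} (h0 : 0 ≤ lam) (h1 : lam < 1) {f : Sm} {p q l : ℝ}
    (hf : Gr wY (D f)) (ht : Tendsto f.1 atTop (𝓝 0)) (hl : Tendsto f.1 atBot (𝓝 l))
    (he : -D (Lo f) + cst p * H lam (lamQ ((1 - lam) / 2)) + cst q * H lam (D qq) = 0)
    (o1 : intg (f * H lam (D qq)) = 0) (o2 : l = 0 → intg (f * H lam qq) = 0) :
    f = 0 ∧ p = 0 ∧ q = 0 ∧ l = 0 := by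
  set Λ := lamQ ((1 - lam) / 2) with hΛ
  have hΛY : Gr wY Λ := gr_lamQ _
  have hden := den_pos h0 h1
  -- Test against `Q`: the term `(Lf)'` and the term in `HQ'` (odd) disappear, leaving `p ∫ ΛHQ =
  -- 0`.
  have hp : p = 0 := by
    have e1 : D (Lo f) * qq = cst p * (H lam Λ * qq) + cst q * (H lam (D qq) * qq) := by
      linear_combination -qq * he
    have e2 := intg_D_Lo_mul_qq (gr_w1_of_deriv hf.Y1)
    rw [e1, intg_add (Gr.cst_mul _ (Gr.mul_one (hΛY.H wY_pos lam) gr_qq.Y1))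
      (Gr.cst_mul _ (Gr.mul_one (gr_D_qq.H wY_pos lam) gr_qq.Y1)), intg_cst_mul, intg_cst_mul,
      intg_H_symm lam hΛY gr_qq.Y1, intg_H_symm lam gr_D_qq gr_qq.Y1, intg_lamQ_H_den,
      intg_D_qq_H_qq, mul_zero, add_zero] at e2
    rcases mul_eq_zero.1 e2 with h | h
    · exact h
    · linarith
  subst hp
  have hR : Gr wR f := gr_R_of_deriv hf.toR ht
  -- Integrate once; the constant of integration vanishes by the limit at `+∞`.
  have e3 : Lo f = cst q * H lam qq := by
    have : D (Lo f - cst q * H lam qq) = 0 := by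
      rw [map_sub, D_mul, D_cst, D_H]
      rw [cst_zero, zero_mul, add_zero] at he
      linear_combination -he
    have e := eq_cst_of_D_eq_zero this 0
    have hlim : Tendsto (Lo f - cst q * H lam qq).1 atTop (𝓝 0) :=
      (Gr.sub wR_pos (hR.Lo wR_pos) (Gr.cst_mul _ (gr_qq.H wY_pos lam)).toR).tendsto_top
    have hc : (Lo f - cst q * H lam qq).1 0 = 0 :=
      tendsto_nhds_unique (by rw [e]; exact tendsto_const_nhds) hlim
    rw [hc, cst_zero, sub_eq_zero] at e
    exact e
  -- At `-∞` the left side `Lf` tends to `l`, the right side to `0`.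
  have hl0 : l = 0 := by
    have t1 : Tendsto (Lo f).1 atBot (𝓝 0) := by
      rw [e3]; exact (Gr.cst_mul _ (gr_qq.H wY_pos lam)).toL.tendsto_bot
    have t2 : Tendsto (Lo f).1 atBot (𝓝 (l - 0 - 0)) := by
      have hw : Gr wY (2 * qq * f) := Gr.mul_one (Gr.one_mul (Gr.ofNat 2) gr_qq) hR.R1
      exact (hl.sub hf.deriv.toL.tendsto_bot).sub hw.toL.tendsto_bot
    have := tendsto_nhds_unique t1 t2
    linarith
  subst hl0
  have hfY : Gr wY f := gr_Y_of_deriv hf hl ht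
  -- Since `LΛ = -HQ`, the sum `f + qΛ` lies in the kernel of `L`. The two orthogonality conditions
  -- then kill `k` and `q` separately, by parity.
  obtain ⟨k, hk⟩ := kernel_Lo (f := f + cst q * Λ)
    (by rw [Lo_add, Lo_cst_mul, e3, hΛ, Lo_lamQ]; ring)
    (Gr.add wY_pos hfY (Gr.cst_mul q hΛY)).toR.tendsto_top
  have hf' : f = cst k * D qq - cst q * Λ := by linear_combination hk
  have g1 : Gr wY (H lam (D qq)) := gr_D_qq.H wY_pos lam
  have g2 : Gr wY (H lam qq) := gr_qq.H wY_pos lam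
  have hk0 : k = 0 := by
    have e : f * H lam (D qq) = cst k * (D qq * H lam (D qq)) - cst q * (Λ * H lam (D qq)) := by
      rw [hf']; ring
    rw [e, intg_sub (Gr.cst_mul _ (Gr.mul_one gr_D_qq g1.Y1))
      (Gr.cst_mul _ (Gr.mul_one hΛY g1.Y1)), intg_cst_mul, intg_cst_mul, intg_lamQ_D_qq,
      mul_zero, sub_zero] at o1
    exact (mul_eq_zero.1 o1).resolve_right (intg_D_qq_H_pos h0 h1).ne'
  have hq0 : q = 0 := by
    have e : f * H lam qq = cst k * (D qq * H lam qq) - cst q * (Λ * H lam qq) := by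
      rw [hf']; ring
    have o2 := o2 rfl
    rw [e, intg_sub (Gr.cst_mul _ (Gr.mul_one gr_D_qq g2.Y1))
      (Gr.cst_mul _ (Gr.mul_one hΛY g2.Y1)), intg_cst_mul, intg_cst_mul, intg_D_qq_H_qq,
      mul_zero, zero_sub, neg_eq_zero, intg_lamQ_H_den] at o2
    rcases mul_eq_zero.1 o2 with h | h
    · exact h
    · linarith
  refine ⟨?_, rfl, hq0, rfl⟩
  rw [hf', hk0, hq0]; simp

/-! ### Solving the linear equation -/

/-- An antiderivative. -/
def anti (f : Sm) : Sm := ⟨fun x => ∫ t in (0 : ℝ)..x, f.1 t, by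
  have h : ∀ x, HasDerivAt (fun x => ∫ t in (0 : ℝ)..x, f.1 t) (f.1 x) x := fun x =>
    (Sm.continuous f).integral_hasStrictDerivAt 0 x |>.hasDerivAt
  change ContDiff ℝ ∞ _
  rw [contDiff_infty_iff_deriv]
  refine ⟨fun x => (h x).differentiableAt, ?_⟩
  rw [show deriv (fun x => ∫ t in (0 : ℝ)..x, f.1 t) = f.1 from funext fun x => (h x).deriv]
  exact Sm.contDiff f⟩

theorem D_anti (f : Sm) : D (anti f) = f := D_eq_of_hasDerivAt fun x =>
  (Sm.continuous f).integral_hasStrictDerivAt 0 x |>.hasDerivAt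

/-- An antiderivative vanishing at `+∞`. -/
theorem exists_anti {f : Sm} (hf : Gr wY f) :
    ∃ g : Sm, D g = f ∧ Tendsto g.1 atTop (𝓝 0) ∧ Tendsto g.1 atBot (𝓝 (-intg f)) := by
  have t1 : Tendsto (anti f).1 atTop (𝓝 (∫ t in Set.Ioi 0, f.1 t)) :=
    intervalIntegral_tendsto_integral_Ioi 0 hf.integrable.integrableOn tendsto_id
  have t2 : Tendsto (anti f).1 atBot (𝓝 (-∫ t in Set.Iic 0, f.1 t)) := by
    refine (intervalIntegral_tendsto_integral_Iic 0 hf.integrable.integrableOn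
      tendsto_id).neg.congr fun x => ?_
    exact (intervalIntegral.integral_symm _ _).symm
  set J := ∫ t in Set.Ioi 0, f.1 t
  refine ⟨anti f - cst J, by simp [D_anti], ?_, ?_⟩
  · rw [← sub_self J]; exact t1.sub_const J
  · have e : -intg f = -(∫ t in Set.Iic 0, f.1 t) - J := by
      rw [intg, ← intervalIntegral.integral_Iic_add_Ioi hf.integrable.integrableOn
        hf.integrable.integrableOn (b := 0)]
      ring
    rw [e]; exact t2.sub_const J

/-- Weight `e^{-2|x|}`. -/
def wY2 (x : ℝ) : ℝ := Real.exp (-(2 * |x|))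
/-- Weight `e^{|x|}`. -/
def wE (x : ℝ) : ℝ := Real.exp |x|

theorem wY2_pos (x : ℝ) : 0 < wY2 x := Real.exp_pos _
theorem wE_pos (x : ℝ) : 0 < wE x := Real.exp_pos _
theorem wY_mul_wY (x : ℝ) : wY x * wY x = wY2 x := by
  rw [wY, wY2, ← Real.exp_add]; congr 1; ring
theorem wE_mul_wY (x : ℝ) : wE x * wY x = 1 := by
  rw [wY, wE, ← Real.exp_add]; simp
theorem wY2_mul_wE (x : ℝ) : wY2 x * wE x = wY x := by
  rw [wY, wE, wY2, ← Real.exp_add]; congr 1; ring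

/-- The rate `2` is reduced to the rate `1` by applying the earlier comparison to `t ↦ f(t/2)`. -/
theorem abs_le_of_deriv_wY2 {f : Sm} {C : ℝ} {n : ℕ}
    (hb : ∀ x, |(D f).1 x| ≤ C * (1 + |x|) ^ n * wY2 x) (h0 : Tendsto f.1 atTop (𝓝 0))
    {x : ℝ} (hx : 0 ≤ x) :
    |f.1 x| ≤ 2 * C * (2 * n + 1) ^ n * 2 ^ n * (1 + |x|) ^ n * wY2 x := by
  have hC : 0 ≤ C := by simpa [wY2] using (abs_nonneg _).trans (hb 0)
  have hd : ∀ t : ℝ, HasDerivAt (fun t => f.1 (t / 2)) ((D f).1 (t / 2) * (1 / 2)) t := fun t =>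
    (hasDerivAt f (t / 2)).comp t ((hasDerivAt_id t).div_const 2)
  have key := abs_le_of_abs_deriv_le hd (C := C) (n := n) (fun t ht => ?_)
    (h0.comp (tendsto_id.atTop_div_const two_pos)) (x := 2 * x) (by positivity)
  · rw [show 2 * x / 2 = x by ring] at key
    refine key.trans ?_
    rw [wY2, abs_of_nonneg hx, mul_assoc _ (2 ^ n : ℝ), ← mul_pow]
    have : 1 + 2 * x ≤ 2 * (1 + x) := by linarith
    gcongr
  · rw [abs_mul]
    have h1 := hb (t / 2)
    rw [wY2, abs_of_nonneg (by positivity : 0 ≤ t / 2), show 2 * (t / 2) = t by ring] at h1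
    have h2 : (1 + t / 2) ^ n ≤ (1 + t) ^ n := by gcongr; linarith
    have h3 : |(1 / 2 : ℝ)| ≤ 1 := by rw [abs_of_pos] <;> norm_num
    calc _ ≤ C * (1 + t / 2) ^ n * Real.exp (-t) * 1 :=
          mul_le_mul h1 h3 (abs_nonneg _) (by positivity)
      _ ≤ _ := by rw [mul_one]; gcongr

theorem gr_wY2_of_deriv {f : Sm} (h : Gr wY2 (D f)) (h0 : Tendsto f.1 atTop (𝓝 0))
    (h1 : Tendsto f.1 atBot (𝓝 0)) : Gr wY2 f := by
  obtain ⟨C, n, hC, hb⟩ := h.bound fun x => (wY2_pos x).le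
  refine Gr.of_deriv (C := 2 * C * (2 * n + 1) ^ n * 2 ^ n) (n := n)
    (fun x => (wY2_pos x).le) (by positivity) (fun x => ?_) h
  rcases le_total 0 x with hx | hx
  · exact abs_le_of_deriv_wY2 hb h0 hx
  · have := abs_le_of_deriv_wY2 (f := rfl' f) (C := C) (n := n)
      (fun t => by simpa [wY2] using hb (-t)) (tendsto_rfl' h1) (x := -x) (by linarith)
    simpa [wY2] using this

theorem gr_grow : Gr wE grow := by
  have hch : ∀ x, Real.cosh x ≤ wE x := fun x => by
    rw [← Real.cosh_abs, wE, Real.cosh_eq]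
    have : Real.exp (-|x|) ≤ Real.exp |x| :=
      Real.exp_le_exp.2 (by linarith [abs_nonneg x])
    linarith
  have hsh : ∀ x, |Real.sinh x| ≤ wE x := fun x => by
    rw [Real.abs_sinh]
    refine (Real.sinh_lt_cosh _).le.trans ?_
    rw [Real.cosh_abs]; exact hch x
  have h1 : Gr wE chS := by
    rw [gr_iff fun x => (wE_pos x).le]
    intro k
    refine ⟨1, 0, zero_le_one, fun x => ?_⟩
    have : D^[k] chS = chS ∨ D^[k] chS = shS := by
      induction k with
      | zero => left; rfl
      | succ k ih =>
        rw [Function.iterate_succ_apply']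
        rcases ih with h | h
        · right; rw [h, D_chS]
        · left; rw [h, D_shS]
    rcases this with h | h
    · rw [h]; simpa [chS, abs_of_pos (Real.cosh_pos x)] using hch x
    · rw [h]; simpa [shS] using hsh x
  have hone : ∀ x, w1 x ≤ wE x := fun x => Real.one_le_exp (abs_nonneg x)
  exact Gr.sub wE_pos (Gr.add wE_pos h1 ((Gr.ofNat 6).mono hone))
    ((Gr.one_mul (Gr.ofNat 10) (gr_lamQ _)).Y1.mono hone)

/-- Variation of constants. -/
theorem exists_Lo_eq {F : Sm} (hF : Gr wY F) (ho : intg (D qq * F) = 0) :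
    ∃ h : Sm, Gr wY h ∧ Lo h = F := by
  have hpF : Gr wY2 (D qq * F) := (Gr.mul gr_D_qq hF).mono fun x => (wY_mul_wY x).le
  obtain ⟨v, hv, hv0, hv1⟩ := exists_anti (f := D qq * F) (Gr.mul_one gr_D_qq hF.Y1)
  rw [ho, neg_zero] at hv1
  have hvG : Gr wY2 v := gr_wY2_of_deriv (by rwa [hv]) hv0 hv1
  set u := anti (grow * F)
  have hu : D u = grow * F := D_anti _
  have huG : Gr w1 u := gr_w1_of_deriv (by
    rw [hu]; exact (Gr.mul gr_grow hF).mono fun x => (wE_mul_wY x).le)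
  -- The factor is the inverse of the Wronskian `-6`. The primitive `u` grows at most polynomially.
  -- The orthogonality hypothesis makes `v` vanish at both ends, so `v` decays like `e^{-2|x|}` up
  -- to polynomials and compensates the growth of `grow`.
  refine ⟨cst (-1 / 6) * (u * D qq - v * grow), Gr.cst_mul _ (Gr.sub wY_pos
    (Gr.one_mul huG gr_D_qq) ((Gr.mul hvG gr_grow).mono fun x => (wY2_mul_wE x).le)), ?_⟩
  rw [Lo_cst_mul]
  have e1 := Lo_D_qq
  have e2 := Lo_grow
  have e3 : D qq * D grow - D (D qq) * grow = -6 := Sm.ext' fun x => by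
    simpa using wronskian_grow x
  have key : Lo (u * D qq - v * grow) = -6 * F := by
    rw [Lo] at e1 e2 ⊢
    simp only [map_sub, map_add, D_mul, hu, hv]
    linear_combination u * e1 - v * e2 + F * e3
  rw [key]
  apply Sm.ext'; intro x; simp; ring

theorem Lo_one_sub_ph : Lo (1 - ph) = 1 - ph - 2 * qq + cst (5 / 3) * (ph * qq) := by
  simp only [Lo, D_mul, D_qq, D_ph, map_sub, D_cst, D_one]
  apply Sm.ext'; intro x; simp [qq_eval]; ring

/-- The primitive of `S` vanishing at `+∞` has limit `2τ` at `-∞`. Subtracting `τ L(1 - φ)`, which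
has the same two limits, leaves a decaying right side. Its orthogonality to `Q'` is the hypothesis
on `S` integrated by parts, so the decaying problem is solvable. -/
theorem exists_D_Lo_eq {S : Sm} (hS : Gr wY S) (ho : intg (S * qq) = 0) :
    ∃ (f : Sm) (τ : ℝ), Gr wY (D f) ∧ Tendsto f.1 atTop (𝓝 0) ∧
      Tendsto f.1 atBot (𝓝 (2 * τ)) ∧ D (Lo f) = S := by
  obtain ⟨G, hG, hG0, hG1⟩ := exists_anti hS
  set τ := -intg S / 2 with hτ
  have hmG : Gr w1 (1 - ph) := gr_one_sub_ph.R1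
  set F := G - cst τ * Lo (1 - ph) with hF
  have hDm : D (1 - ph) = -(cst (1 / 3) * qq) := by simp [D_ph]
  have hDmY : Gr wY (D (1 - ph)) := by rw [hDm]; exact (Gr.cst_mul _ gr_qq).neg
  have gpq : Gr wY (cst (5 / 3) * (ph * qq)) := Gr.cst_mul _ (Gr.one_mul gr_ph gr_qq)
  have g2q : Gr wY (2 * qq) := Gr.one_mul (Gr.ofNat 2) gr_qq
  have gLo : Gr wY (D (Lo (1 - ph))) := by
    rw [Lo_one_sub_ph, map_add, map_sub]
    exact Gr.add wY_pos (Gr.sub wY_pos hDmY g2q.deriv) gpq.deriv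
  have hFY : Gr wY F := by
    refine gr_Y_of_deriv ?_ ?_ ?_
    · rw [hF, map_sub, D_mul, D_cst, mul_zero, add_zero, hG]
      exact Gr.sub wY_pos hS (Gr.cst_mul _ gLo)
    · have t : Tendsto (Lo (1 - ph)).1 atBot (𝓝 (1 - (-1) - 0 + 0)) := by
        rw [Lo_one_sub_ph]
        exact ((tendsto_ph_bot.const_sub 1).sub g2q.toL.tendsto_bot).add gpq.toL.tendsto_bot
      have := hG1.sub (t.const_mul τ)
      have e : -intg S - τ * (1 - -1 - 0 + 0) = 0 := by rw [hτ]; ring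
      rw [e] at this
      exact this
    · have t : Tendsto (Lo (1 - ph)).1 atTop (𝓝 0) := (gr_one_sub_ph.Lo wR_pos).tendsto_top
      have := hG0.sub (t.const_mul τ)
      rw [mul_zero, sub_zero] at this
      exact this
  have hFo : intg (D qq * F) = 0 := by
    have e : D qq * F = D (qq * F) - S * qq + cst τ * (D (Lo (1 - ph)) * qq) := by
      rw [D_mul, hF]
      simp only [map_sub, D_mul, D_cst, hG]; ring
    have gq : Gr wY (qq * F) := Gr.mul_one gr_qq hFY.Y1
    have gs : Gr wY (S * qq) := Gr.mul_one hS gr_qq.Y1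
    rw [e, intg_add (Gr.sub wY_pos gq.deriv gs)
      (Gr.cst_mul _ (Gr.mul_one gLo gr_qq.Y1)), intg_sub gq.deriv gs, intg_D_zero gq, ho,
      intg_cst_mul, intg_D_Lo_mul_qq hmG]
    ring
  obtain ⟨h, hh, hLh⟩ := exists_Lo_eq hFY hFo
  refine ⟨h + cst τ * (1 - ph), τ, ?_, ?_, ?_, ?_⟩
  · rw [map_add, D_mul, D_cst, mul_zero, add_zero]
    exact Gr.add wY_pos hh.deriv (Gr.cst_mul _ hDmY)
  · exact (Gr.add wR_pos hh.toR (Gr.cst_mul _ gr_one_sub_ph)).tendsto_top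
  · have := hh.toL.tendsto_bot.add ((tendsto_ph_bot.const_sub 1).const_mul τ)
    rw [show 0 + τ * (1 - -1) = 2 * τ by ring] at this
    exact this
  · rw [Lo_add, hLh, Lo_cst_mul, hF, sub_add_cancel, hG]

/-! ### The soliton family `Q_μ` and its dependence on `μ`. -/

/-- Dilation. -/
def sc (κ : ℝ) : Sm →ₐ[ℝ] Sm where
  toFun f := ⟨fun x => f.1 (κ * x), (Sm.contDiff f).comp (contDiff_const.mul contDiff_id)⟩
  map_one' := rfl
  map_mul' _ _ := rfl
  map_zero' := rfl
  map_add' _ _ := rfl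
  commutes' _ := rfl

@[simp] theorem sc_apply (κ : ℝ) (f : Sm) (x : ℝ) : (sc κ f).1 x = f.1 (κ * x) := rfl

theorem D_sc (κ : ℝ) (f : Sm) : D (sc κ f) = cst κ * sc κ (D f) :=
  D_eq_of_hasDerivAt fun x => by
    have h : HasDerivAt (fun x : ℝ => κ * x) κ x := by
      simpa using (hasDerivAt_id x).const_mul κ
    have := (hasDerivAt f (κ * x)).comp x h
    rw [Sm.coe_mul', cst_apply, sc_apply, mul_comm]
    exact this

theorem sc_one (f : Sm) : sc 1 f = f := Sm.ext' fun x => by simp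

/-- The inverse width of the soliton `Q_μ`. -/
def kap (lam mu : ℝ) : ℝ := Real.sqrt ((1 + mu) / (1 + lam * mu))

/-- The derivative of the inverse width. -/
def kap' (lam mu : ℝ) : ℝ := (1 - lam) / (1 + lam * mu) ^ 2 / (2 * kap lam mu)

/-- The soliton family. -/
def Rs (lam mu : ℝ) : Sm := cst (1 + mu) * sc (kap lam mu) qq

/-- The derivative of the soliton family in the parameter. -/
def Rmu (lam mu : ℝ) : Sm :=
  sc (kap lam mu) qq + cst ((1 + mu) * kap' lam mu) * zz * sc (kap lam mu) (D qq)

theorem Rs_coe (lam mu : ℝ) : (Rs lam mu).1 = Qmu lam mu := rfl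

section
variable {lam : ℝ} (h0 : 0 ≤ lam) (h1 : lam < 1)
include h0 h1

theorem one_add_pos {mu : ℝ} (hm : mu ∈ Set.Ioo (-1 : ℝ) 1) : 0 < 1 + mu ∧ 0 < 1 + lam * mu := by
  obtain ⟨ha, hb⟩ := hm
  constructor <;> nlinarith

theorem kap_sq {mu : ℝ} (hm : mu ∈ Set.Ioo (-1 : ℝ) 1) :
    kap lam mu ^ 2 = (1 + mu) / (1 + lam * mu) := by
  obtain ⟨ha, hb⟩ := one_add_pos h0 h1 hm
  exact Real.sq_sqrt (by positivity)

theorem hasDerivAt_kap {mu : ℝ} (hm : mu ∈ Set.Ioo (-1 : ℝ) 1) :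
    HasDerivAt (kap lam) (kap' lam mu) mu := by
  obtain ⟨ha, hb⟩ := one_add_pos h0 h1 hm
  have d1 : HasDerivAt (fun m : ℝ => 1 + m) 1 mu := (hasDerivAt_id mu).const_add 1
  have d2 : HasDerivAt (fun m : ℝ => 1 + lam * m) lam mu := by
    simpa using ((hasDerivAt_id mu).const_mul lam).const_add 1
  refine ((d1.div d2 hb.ne').sqrt (div_pos ha hb).ne').congr_deriv ?_
  unfold kap' kap
  congr 1
  ring

theorem contDiffOn_kap : ContDiffOn ℝ ∞ (kap lam) (Set.Ioo (-1) 1) := by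
  refine ContDiffOn.sqrt (ContDiffOn.div ?_ ?_ ?_) ?_
  · fun_prop
  · fun_prop
  · exact fun m hm => (one_add_pos h0 h1 hm).2.ne'
  · exact fun m hm => (div_pos (one_add_pos h0 h1 hm).1 (one_add_pos h0 h1 hm).2).ne'

/-- This fixes the decay rate `1 - |μ|` of the soliton family, uniformly in `λ`. -/
theorem kap_ge {mu m : ℝ} (hm : m ≤ 1 / 5) (hmu : |mu| ≤ m) : 1 - m ≤ kap lam mu := by
  obtain ⟨ha, hb⟩ := abs_le.1 hmu
  have hI : mu ∈ Set.Ioo (-1 : ℝ) 1 := ⟨by linarith, by linarith⟩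
  obtain ⟨hc, hd⟩ := one_add_pos h0 h1 hI
  refine Real.le_sqrt_of_sq_le ?_
  rw [le_div_iff₀ hd]
  have hm0 : 0 ≤ m := (abs_nonneg _).trans hmu
  rcases le_total 0 mu with h | h
  · have : (1 - m) ^ 2 ≤ 1 := by nlinarith
    nlinarith
  · have e1 : 1 + lam * mu ≤ 1 := by nlinarith
    have e2 : (1 - m) ^ 2 ≤ 1 - m := by nlinarith
    nlinarith [sq_nonneg (1 - m)]

theorem kap_le {mu : ℝ} (hmu : |mu| ≤ 1 / 5) : kap lam mu ≤ 2 := by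
  obtain ⟨ha, hb⟩ := abs_le.1 hmu
  have hI : mu ∈ Set.Ioo (-1 : ℝ) 1 := ⟨by linarith, by linarith⟩
  obtain ⟨hc, hd⟩ := one_add_pos h0 h1 hI
  refine Real.sqrt_le_iff.2 ⟨by norm_num, ?_⟩
  rw [div_le_iff₀ hd]
  nlinarith

end

theorem kap_zero (lam : ℝ) : kap lam 0 = 1 := by simp [kap]
theorem kap'_zero (lam : ℝ) : kap' lam 0 = (1 - lam) / 2 := by simp [kap', kap_zero]

theorem Rs_zero (lam : ℝ) : Rs lam 0 = qq := by simp [Rs, kap_zero, sc_one]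
theorem Rmu_zero (lam : ℝ) : Rmu lam 0 = lamQ ((1 - lam) / 2) := by
  simp only [Rmu, kap_zero, sc_one, kap'_zero, lamQ, D_qq]
  apply Sm.ext'; intro x; simp; ring

/-- Before the last derivative the equation is `R'' - R + R² = μ(R - λR'')`. By `Q'' = Q - Q²` both
sides are combinations of `Q(κ·)` and its square, and they agree because `κ²(1 + λμ) = 1 + μ`. -/
theorem soliton_eq {lam mu : ℝ} (h0 : 0 ≤ lam) (h1 : lam < 1) (hm : mu ∈ Set.Ioo (-1 : ℝ) 1) :
    D (D (D (Rs lam mu)) - Rs lam mu + Rs lam mu ^ 2) = cst mu * H lam (D (Rs lam mu)) := by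
  obtain ⟨ha, hb⟩ := one_add_pos h0 h1 hm
  have hk := kap_sq h0 h1 hm
  set κ := kap lam mu
  have e0 : κ ^ 2 * (1 + lam * mu) = 1 + mu := by rw [hk, div_mul_cancel₀ _ hb.ne']
  have e1 : D (D (Rs lam mu)) = cst ((1 + mu) * κ ^ 2) * (sc κ qq - sc κ qq ^ 2) := by
    rw [← map_pow, ← map_sub, ← D_D_qq]
    simp only [Rs, D_mul, D_cst, D_sc, mul_zero, add_zero, cst_mul, cst_pow]
    ring
  have e2 : D (D (Rs lam mu)) - Rs lam mu + Rs lam mu ^ 2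
      = cst mu * (Rs lam mu - cst lam * D (D (Rs lam mu))) := by
    rw [e1, Rs]
    apply Sm.ext'; intro x
    simp only [Sm.coe_add', Sm.coe_sub', Sm.coe_mul', Sm.coe_pow', cst_apply]
    set q := (sc κ qq).1 x
    linear_combination (1 + mu) * (q - q ^ 2) * e0
  rw [e2, D_mul, D_cst, mul_zero, add_zero, map_sub, D_mul, D_cst, mul_zero, add_zero, H]

/-! ### First order expansion of parameter families -/

/-- A family `c(μ) zⁿ f(κ(μ) z)`. -/
def mon (lam : ℝ) (c : ℝ → ℝ) (n : ℕ) (f : Sm) (mu : ℝ) : Sm :=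
  cst (c mu) * zz ^ n * sc (kap lam mu) f

/-- The first order coefficient of `mon`. -/
def mon1 (lam : ℝ) (c : ℝ → ℝ) (n : ℕ) (f : Sm) : Sm :=
  cst (deriv c 0) * zz ^ n * f + cst (c 0 * ((1 - lam) / 2)) * zz ^ (n + 1) * D f

/-- The `k`-th derivative of the family `F` has the expansion `F μ = F 0 + μ F₁ + O(μ²)`. -/
def TayK (k : ℕ) (F : ℝ → Sm) (F₁ : Sm) : Prop :=
  ∃ (C : ℝ) (n : ℕ), 0 ≤ C ∧ ∀ mu, |mu| ≤ 1 / 5 → ∀ z,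
    |(D^[k] (F mu - F 0 - cst mu * F₁)).1 z| ≤
      C * mu ^ 2 * (1 + |z|) ^ n * Real.exp (-((1 - |mu|) * |z|))

/-- The family `F` has the expansion `F μ = F 0 + μ F₁ + O(μ²)`, with all derivatives. -/
def Tay (F : ℝ → Sm) (F₁ : Sm) : Prop := ∀ k : ℕ, TayK k F F₁

theorem TayK.add {k : ℕ} {F G : ℝ → Sm} {F₁ G₁ : Sm} (hF : TayK k F F₁) (hG : TayK k G G₁) :
    TayK k (fun m => F m + G m) (F₁ + G₁) := by
  obtain ⟨C, n, hC, hb⟩ := hF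
  obtain ⟨C', n', hC', hb'⟩ := hG
  refine ⟨C + C', n + n', by positivity, fun mu hmu z => ?_⟩
  have e : F mu + G mu - (F 0 + G 0) - cst mu * (F₁ + G₁)
      = (F mu - F 0 - cst mu * F₁) + (G mu - G 0 - cst mu * G₁) := by ring
  simp only [e, iter_D_add, Sm.coe_add']
  have h0 : (1 : ℝ) ≤ 1 + |z| := by have := abs_nonneg z; linarith
  have e1 : (1 + |z|) ^ n ≤ (1 + |z|) ^ (n + n') := pow_le_pow_right₀ h0 (by omega)
  have e2 : (1 + |z|) ^ n' ≤ (1 + |z|) ^ (n + n') := pow_le_pow_right₀ h0 (by omega)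
  have e3 := (Real.exp_pos (-((1 - |mu|) * |z|))).le
  refine (abs_add_le _ _).trans ((add_le_add (hb mu hmu z) (hb' mu hmu z)).trans ?_)
  calc _ ≤ C * mu ^ 2 * (1 + |z|) ^ (n + n') * Real.exp (-((1 - |mu|) * |z|))
        + C' * mu ^ 2 * (1 + |z|) ^ (n + n') * Real.exp (-((1 - |mu|) * |z|)) := by gcongr
    _ = _ := by ring

/-- The mean value inequality is used twice, first for `f'` and then for `f - s f'(0)`. The lost
factor `1/2` is irrelevant. -/
theorem abs_taylor_le {f f' f'' : ℝ → ℝ} {m M : ℝ} (hM : 0 ≤ M)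
    (h1 : ∀ s, |s| ≤ m → HasDerivAt f (f' s) s) (h2 : ∀ s, |s| ≤ m → HasDerivAt f' (f'' s) s)
    (hb : ∀ s, |s| ≤ m → |f'' s| ≤ M) {mu : ℝ} (hmu : |mu| = m) :
    |f mu - f 0 - mu * f' 0| ≤ M * mu ^ 2 := by
  have hm : 0 ≤ m := hmu ▸ abs_nonneg mu
  have hconv : Convex ℝ (Set.Icc (-m) m) := convex_Icc _ _
  have hmem0 : (0 : ℝ) ∈ Set.Icc (-m) m := ⟨by linarith, hm⟩
  have hmem : mu ∈ Set.Icc (-m) m := abs_le.1 hmu.le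
  have a1 : ∀ s ∈ Set.Icc (-m) m, |f' s - f' 0| ≤ M * m := fun s hs => by
    have := hconv.norm_image_sub_le_of_norm_hasDerivWithin_le (f := f') (f' := f'') (C := M)
      (fun t ht => (h2 t (abs_le.2 ht)).hasDerivWithinAt)
      (fun t ht => by simpa using hb t (abs_le.2 ht)) hmem0 hs
    simp only [Real.norm_eq_abs, sub_zero] at this
    exact this.trans (mul_le_mul_of_nonneg_left (abs_le.2 hs) hM)
  have := hconv.norm_image_sub_le_of_norm_hasDerivWithin_le
    (f := fun s => f s - s * f' 0) (f' := fun s => f' s - f' 0) (C := M * m)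
    (fun t ht => ((h1 t (abs_le.2 ht)).sub
      (((hasDerivAt_id t).mul_const (f' 0)).congr_deriv (one_mul _))).hasDerivWithinAt)
    (fun t ht => by simpa using a1 t ht) hmem0 hmem
  simp only [Real.norm_eq_abs, sub_zero, zero_mul] at this
  rw [hmu, mul_assoc, ← pow_two, ← hmu, sq_abs] at this
  convert this using 2
  ring

theorem exists_bound_on {c : ℝ → ℝ} (hc : ContDiffOn ℝ ∞ c (Set.Ioo (-1) 1)) :
    ∃ M : ℝ, 0 ≤ M ∧ ∀ s, |s| ≤ 1 / 5 → |c s| ≤ M := by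
  have hsub : Set.Icc (-(1 / 5) : ℝ) (1 / 5) ⊆ Set.Ioo (-1) 1 := fun s hs =>
    ⟨by linarith [hs.1], by linarith [hs.2]⟩
  obtain ⟨M, hM⟩ := isCompact_Icc.exists_bound_of_continuousOn (hc.continuousOn.mono hsub)
  exact ⟨|M|, abs_nonneg M, fun s hs => ((hM s (abs_le.1 hs)).trans (le_abs_self M))⟩

theorem contDiffOn_deriv {c : ℝ → ℝ} (hc : ContDiffOn ℝ ∞ c (Set.Ioo (-1) 1)) :
    ContDiffOn ℝ ∞ (deriv c) (Set.Ioo (-1) 1) :=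
  ((contDiffOn_infty_iff_deriv_of_isOpen isOpen_Ioo).1 hc).2

theorem hasDerivAt_of_contDiffOn {c : ℝ → ℝ} (hc : ContDiffOn ℝ ∞ c (Set.Ioo (-1) 1)) {s : ℝ}
    (hs : |s| ≤ 1 / 5) : HasDerivAt c (deriv c s) s := by
  obtain ⟨ha, hb⟩ := abs_le.1 hs
  have : Set.Ioo (-1 : ℝ) 1 ∈ 𝓝 s := isOpen_Ioo.mem_nhds ⟨by linarith, by linarith⟩
  exact ((hc.contDiffAt this).differentiableAt (by simp)).hasDerivAt

section
variable {lam : ℝ} (h0 : 0 ≤ lam) (h1 : lam < 1)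
include h0 h1

theorem abs_sc_le {f : Sm} (hf : Gr wY f) : ∃ (C : ℝ) (n : ℕ), 0 ≤ C ∧ ∀ m ≤ 1 / 5, ∀ s, |s| ≤ m →
    ∀ z, |f.1 (kap lam s * z)| ≤ C * (1 + |z|) ^ n * Real.exp (-((1 - m) * |z|)) := by
  obtain ⟨C, n, hC, hb⟩ := hf.bound fun x => (wY_pos x).le
  refine ⟨C * 2 ^ n, n, by positivity, fun m hm s hs z => (hb _).trans ?_⟩
  have k1 := kap_ge h0 h1 hm hs
  have k2 := kap_le h0 h1 (hs.trans hm)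
  have k3 : 0 ≤ kap lam s := by linarith
  have hz := abs_nonneg z
  rw [wY, abs_mul, abs_of_nonneg k3]
  have e1 : 1 + kap lam s * |z| ≤ 2 * (1 + |z|) := by nlinarith
  have e2 : -(kap lam s * |z|) ≤ -((1 - m) * |z|) := by nlinarith
  calc _ ≤ C * (2 * (1 + |z|)) ^ n * Real.exp (-((1 - m) * |z|)) := by gcongr
    _ = _ := by rw [mul_pow]; ring

/-- For fixed `z`, expand `s ↦ c(s) f(κ(s)z)` to second order. Each `s`-derivative of the argument
produces a factor `z`, absorbed in the polynomial weight; the slowest decay rate for `|s| ≤ |μ|` is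
`1 - |μ|`. -/
theorem mon_taylor_zero {c : ℝ → ℝ} (hc : ContDiffOn ℝ ∞ c (Set.Ioo (-1) 1)) (j : ℕ) {f : Sm}
    (hf : Gr wY f) : ∃ (C : ℝ) (n : ℕ), 0 ≤ C ∧ ∀ mu, |mu| ≤ 1 / 5 → ∀ z,
    |(mon lam c j f mu - mon lam c j f 0 - cst mu * mon1 lam c j f).1 z| ≤
      C * mu ^ 2 * (1 + |z|) ^ n * Real.exp (-((1 - |mu|) * |z|)) := by
  have hk := contDiffOn_kap h0 h1
  obtain ⟨c0, pc0, hc0⟩ := exists_bound_on hc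
  obtain ⟨c1, pc1, hc1⟩ := exists_bound_on (contDiffOn_deriv hc)
  obtain ⟨c2, pc2, hc2⟩ := exists_bound_on (contDiffOn_deriv (contDiffOn_deriv hc))
  obtain ⟨k1, pk1, hk1⟩ := exists_bound_on (contDiffOn_deriv hk)
  obtain ⟨k2, pk2, hk2⟩ := exists_bound_on (contDiffOn_deriv (contDiffOn_deriv hk))
  obtain ⟨f0, n0, pf0, hf0⟩ := abs_sc_le h0 h1 hf
  obtain ⟨f1, n1, pf1, hf1⟩ := abs_sc_le h0 h1 hf.deriv
  obtain ⟨f2, n2, pf2, hf2⟩ := abs_sc_le h0 h1 hf.deriv.deriv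
  set κ := kap lam with hκ
  set N := n0 + n1 + n2 + 2 with hN
  refine ⟨c2 * f0 + 2 * (c1 * k1 * f1) + c0 * k2 * f1 + c0 * k1 * k1 * f2, N + j,
    by positivity, fun mu hmu z => ?_⟩
  have hz := abs_nonneg z
  set e := Real.exp (-((1 - |mu|) * |z|)) with he
  have pe : 0 < e := Real.exp_pos _
  have hp : ∀ i ≤ N, (1 + |z|) ^ i ≤ (1 + |z|) ^ N := fun i hi =>
    pow_le_pow_right₀ (by linarith) hi
  have b0 : ∀ s, |s| ≤ |mu| → |f.1 (κ s * z)| ≤ f0 * (1 + |z|) ^ N * e := fun s hs =>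
    (hf0 _ hmu s hs z).trans
      (mul_le_mul_of_nonneg_right (mul_le_mul_of_nonneg_left (hp n0 (by omega)) pf0) pe.le)
  have b1 : ∀ s, |s| ≤ |mu| → |z * (D f).1 (κ s * z)| ≤ f1 * (1 + |z|) ^ N * e := fun s hs => by
    rw [abs_mul]
    calc _ ≤ (1 + |z|) * (f1 * (1 + |z|) ^ n1 * e) :=
          mul_le_mul (by linarith) (hf1 _ hmu s hs z) (abs_nonneg _) (by positivity)
      _ = f1 * (1 + |z|) ^ (n1 + 1) * e := by ring
      _ ≤ _ := mul_le_mul_of_nonneg_right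
          (mul_le_mul_of_nonneg_left (hp (n1 + 1) (by omega)) pf1) pe.le
  have b2 : ∀ s, |s| ≤ |mu| → |z * z * (D (D f)).1 (κ s * z)| ≤ f2 * (1 + |z|) ^ N * e :=
    fun s hs => by
    rw [abs_mul, abs_mul]
    calc _ ≤ ((1 + |z|) * (1 + |z|)) * (f2 * (1 + |z|) ^ n2 * e) :=
          mul_le_mul (by gcongr <;> linarith) (hf2 _ hmu s hs z) (abs_nonneg _) (by positivity)
      _ = f2 * (1 + |z|) ^ (n2 + 2) * e := by ring
      _ ≤ _ := mul_le_mul_of_nonneg_right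
          (mul_le_mul_of_nonneg_left (hp (n2 + 2) (by omega)) pf2) pe.le
  have hI : ∀ s, |s| ≤ |mu| → |s| ≤ 1 / 5 := fun s hs => hs.trans hmu
  have dκ : ∀ s, |s| ≤ |mu| → HasDerivAt κ (deriv κ s) s := fun s hs =>
    hasDerivAt_of_contDiffOn hk (hI s hs)
  have dκ' : ∀ s, |s| ≤ |mu| → HasDerivAt (deriv κ) (deriv (deriv κ) s) s := fun s hs =>
    hasDerivAt_of_contDiffOn (contDiffOn_deriv hk) (hI s hs)
  have dc : ∀ s, |s| ≤ |mu| → HasDerivAt c (deriv c s) s := fun s hs =>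
    hasDerivAt_of_contDiffOn hc (hI s hs)
  have dc' : ∀ s, |s| ≤ |mu| → HasDerivAt (deriv c) (deriv (deriv c) s) s := fun s hs =>
    hasDerivAt_of_contDiffOn (contDiffOn_deriv hc) (hI s hs)
  have df : ∀ (g : Sm) s, |s| ≤ |mu| →
      HasDerivAt (fun s => g.1 (κ s * z)) ((D g).1 (κ s * z) * (deriv κ s * z)) s :=
    fun g s hs => (hasDerivAt g (κ s * z)).comp s ((dκ s hs).mul_const z)
  have key := abs_taylor_le (m := |mu|)
    (M := (c2 * f0 + 2 * (c1 * k1 * f1) + c0 * k2 * f1 + c0 * k1 * k1 * f2) * (1 + |z|) ^ N * e)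
    (by positivity)
    (f := fun s => c s * f.1 (κ s * z))
    (f' := fun s => deriv c s * f.1 (κ s * z) + c s * deriv κ s * z * (D f).1 (κ s * z))
    (f'' := fun s => deriv (deriv c) s * f.1 (κ s * z)
      + 2 * (deriv c s * deriv κ s * (z * (D f).1 (κ s * z)))
      + c s * deriv (deriv κ) s * (z * (D f).1 (κ s * z))
      + c s * deriv κ s * deriv κ s * (z * z * (D (D f)).1 (κ s * z)))
    (fun s hs => ((dc s hs).mul (df f s hs)).congr_deriv (by ring))
    (fun s hs => (((dc' s hs).mul (df f s hs)).add
      ((((dc s hs).mul (dκ' s hs)).mul_const z).mul (df (D f) s hs))).congr_deriv (by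
        simp only [Pi.mul_apply]; ring))
    (fun s hs => ?_) (mu := mu) rfl
  · have e0 : κ 0 = 1 := kap_zero lam
    have e1 : deriv κ 0 = (1 - lam) / 2 := by
      rw [← kap'_zero]; exact (hasDerivAt_kap h0 h1 ⟨by norm_num, by norm_num⟩).deriv
    have e2 : (mon lam c j f mu - mon lam c j f 0 - cst mu * mon1 lam c j f).1 z
        = z ^ j * (c mu * f.1 (κ mu * z) - c 0 * f.1 (κ 0 * z)
          - mu * (deriv c 0 * f.1 (κ 0 * z) + c 0 * deriv κ 0 * z * (D f).1 (κ 0 * z))) := by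
      simp only [mon, mon1, Sm.coe_sub', Sm.coe_add', Sm.coe_mul', Sm.coe_pow', cst_apply,
        zz_apply, sc_apply, e1, e0, kap_zero, one_mul]
      rw [hκ]; ring
    rw [e2, abs_mul, abs_pow]
    calc _ ≤ (1 + |z|) ^ j * _ :=
          mul_le_mul (by gcongr; linarith) key (abs_nonneg _) (by positivity)
      _ = _ := by ring
  · have hs' := hI s hs
    refine (abs_add_le _ _).trans ((add_le_add ((abs_add_le _ _).trans (add_le_add
      (abs_add_le _ _) le_rfl)) le_rfl).trans ?_)
    rw [abs_mul, abs_mul 2, abs_mul (_ * _), abs_mul (deriv c s), abs_mul (_ * _) (z * _),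
      abs_mul (c s), abs_mul (_ * _ * _), abs_mul (_ * _) (deriv κ s), abs_mul (c s), abs_two]
    have a0 := b0 s hs
    have a1 := b1 s hs
    have a2 := b2 s hs
    calc _ ≤ c2 * (f0 * (1 + |z|) ^ N * e) + 2 * (c1 * k1 * (f1 * (1 + |z|) ^ N * e))
          + c0 * k2 * (f1 * (1 + |z|) ^ N * e) + c0 * k1 * k1 * (f2 * (1 + |z|) ^ N * e) := by
          gcongr
          · exact hc2 s hs'
          · exact hc1 s hs'
          · exact hk1 s hs'
          · exact hc0 s hs'
          · exact hk2 s hs'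
          · exact hc0 s hs'
          · exact hk1 s hs'
          · exact hk1 s hs'
      _ = _ := by ring

/-- The families `c(μ) zʲ f(κ(μ)z)` are stable under `D`, up to sums, and the formation of the first
order coefficient commutes with `D`. The bound on every derivative thus follows from the
undifferentiated one. -/
theorem tay_mon {c : ℝ → ℝ} (hc : ContDiffOn ℝ ∞ c (Set.Ioo (-1) 1)) (j : ℕ) {f : Sm}
    (hf : Gr wY f) : Tay (mon lam c j f) (mon1 lam c j f) := fun k => by
  induction k generalizing c j f with
  | zero => exact mon_taylor_zero h0 h1 hc j hf
  | succ k ih =>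
    have hk := contDiffOn_kap h0 h1
    have hzero : |(0 : ℝ)| ≤ 1 / 5 := by norm_num
    set c1 : ℝ → ℝ := fun m => j * c m with hc1
    set c2 : ℝ → ℝ := fun m => c m * kap lam m with hc2
    -- For `j = 0` the subtraction is truncated, but the coefficient `j` then vanishes.
    have i1 := ih (contDiffOn_const.mul hc : ContDiffOn ℝ ∞ c1 (Set.Ioo (-1) 1)) (j - 1) hf
    have i2 := ih (hc.mul hk : ContDiffOn ℝ ∞ c2 (Set.Ioo (-1) 1)) j hf.deriv
    have d1 : deriv c1 0 = j * deriv c 0 :=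
      ((hasDerivAt_of_contDiffOn hc hzero).const_mul (j : ℝ)).deriv
    have d2 : deriv c2 0 = deriv c 0 + c 0 * ((1 - lam) / 2) := by
      refine (((hasDerivAt_of_contDiffOn hc hzero).mul
        (hasDerivAt_kap h0 h1 ⟨by norm_num, by norm_num⟩)).congr_deriv ?_).deriv
      rw [kap_zero, kap'_zero, mul_one]
    have hD : ∀ n : ℕ, D (zz ^ n) = cst (n : ℝ) * zz ^ (n - 1) := fun n => by
      rw [Derivation.leibniz_pow]; simp [cst, nsmul_eq_mul]
    have eD : ∀ m, D (mon lam c j f m) = mon lam c1 (j - 1) f m + mon lam c2 j (D f) m := by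
      intro m
      simp only [mon, D_mul, D_cst, D_sc, hD, hc1, hc2, cst_mul]
      ring
    have v1 : c1 0 = j * c 0 := rfl
    have v2 : c2 0 = c 0 := by simp [hc2, kap_zero]
    have eD1 : D (mon1 lam c j f) = mon1 lam c1 (j - 1) f + mon1 lam c2 j (D f) := by
      simp only [mon1, map_add, D_mul, D_cst, hD, d1, d2, v1, v2, cst_mul, cst_add]
      cases j with
      | zero => simp; ring
      | succ j =>
        simp only [Nat.add_sub_cancel, Nat.cast_add, Nat.cast_one, cst_add, cst_one]; ring
    obtain ⟨C, n, hC, hb⟩ := TayK.add i1 i2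
    refine ⟨C, n, hC, fun mu hmu z => ?_⟩
    have := hb mu hmu z
    rw [Function.iterate_succ_apply, map_sub, map_sub, D_mul, D_cst, mul_zero, add_zero, eD, eD,
      eD1]
    exact this

theorem contDiffOn_kap' : ContDiffOn ℝ ∞ (kap' lam) (Set.Ioo (-1) 1) := by
  refine (contDiffOn_deriv (contDiffOn_kap h0 h1)).congr fun m hm => ?_
  exact (hasDerivAt_kap h0 h1 hm).deriv.symm

theorem tay_Rs : Tay (Rs lam) (lamQ ((1 - lam) / 2)) := by
  have hc : ContDiffOn ℝ ∞ (fun m : ℝ => 1 + m) (Set.Ioo (-1) 1) := by fun_prop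
  have e : mon1 lam (fun m : ℝ => 1 + m) 0 qq = lamQ ((1 - lam) / 2) := by
    have : deriv (fun m : ℝ => 1 + m) 0 = 1 := ((hasDerivAt_id (0 : ℝ)).const_add 1).deriv
    simp only [mon1, this, lamQ, D_qq]
    apply Sm.ext'; intro x; simp; ring
  have e' : mon lam (fun m : ℝ => 1 + m) 0 qq = Rs lam := by
    funext m; simp [mon, Rs]
  rw [← e, ← e']
  exact tay_mon h0 h1 hc 0 gr_qq

/-- `Ξ` is the derivative in `μ` at `0` of `∂_μ Q_μ`. Its evenness is what makes the sources of the
equations of `D₁` and `D₂` reflections of each other. -/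
theorem exists_tay_Rmu : ∃ Ξ : Sm, Gr wY Ξ ∧ rfl' Ξ = Ξ ∧ Tay (Rmu lam) Ξ := by
  set c : ℝ → ℝ := fun m => (1 + m) * kap' lam m with hc
  have hcc : ContDiffOn ℝ ∞ c (Set.Ioo (-1) 1) :=
    ContDiffOn.mul (by fun_prop) (contDiffOn_kap' h0 h1)
  have e : Rmu lam = fun m => mon lam (fun _ => 1) 0 qq m + mon lam c 1 (D qq) m := by
    funext m; simp [mon, Rmu, hc]
  have gz : ∀ n, Gr w1 (zz ^ n) := fun n => gr_zz.pow n
  refine ⟨mon1 lam (fun _ => 1) 0 qq + mon1 lam c 1 (D qq), ?_, ?_, ?_⟩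
  · exact Gr.add wY_pos
      (Gr.add wY_pos (Gr.one_mul (Gr.mul_one (Gr.cst _) (gz _)) gr_qq)
        (Gr.one_mul (Gr.mul_one (Gr.cst _) (gz _)) gr_D_qq))
      (Gr.add wY_pos (Gr.one_mul (Gr.mul_one (Gr.cst _) (gz _)) gr_D_qq)
        (Gr.one_mul (Gr.mul_one (Gr.cst _) (gz _)) gr_D_qq.deriv))
  · simp only [mon1, D_D_qq]
    simp only [map_add, map_mul, map_pow, rfl'_cst, rfl'_zz, map_sub, D_qq,
      rfl'_qq, rfl'_ph, map_neg]
    ring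
  · rw [e]
    exact fun k => TayK.add (tay_mon h0 h1 contDiffOn_const 0 gr_qq k)
      (tay_mon h0 h1 hcc 1 gr_D_qq k)

end

/-! ### Admissible parameters and the calculus of error sizes. -/

/-- The parameters of the approximate solution. -/
structure Par where
  mu0 : ℝ
  m1 : ℝ
  m2 : ℝ
  y1 : ℝ
  y2 : ℝ

/-- The distance of the solitons. -/
def Par.y (p : Par) : ℝ := p.y1 - p.y2

/-- The size conditions on the parameters. -/
structure Dom (lam K : ℝ) (p : Par) : Prop where
  pos : 0 < p.mu0
  small : p.mu0 < 1 / 100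
  dist_lower : Y₀ lam p.mu0 - 1 ≤ p.y
  dist_upper : p.y ≤ K * Y₀ lam p.mu0
  m1_le : |p.m1| ≤ 2 * p.mu0
  m2_le : |p.m2| ≤ 2 * p.mu0
  m_sum : |p.m1 + p.m2| ≤ Y₀ lam p.mu0 ^ 2 * Real.exp (-Y₀ lam p.mu0)
  y_sum : |p.y1 + p.y2| ≤ Y₀ lam p.mu0 ^ 4 * Real.exp (-(1 / 2) * Y₀ lam p.mu0)

/-- Admissible parameters. -/
def Adm (lam : ℝ) : Type := {p : Par // ∃ K, 1 < K ∧ Dom lam K p}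

theorem alphaVal_bounds {lam : ℝ} (h0 : 0 ≤ lam) (h1 : lam < 1) :
    10 ≤ alphaVal lam ∧ alphaVal lam ≤ 16 := by
  have hd := den_pos h0 h1
  unfold alphaVal
  rw [le_div_iff₀ hd, div_le_iff₀ hd]
  unfold den
  constructor <;> nlinarith

section
variable {lam : ℝ} (h0 : 0 ≤ lam) (h1 : lam < 1)
include h0 h1

theorem exp_neg_Y₀ {m : ℝ} (hm : 0 < m) (hs : m < 1 / 100) :
    Real.exp (-Y₀ lam m) = m ^ 2 / alphaVal lam := by
  obtain ⟨ha, hb⟩ := alphaVal_bounds h0 h1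
  have hp : 0 < m ^ 2 / alphaVal lam := by positivity
  have hl : m ^ 2 / alphaVal lam ≤ 1 := by
    rw [div_le_one (by linarith)]; nlinarith
  rw [Y₀, abs_of_nonpos (Real.log_nonpos hp.le hl), neg_neg, Real.exp_log hp]

theorem two_le_Y₀ {m : ℝ} (hm : 0 < m) (hs : m < 1 / 100) : 2 ≤ Y₀ lam m := by
  obtain ⟨ha, hb⟩ := alphaVal_bounds h0 h1
  have e := exp_neg_Y₀ h0 h1 hm hs
  have h2 : Real.exp (-Y₀ lam m) ≤ Real.exp (-2) := by
    have e1 : Real.exp 2 ≤ 9 := by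
      have := Real.exp_one_lt_d9
      have e2 : Real.exp 2 = Real.exp 1 * Real.exp 1 := by rw [← Real.exp_add]; norm_num
      rw [e2]
      have := Real.exp_pos 1
      nlinarith
    rw [e, Real.exp_neg, div_le_iff₀ (by linarith)]
    have : (1 : ℝ) / 9 ≤ (Real.exp 2)⁻¹ := by
      rw [one_div]; exact inv_anti₀ (Real.exp_pos _) e1
    nlinarith
  linarith [Real.exp_le_exp.1 h2]

/-- `m² = α e^{-Y₀}`, and the constant `4` comes from `α ≤ 16`. -/
theorem mu0_le {m : ℝ} (hm : 0 < m) (hs : m < 1 / 100) :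
    m ≤ 4 * Real.exp (-(1 / 2) * Y₀ lam m) := by
  obtain ⟨ha, hb⟩ := alphaVal_bounds h0 h1
  have e := exp_neg_Y₀ h0 h1 hm hs
  set η := Real.exp (-(1 / 2) * Y₀ lam m) with hη
  have e1 : η ^ 2 = m ^ 2 / alphaVal lam := by
    rw [← e, hη, ← Real.exp_nat_mul]; congr 1; push_cast; ring
  have e2 : m ^ 2 ≤ (4 * η) ^ 2 := by
    rw [mul_pow, e1, mul_div_assoc', le_div_iff₀ (by linarith)]
    nlinarith [sq_nonneg m]
  exact le_of_sq_le_sq e2 (by positivity)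

end

theorem Dom.two_le {lam K : ℝ} (h0 : 0 ≤ lam) (h1 : lam < 1) {p : Par} (h : Dom lam K p) :
    2 ≤ Y₀ lam p.mu0 := two_le_Y₀ h0 h1 h.pos h.small

/-- The small parameter `e^{-Y₀/2}`. -/
def eta (lam : ℝ) (p : Par) : ℝ := Real.exp (-(1 / 2) * Y₀ lam p.mu0)
/-- The interaction strength `e^{-y}`. -/
def eps (p : Par) : ℝ := Real.exp (-p.y)
/-- The weight decaying to the right of the first soliton. -/
def om (p : Par) (x : ℝ) : ℝ := 1 / (1 + Real.exp ((x - p.y1) / 2))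

theorem eta_pos (lam : ℝ) (p : Par) : 0 < eta lam p := Real.exp_pos _
theorem eps_pos (p : Par) : 0 < eps p := Real.exp_pos _
theorem om_pos (p : Par) (x : ℝ) : 0 < om p x := by
  have := Real.exp_pos ((x - p.y1) / 2); unfold om; positivity
theorem om_le (p : Par) (x : ℝ) : om p x ≤ 1 := by
  have := Real.exp_pos ((x - p.y1) / 2)
  unfold om; rw [div_le_one (by positivity)]; linarith

/-- Factors bounded by powers of `Y₀`, locally uniformly in `K`. -/
def admSlack {lam : ℝ} (h0 : 0 ≤ lam) (h1 : lam < 1) : Slack (Adm lam) where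
  -- The exponent is chosen before `K` and the constant after it, as the final bound requires.
  mem s := (∀ i x, 0 ≤ s i x) ∧ ∃ σ : ℕ, ∀ K, 1 < K → ∃ C : ℝ, 0 ≤ C ∧
    ∀ i : Adm lam, Dom lam K i.1 → ∀ x, s i x ≤ C * Y₀ lam i.1.mu0 ^ σ
  nonneg s hs := hs.1
  add s t hs ht := by
    obtain ⟨p1, σ, hs⟩ := hs
    obtain ⟨p2, τ, ht⟩ := ht
    refine ⟨fun i x => add_nonneg (p1 i x) (p2 i x), σ + τ, fun K hK => ?_⟩
    obtain ⟨C, hC, hs⟩ := hs K hK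
    obtain ⟨C', hC', ht⟩ := ht K hK
    refine ⟨C + C', by positivity, fun i hi x => ?_⟩
    have hY := hi.two_le h0 h1
    have e1 : Y₀ lam i.1.mu0 ^ σ ≤ Y₀ lam i.1.mu0 ^ (σ + τ) :=
      pow_le_pow_right₀ (by linarith) (by omega)
    have e2 : Y₀ lam i.1.mu0 ^ τ ≤ Y₀ lam i.1.mu0 ^ (σ + τ) :=
      pow_le_pow_right₀ (by linarith) (by omega)
    have := mul_le_mul_of_nonneg_left e1 hC
    have := mul_le_mul_of_nonneg_left e2 hC'
    have := hs i hi x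
    have := ht i hi x
    linarith
  mul s t hs ht := by
    obtain ⟨p1, σ, hs⟩ := hs
    obtain ⟨p2, τ, ht⟩ := ht
    refine ⟨fun i x => mul_nonneg (p1 i x) (p2 i x), σ + τ, fun K hK => ?_⟩
    obtain ⟨C, hC, hs⟩ := hs K hK
    obtain ⟨C', hC', ht⟩ := ht K hK
    refine ⟨C * C', by positivity, fun i hi x => ?_⟩
    calc _ ≤ (C * Y₀ lam i.1.mu0 ^ σ) * (C' * Y₀ lam i.1.mu0 ^ τ) :=
          mul_le_mul (hs i hi x) (ht i hi x) (p2 i x) ((p1 i x).trans (hs i hi x))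
      _ = _ := by ring
  const c hc := ⟨fun _ _ => hc, 0, fun K _ => ⟨c, hc, fun i _ x => by simp⟩⟩

/-- The gauge `e^{-aY₀/2} e^{-by} ω^c`. -/
def gauge {lam : ℝ} (a b c : ℕ) (i : Adm lam) (x : ℝ) : ℝ :=
  eta lam i.1 ^ a * eps i.1 ^ b * om i.1 x ^ c

theorem gauge_nonneg {lam : ℝ} (a b c : ℕ) (i : Adm lam) (x : ℝ) : 0 ≤ gauge a b c i x := by
  have := eta_pos lam i.1; have := eps_pos i.1; have := om_pos i.1 x
  unfold gauge; positivity

section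
variable {lam : ℝ} (h0 : 0 ≤ lam) (h1 : lam < 1)

/-- The family `E` is of size `e^{-aY₀/2} e^{-by} ω^c`, up to powers of `Y₀`. -/
def O (a b c : ℕ) (E : Adm lam → Sm) : Prop := (admSlack h0 h1).Bdd (gauge a b c) E

variable {h0 h1} {a b c a' b' c' : ℕ} {E F : Adm lam → Sm}

namespace O

theorem deriv (h : O h0 h1 a b c E) : O h0 h1 a b c (fun i => D (E i)) := Slack.Bdd.deriv h
theorem neg (h : O h0 h1 a b c E) : O h0 h1 a b c (fun i => -E i) := Slack.Bdd.neg h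
theorem add (hE : O h0 h1 a b c E) (hF : O h0 h1 a b c F) :
    O h0 h1 a b c (fun i => E i + F i) := Slack.Bdd.add (gauge_nonneg a b c) hE hF
theorem sub (hE : O h0 h1 a b c E) (hF : O h0 h1 a b c F) :
    O h0 h1 a b c (fun i => E i - F i) := Slack.Bdd.sub (gauge_nonneg a b c) hE hF
theorem cst_mul (r : ℝ) (hE : O h0 h1 a b c E) : O h0 h1 a b c (fun i => cst r * E i) :=
  Slack.Bdd.const_mul r hE

/-- From `y ≥ Y₀ - 1` follows `e^{-y} ≤ e · e^{-Y₀}`, so every factor `e^{-y}` can be traded for two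
factors `e^{-Y₀/2}`. -/
theorem weaken (h : O h0 h1 a b c E)
    (ha : b' ≤ b ∧ c' ≤ c ∧ a' ≤ a + 2 * (b - b') := by omega) : O h0 h1 a' b' c' E := by
  obtain ⟨hb, hc, ha⟩ := ha
  obtain ⟨k, rfl⟩ := Nat.exists_eq_add_of_le hb
  refine Slack.Bdd.mono h ((admSlack h0 h1).const (Real.exp 1 ^ k) (by positivity))
    fun i x => ?_
  obtain ⟨K, hK, hi⟩ := i.2
  have p1 := eta_pos lam i.1; have p2 := eps_pos i.1; have p3 := om_pos i.1 x
  have l1 : eta lam i.1 ≤ 1 := Real.exp_le_one_iff.2 (by linarith [hi.two_le h0 h1])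
  have l2 : eps i.1 ≤ Real.exp 1 * eta lam i.1 ^ 2 := by
    unfold eps eta
    rw [← Real.exp_nat_mul, ← Real.exp_add]
    refine Real.exp_le_exp.2 ?_
    push_cast
    linarith [hi.dist_lower]
  unfold gauge
  have e1 : om i.1 x ^ c ≤ om i.1 x ^ c' := pow_le_pow_of_le_one p3.le (om_le _ _) hc
  have e2 : eps i.1 ^ k ≤ Real.exp 1 ^ k * eta lam i.1 ^ (2 * k) := by
    rw [pow_mul, ← mul_pow]; gcongr
  have e3 : eta lam i.1 ^ (a + 2 * k) ≤ eta lam i.1 ^ a' :=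
    pow_le_pow_of_le_one p1.le l1 (by omega)
  calc _ ≤ eta lam i.1 ^ a * (eps i.1 ^ b' * (Real.exp 1 ^ k * eta lam i.1 ^ (2 * k)))
          * om i.1 x ^ c' := by rw [pow_add]; gcongr
    _ = Real.exp 1 ^ k * (eta lam i.1 ^ (a + 2 * k) * eps i.1 ^ b' * om i.1 x ^ c') := by ring
    _ ≤ _ := by gcongr

theorem mul {a'' b'' c'' : ℕ} (hE : O h0 h1 a b c E) (hF : O h0 h1 a' b' c' F)
    (ha : b'' ≤ b + b' ∧ c'' ≤ c + c' ∧ a'' ≤ a + a' + 2 * (b + b' - b'') := by omega) :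
    O h0 h1 a'' b'' c'' (fun i => E i * F i) := by
  refine weaken (a := a + a') (b := b + b') (c := c + c') ?_ ha
  refine Slack.Bdd.mono' (Slack.Bdd.mul hE hF) fun i x => le_of_eq ?_
  unfold gauge; ring

theorem H (hE : O h0 h1 a b c E) : O h0 h1 a b c (fun i => BBM.H lam (E i)) :=
  hE.sub (hE.deriv.deriv.cst_mul lam)

theorem of_cst {s : Adm lam → ℝ} {r : Adm lam → ℝ} (hr : (admSlack h0 h1).mem fun i _ => r i)
    (hs : ∀ i, |s i| ≤ r i * (eta lam i.1 ^ a * eps i.1 ^ b)) :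
    O h0 h1 a b 0 (fun i => cst (s i)) :=
  Slack.Bdd.const hr (gauge_nonneg _ _ _) fun i x => by simpa [gauge] using hs i

theorem const (r : ℝ) : O h0 h1 0 0 0 (fun _ => cst r) :=
  of_cst (r := fun _ => |r|) ((admSlack h0 h1).const _ (abs_nonneg r)) (by simp)

end O

theorem mem_of_le {r : Adm lam → ℝ} (hr : ∀ i, 0 ≤ r i) (σ : ℕ) (C : ℝ → ℝ)
    (hb : ∀ K, 1 < K → 0 ≤ C K ∧ ∀ i : Adm lam, Dom lam K i.1 → r i ≤ C K * Y₀ lam i.1.mu0 ^ σ) :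
    (admSlack h0 h1).mem fun i _ => r i :=
  ⟨fun i _ => hr i, σ, fun K hK => ⟨C K, (hb K hK).1, fun i hi _ => (hb K hK).2 i hi⟩⟩

theorem Adm.y_pos (h0 : 0 ≤ lam) (h1 : lam < 1) (i : Adm lam) : 1 ≤ i.1.y := by
  obtain ⟨K, hK, hi⟩ := i.2
  linarith [hi.two_le h0 h1, hi.dist_lower]

theorem mem_one_add_y (N : ℕ) : (admSlack h0 h1).mem fun i _ => (1 + i.1.y) ^ N := by
  refine mem_of_le (fun i => pow_nonneg (by linarith [i.y_pos h0 h1]) N) N (fun K => (1 + K) ^ N)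
    fun K hK => ⟨by positivity, fun i hi => ?_⟩
  rw [← mul_pow]
  have := hi.two_le h0 h1
  have := i.y_pos h0 h1
  refine pow_le_pow_left₀ (by linarith) ?_ N
  nlinarith [hi.dist_upper]

theorem O_y : O h0 h1 0 0 0 (fun i => cst i.1.y) :=
  O.of_cst (mem_one_add_y 1) fun i => by
    have := i.y_pos h0 h1
    rw [abs_of_pos (by linarith)]; simp

theorem O_eps : O h0 h1 0 1 0 (fun i => cst (eps i.1)) :=
  O.of_cst (r := fun _ => 1) ((admSlack h0 h1).const 1 zero_le_one) fun i => by
    rw [abs_of_pos (eps_pos _)]; simp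

theorem Adm.abs_m1_le (h0 : 0 ≤ lam) (h1 : lam < 1) (i : Adm lam) :
    |i.1.m1| ≤ 8 * eta lam i.1 := by
  obtain ⟨K, hK, hi⟩ := i.2
  have := hi.m1_le; have := mu0_le h0 h1 hi.pos hi.small; unfold eta; linarith

theorem Adm.abs_m2_le (h0 : 0 ≤ lam) (h1 : lam < 1) (i : Adm lam) :
    |i.1.m2| ≤ 8 * eta lam i.1 := by
  obtain ⟨K, hK, hi⟩ := i.2
  have := hi.m2_le; have := mu0_le h0 h1 hi.pos hi.small; unfold eta; linarith

theorem O_m1 : O h0 h1 1 0 0 (fun i => cst i.1.m1) :=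
  O.of_cst (r := fun _ => 8) ((admSlack h0 h1).const 8 (by norm_num)) fun i => by
    simpa using i.abs_m1_le h0 h1

theorem O_m2 : O h0 h1 1 0 0 (fun i => cst i.1.m2) :=
  O.of_cst (r := fun _ => 8) ((admSlack h0 h1).const 8 (by norm_num)) fun i => by
    simpa using i.abs_m2_le h0 h1

theorem mem_Y₀_pow (N : ℕ) : (admSlack h0 h1).mem fun i _ => Y₀ lam i.1.mu0 ^ N :=
  mem_of_le (fun i => pow_nonneg (abs_nonneg _) N) N (fun _ => 1)
    fun K hK => ⟨zero_le_one, fun i hi => by rw [one_mul]⟩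

/-- The sum is one order smaller than each `μ_j`; this is what permits replacing `μ₂` by `-μ₁` in
terms already of size `e^{-y}`. -/
theorem O_m_sum : O h0 h1 2 0 0 (fun i => cst (i.1.m1 + i.1.m2)) :=
  O.of_cst (mem_Y₀_pow 2) fun i => by
    obtain ⟨K, hK, hi⟩ := i.2
    have e : eta lam i.1 ^ 2 = Real.exp (-Y₀ lam i.1.mu0) := by
      rw [eta, ← Real.exp_nat_mul]; congr 1; push_cast; ring
    simpa [e] using hi.m_sum

theorem O_y_sum : O h0 h1 1 0 0 (fun i => cst (i.1.y1 + i.1.y2)) :=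
  O.of_cst (mem_Y₀_pow 4) fun i => by
    obtain ⟨K, hK, hi⟩ := i.2
    simpa [eta] using hi.y_sum

/-- `2y₁ = (y₁ + y₂) + y`, and both summands are controlled by powers of `Y₀`. -/
theorem O_y1 : O h0 h1 0 0 0 (fun i => cst i.1.y1) := by
  have := ((O_y_sum (h0 := h0) (h1 := h1)).weaken (a' := 0)).add O_y |>.cst_mul (1 / 2)
  convert this using 2 with i
  rw [← cst_add, ← BBM.cst_mul, Par.y]; congr 1; ring

/-! ### Localized functions -/

/-- The inequality form of the hypothesis covers both solitons, since `x - y₂ ≥ x - y₁`. -/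
theorem min_le_om {p : Par} {x z : ℝ} (hz : x - p.y1 ≤ z) :
    min 1 (Real.exp (-(z / 2))) ≤ 2 * om p x := by
  have hpos := Real.exp_pos ((x - p.y1) / 2)
  rw [om, mul_one_div, le_div_iff₀ (by positivity), mul_add, mul_one]
  have hm0 : 0 ≤ min 1 (Real.exp (-(z / 2))) := le_min zero_le_one (Real.exp_pos _).le
  have e1 := min_le_left 1 (Real.exp (-(z / 2)))
  have e2 : min 1 (Real.exp (-(z / 2))) * Real.exp ((x - p.y1) / 2) ≤ 1 := by
    calc _ ≤ Real.exp (-(z / 2)) * Real.exp ((x - p.y1) / 2) := by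
          gcongr; exact min_le_right _ _
      _ ≤ 1 := by rw [← Real.exp_add]; exact Real.exp_le_one_iff.2 (by linarith)
  linarith

theorem O_half1 {f : Sm} (hf : HalfDecay f) : O h0 h1 0 0 1 (fun i => sh i.1.y1 f) := fun k => by
  obtain ⟨C, hC, hb⟩ := hf k
  refine ⟨_, (admSlack h0 h1).const (C * 2) (by positivity), fun i x => ?_⟩
  rw [iter_D_sh, sh_apply]
  refine (hb _).trans ?_
  rw [mul_assoc]
  simpa [gauge] using mul_le_mul_of_nonneg_left (min_le_om (le_refl (x - i.1.y1))) hC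

theorem O_half2 {f : Sm} (hf : HalfDecay f) : O h0 h1 0 0 1 (fun i => sh i.1.y2 f) := fun k => by
  obtain ⟨C, hC, hb⟩ := hf k
  refine ⟨_, (admSlack h0 h1).const (C * 2) (by positivity), fun i x => ?_⟩
  rw [iter_D_sh, sh_apply]
  refine (hb _).trans ?_
  rw [mul_assoc]
  have hy := i.y_pos h0 h1
  unfold Par.y at hy
  simpa [gauge] using mul_le_mul_of_nonneg_left
    (min_le_om (p := i.1) (x := x) (z := x - i.1.y2) (by linarith)) hC

/-- The distance of `z` to the interval `[-y, 0]`. -/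
def dst (y z : ℝ) : ℝ := max z 0 + max (-(z + y)) 0

/-- If `d` is the distance to the interval between the solitons, both `|z₁|` and `|z₂|` are at most
`y + d`, and `1 + y + d ≤ (1 + y)(1 + d)`. Half of `e^{-d}` absorbs the powers of `1 + d`, the other
half gives the weight `ω`. -/
theorem poly_dst_le (n m : ℕ) : ∃ C : ℝ, 0 ≤ C ∧ ∀ (p : Par) (x : ℝ), 0 ≤ p.y →
    (1 + |x - p.y1|) ^ n * (1 + |x - p.y2|) ^ m * Real.exp (-dst p.y (x - p.y1)) ≤
      C * (1 + p.y) ^ (n + m) * om p x := by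
  obtain ⟨A, hA, hA'⟩ := one_add_pow_le_exp (n + m)
  refine ⟨A * 2, by positivity, fun p x hy => ?_⟩
  set z := x - p.y1 with hz
  have hz2 : x - p.y2 = z + p.y := by rw [hz, Par.y]; ring
  rw [hz2]
  set d := dst p.y z with hd
  have a1 := le_max_left z 0
  have a2 := le_max_right z 0
  have a3 := le_max_left (-(z + p.y)) 0
  have a4 := le_max_right (-(z + p.y)) 0
  have hd' : d = max z 0 + max (-(z + p.y)) 0 := rfl
  have d0 : 0 ≤ d := by linarith
  have b1 : |z| ≤ p.y + d := abs_le.2 ⟨by linarith, by linarith⟩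
  have b2 : |z + p.y| ≤ p.y + d := abs_le.2 ⟨by linarith, by linarith⟩
  have c1 : 1 + (p.y + d) ≤ (1 + p.y) * (1 + d) := by nlinarith
  have e1 : Real.exp (d / 2) * Real.exp (-d) = Real.exp (-(d / 2)) := by
    rw [← Real.exp_add]; congr 1; ring
  have e2 : Real.exp (-(d / 2)) ≤ 2 * om p x := by
    refine le_trans (le_min ?_ ?_) (min_le_om (le_refl (x - p.y1)))
    · exact Real.exp_le_one_iff.2 (by linarith)
    · exact Real.exp_le_exp.2 (by rw [← hz]; linarith)
  calc _ ≤ (1 + (p.y + d)) ^ n * (1 + (p.y + d)) ^ m * Real.exp (-d) := by gcongr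
    _ = (1 + (p.y + d)) ^ (n + m) * Real.exp (-d) := by ring
    _ ≤ ((1 + p.y) * (1 + d)) ^ (n + m) * Real.exp (-d) := by gcongr
    _ = (1 + p.y) ^ (n + m) * (1 + d) ^ (n + m) * Real.exp (-d) := by rw [mul_pow]
    _ ≤ (1 + p.y) ^ (n + m) * (A * Real.exp (d / 2)) * Real.exp (-d) := by
        gcongr; exact hA' d d0
    _ = A * (1 + p.y) ^ (n + m) * Real.exp (-(d / 2)) := by rw [← e1]; ring
    _ ≤ A * (1 + p.y) ^ (n + m) * (2 * om p x) := by gcongr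
    _ = _ := by ring

theorem abs_add_abs_eq (y z : ℝ) (hy : 0 ≤ y) : |z| + |z + y| = y + 2 * dst y z := by
  unfold dst
  rcases le_total 0 z with h | h
  · rw [abs_of_nonneg h, abs_of_nonneg (by linarith), max_eq_left h, max_eq_right (by linarith)]
    ring
  · rcases le_total 0 (z + y) with h' | h'
    · rw [abs_of_nonpos h, abs_of_nonneg h', max_eq_right h, max_eq_right (by linarith)]
      ring
    · rw [abs_of_nonpos h, abs_of_nonpos h', max_eq_right h, max_eq_left (by linarith)]
      ring

theorem wL_mul_wR_shift (y z : ℝ) (hy : 0 ≤ y) :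
    wL z * wR (z + y) ≤ Real.exp (-y) * Real.exp (-dst y z) := by
  unfold dst wL wR
  rw [← Real.exp_add]
  rcases le_total 0 z with h | h
  · rw [max_eq_left h, max_eq_right (by linarith)]
    calc _ ≤ 1 * Real.exp (-(z + y)) := by
          gcongr
          · exact min_le_left _ _
          · exact min_le_right _ _
      _ = _ := by rw [one_mul]; congr 1; ring
  · rcases le_total 0 (z + y) with h' | h'
    · rw [max_eq_right h, max_eq_right (by linarith)]
      calc _ ≤ Real.exp z * Real.exp (-(z + y)) := by
            gcongr
            · exact min_le_right _ _
            · exact min_le_right _ _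
        _ = _ := by rw [← Real.exp_add]; congr 1; ring
    · rw [max_eq_right h, max_eq_left (by linarith)]
      calc _ ≤ Real.exp z * 1 := by
            gcongr
            · exact min_le_right _ _
            · exact min_le_left _ _
        _ = _ := by rw [mul_one]; congr 1; ring

/-- A function decaying to the left of the right soliton times one decaying to the right of the left
soliton is of size `e^{-y}` between them and decays further outside. -/
theorem O_pair {f g : Sm} (hf : Gr wL f) (hg : Gr wR g) :
    O h0 h1 0 1 1 (fun i => sh i.1.y1 f * sh i.1.y2 g) := fun k => by
  induction k generalizing f g with
  | zero =>
    obtain ⟨C, n, hC, hb⟩ := hf.bound fun x => (wL_pos x).le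
    obtain ⟨C', m, hC', hb'⟩ := hg.bound fun x => (wR_pos x).le
    obtain ⟨A, hA, hA'⟩ := poly_dst_le n m
    refine ⟨_, (admSlack h0 h1).mul _ _ ((admSlack h0 h1).const (C * C' * A) (by positivity))
      (mem_one_add_y (n + m)), fun i x => ?_⟩
    have hy : 0 ≤ i.1.y := by linarith [i.y_pos h0 h1]
    have key := hA' i.1 x hy
    have hw := wL_mul_wR_shift i.1.y (x - i.1.y1) hy
    have e : x - i.1.y1 + i.1.y = x - i.1.y2 := by rw [Par.y]; ring
    rw [e] at hw
    have b1 := hb (x - i.1.y1)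
    have b2 := hb' (x - i.1.y2)
    simp only [Function.iterate_zero, id_eq, Sm.coe_mul', sh_apply, abs_mul]
    calc _ ≤ (C * (1 + |x - i.1.y1|) ^ n * wL (x - i.1.y1))
          * (C' * (1 + |x - i.1.y2|) ^ m * wR (x - i.1.y2)) :=
          mul_le_mul b1 b2 (abs_nonneg _) ((abs_nonneg _).trans b1)
      _ = C * C' * ((1 + |x - i.1.y1|) ^ n * (1 + |x - i.1.y2|) ^ m)
          * (wL (x - i.1.y1) * wR (x - i.1.y2)) := by ring
      _ ≤ C * C' * ((1 + |x - i.1.y1|) ^ n * (1 + |x - i.1.y2|) ^ m)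
          * (Real.exp (-i.1.y) * Real.exp (-dst i.1.y (x - i.1.y1))) := by gcongr
      _ = C * C' * Real.exp (-i.1.y) * ((1 + |x - i.1.y1|) ^ n * (1 + |x - i.1.y2|) ^ m
          * Real.exp (-dst i.1.y (x - i.1.y1))) := by ring
      _ ≤ C * C' * Real.exp (-i.1.y) * (A * (1 + i.1.y) ^ (n + m) * om i.1 x) := by gcongr
      _ = _ := by unfold gauge eps; ring
  | succ k ih =>
    obtain ⟨s, hs, hb⟩ := ih hf.deriv hg
    obtain ⟨t, ht, hc⟩ := ih hf hg.deriv
    refine ⟨_, (admSlack h0 h1).add _ _ hs ht, fun i x => ?_⟩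
    rw [Function.iterate_succ_apply, D_mul, add_comm, mul_comm (sh i.1.y2 g), iter_D_add,
      Sm.coe_add', add_mul, D_sh, D_sh]
    exact (abs_add_le _ _).trans (add_le_add (hb i x) (hc i x))

/-! ### Soliton families -/

/-- Families of size `|μ|^a` with the decay of a soliton of parameter `μ`. -/
def Fam (a : ℕ) (F : ℝ → Sm) : Prop := ∀ k : ℕ, ∃ (C : ℝ) (n : ℕ), 0 ≤ C ∧
  ∀ mu, |mu| ≤ 1 / 5 → ∀ z,
    |(D^[k] (F mu)).1 z| ≤ C * |mu| ^ a * (1 + |z|) ^ n * Real.exp (-((1 - |mu|) * |z|))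

theorem Fam.add {a : ℕ} {F G : ℝ → Sm} (hF : Fam a F) (hG : Fam a G) :
    Fam a (fun m => F m + G m) := fun k => by
  obtain ⟨C, n, hC, hb⟩ := hF k
  obtain ⟨C', n', hC', hb'⟩ := hG k
  refine ⟨C + C', n + n', by positivity, fun mu hmu z => ?_⟩
  simp only [iter_D_add, Sm.coe_add']
  have h0 : (1 : ℝ) ≤ 1 + |z| := by have := abs_nonneg z; linarith
  have e1 : (1 + |z|) ^ n ≤ (1 + |z|) ^ (n + n') := pow_le_pow_right₀ h0 (by omega)
  have e2 : (1 + |z|) ^ n' ≤ (1 + |z|) ^ (n + n') := pow_le_pow_right₀ h0 (by omega)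
  refine (abs_add_le _ _).trans ((add_le_add (hb mu hmu z) (hb' mu hmu z)).trans ?_)
  calc _ ≤ C * |mu| ^ a * (1 + |z|) ^ (n + n') * Real.exp (-((1 - |mu|) * |z|))
        + C' * |mu| ^ a * (1 + |z|) ^ (n + n') * Real.exp (-((1 - |mu|) * |z|)) := by gcongr
    _ = _ := by ring

theorem Fam.weaken {a b : ℕ} {F : ℝ → Sm} (hF : Fam a F) (hb : b ≤ a) : Fam b F := fun k => by
  obtain ⟨C, n, hC, h⟩ := hF k
  refine ⟨C, n, hC, fun mu hmu z => (h mu hmu z).trans ?_⟩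
  have : |mu| ^ a ≤ |mu| ^ b := pow_le_pow_of_le_one (abs_nonneg _) (by linarith) hb
  gcongr

theorem Fam.of_gr {f : Sm} (hf : Gr wY f) : Fam 0 (fun _ => f) := fun k => by
  obtain ⟨C, n, hC, hb⟩ := (gr_iff fun x => (wY_pos x).le).1 hf k
  refine ⟨C, n, hC, fun mu hmu z => (hb z).trans ?_⟩
  rw [pow_zero, mul_one, wY]
  have : -|z| ≤ -((1 - |mu|) * |z|) := by nlinarith [abs_nonneg mu, abs_nonneg z]
  gcongr

theorem Fam.mu_mul {a : ℕ} {F : ℝ → Sm} (hF : Fam a F) : Fam (a + 1) (fun m => cst m * F m) :=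
  fun k => by
  obtain ⟨C, n, hC, hb⟩ := hF k
  refine ⟨C, n, hC, fun mu hmu z => ?_⟩
  rw [iter_D_cst_mul, Sm.coe_mul', cst_apply, abs_mul]
  calc _ ≤ |mu| * (C * |mu| ^ a * (1 + |z|) ^ n * Real.exp (-((1 - |mu|) * |z|))) := by
        gcongr; exact hb mu hmu z
    _ = _ := by ring

theorem Tay.fam {F : ℝ → Sm} {F₁ : Sm} (hF : Tay F F₁) :
    Fam 2 (fun m => F m - F 0 - cst m * F₁) := fun k => by
  obtain ⟨C, n, hC, hb⟩ := hF k
  exact ⟨C, n, hC, fun mu hmu z => by simpa using hb mu hmu z⟩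

theorem Tay.fam1 {F : ℝ → Sm} {F₁ : Sm} (hF : Tay F F₁) (h : Gr wY F₁) :
    Fam 1 (fun m => F m - F 0) := by
  have := (hF.fam.weaken (b := 1) (by norm_num)).add (Fam.of_gr h).mu_mul
  simpa using this

theorem Tay.fam0 {F : ℝ → Sm} {F₁ : Sm} (hF : Tay F F₁) (h : Gr wY F₁) (h' : Gr wY (F 0)) :
    Fam 0 F := by
  have := ((hF.fam1 h).weaken (b := 0) (by norm_num)).add (Fam.of_gr h')
  simpa using this

theorem Adm.small (i : Adm lam) : |i.1.m1| ≤ 1 / 50 ∧ |i.1.m2| ≤ 1 / 50 := by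
  obtain ⟨K, hK, hi⟩ := i.2
  constructor <;> linarith [hi.small, hi.m1_le, hi.m2_le]

/-- A rate `1 - |μ|` close to `1` leaves room to spend `1/4` on the polynomial factor and still keep
the rate `1/2`. -/
theorem fam_single {a : ℕ} {F : ℝ → Sm} (hF : Fam a F) (k : ℕ) : ∃ C : ℝ, 0 ≤ C ∧
    ∀ mu, |mu| ≤ 1 / 50 → ∀ z,
      |(D^[k] (F mu)).1 z| ≤ C * |mu| ^ a * min 1 (Real.exp (-(z / 2))) := by
  obtain ⟨C, n, hC, hb⟩ := hF k
  obtain ⟨A, hA, hA'⟩ := one_add_pow_le_exp n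
  refine ⟨C * (2 ^ n * A), by positivity, fun mu hmu z => (hb mu (by linarith) z).trans ?_⟩
  have hz := abs_nonneg z
  have e1 : (1 + |z|) ^ n ≤ 2 ^ n * A * Real.exp (|z| / 4) := by
    have := hA' (|z| / 2) (by positivity)
    rw [show |z| / 2 / 2 = |z| / 4 by ring] at this
    calc (1 + |z|) ^ n ≤ (2 * (1 + |z| / 2)) ^ n := by gcongr; linarith
      _ ≤ _ := by rw [mul_pow, mul_assoc]; gcongr
  have e2 : Real.exp (|z| / 4) * Real.exp (-((1 - |mu|) * |z|)) ≤ Real.exp (-(|z| / 2)) := by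
    rw [← Real.exp_add]; exact Real.exp_le_exp.2 (by nlinarith)
  have e3 : Real.exp (-(|z| / 2)) ≤ min 1 (Real.exp (-(z / 2))) :=
    le_min (Real.exp_le_one_iff.2 (by linarith))
      (Real.exp_le_exp.2 (by have := le_abs_self z; linarith))
  calc _ ≤ C * |mu| ^ a * (2 ^ n * A * Real.exp (|z| / 4)) * Real.exp (-((1 - |mu|) * |z|)) := by
        gcongr
    _ = C * (2 ^ n * A) * |mu| ^ a
        * (Real.exp (|z| / 4) * Real.exp (-((1 - |mu|) * |z|))) := by ring
    _ ≤ C * (2 ^ n * A) * |mu| ^ a * min 1 (Real.exp (-(z / 2))) := by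
        gcongr; exact e2.trans e3

theorem O_fam1 {a : ℕ} {F : ℝ → Sm} (hF : Fam a F) :
    O h0 h1 a 0 1 (fun i => sh i.1.y1 (F i.1.m1)) := fun k => by
  obtain ⟨C, hC, hb⟩ := fam_single hF k
  refine ⟨_, (admSlack h0 h1).const (C * 8 ^ a * 2) (by positivity), fun i x => ?_⟩
  rw [iter_D_sh, sh_apply]
  refine (hb _ i.small.1 _).trans ?_
  have e1 := i.abs_m1_le h0 h1
  have e2 := min_le_om (p := i.1) (le_refl (x - i.1.y1))
  have e3 : |i.1.m1| ^ a ≤ 8 ^ a * eta lam i.1 ^ a := by rw [← mul_pow]; gcongr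
  have := eta_pos lam i.1
  calc _ ≤ C * (8 ^ a * eta lam i.1 ^ a) * (2 * om i.1 x) := by gcongr
    _ = _ := by unfold gauge; ring

theorem O_fam2 {a : ℕ} {F : ℝ → Sm} (hF : Fam a F) :
    O h0 h1 a 0 1 (fun i => sh i.1.y2 (F i.1.m2)) := fun k => by
  obtain ⟨C, hC, hb⟩ := fam_single hF k
  refine ⟨_, (admSlack h0 h1).const (C * 8 ^ a * 2) (by positivity), fun i x => ?_⟩
  rw [iter_D_sh, sh_apply]
  refine (hb _ i.small.2 _).trans ?_
  have hy := i.y_pos h0 h1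
  unfold Par.y at hy
  have e1 := i.abs_m2_le h0 h1
  have e2 := min_le_om (p := i.1) (x := x) (z := x - i.1.y2) (by linarith)
  have e3 : |i.1.m2| ^ a ≤ 8 ^ a * eta lam i.1 ^ a := by rw [← mul_pow]; gcongr
  have := eta_pos lam i.1
  calc _ ≤ C * (8 ^ a * eta lam i.1 ^ a) * (2 * om i.1 x) := by gcongr
    _ = _ := by unfold gauge; ring

/-- The upper bound `y ≤ K Y₀` enters here: `μ₀ ≤ 4e^{-Y₀/2}` and `Y₀ e^{-Y₀/2} ≤ 1` give `μ₀ y ≤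
4K`. The factor is thus bounded by a constant depending on `K`, without any power of `Y₀`. -/
theorem mem_exp_mu_y : (admSlack h0 h1).mem fun i _ => Real.exp (2 * i.1.mu0 * i.1.y) := by
  refine mem_of_le (fun i => (Real.exp_pos _).le) 0 (fun K => Real.exp (8 * K))
    fun K hK => ⟨(Real.exp_pos _).le, fun i hi => ?_⟩
  rw [pow_zero, mul_one]
  refine Real.exp_le_exp.2 ?_
  have hY := hi.two_le h0 h1
  have hm := mu0_le h0 h1 hi.pos hi.small
  set Y := Y₀ lam i.1.mu0
  have e1 : Y * Real.exp (-(1 / 2) * Y) ≤ 1 := by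
    have := Real.add_one_le_exp (1 / 2 * Y)
    have e2 : Y ≤ Real.exp (1 / 2 * Y) := by
      have e3 : Real.exp (1 / 2 * Y) = Real.exp (1 / 4 * Y) ^ 2 := by
        rw [← Real.exp_nat_mul]; congr 1; push_cast; ring
      have := Real.add_one_le_exp (1 / 4 * Y)
      rw [e3]; nlinarith [sq_nonneg (1 / 4 * Y - 1)]
    rw [show -(1 / 2) * Y = -(1 / 2 * Y) by ring, Real.exp_neg, ← div_eq_mul_inv,
      div_le_one (Real.exp_pos _)]
    exact e2
  have e4 : i.1.mu0 * Y ≤ 4 := by nlinarith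
  have hu := hi.dist_upper
  have hp := hi.pos
  have : i.1.mu0 * i.1.y ≤ K * (i.1.mu0 * Y) := by nlinarith
  nlinarith

/-- The decay rates are only `1 - |μ_j|`. Since `|z₁| + |z₂| = y + 2d`, the loss is `e^{2μ₀y}`
together with part of the decay in `d`, and both are affordable. -/
theorem O_fam_pair {a b : ℕ} {F G : ℝ → Sm} (hF : Fam a F) (hG : Fam b G) :
    O h0 h1 (a + b) 1 1 (fun i => sh i.1.y1 (F i.1.m1) * sh i.1.y2 (G i.1.m2)) := fun k => by
  have hderiv : ∀ {a : ℕ} {F : ℝ → Sm}, Fam a F → Fam a (fun m => D (F m)) := fun hF k => by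
    simpa only [Function.iterate_succ_apply] using hF (k + 1)
  induction k generalizing F G with
  | zero =>
    obtain ⟨C, n, hC, hb⟩ := hF 0
    obtain ⟨C', m, hC', hb'⟩ := hG 0
    obtain ⟨A, hA, hA'⟩ := poly_dst_le n m
    refine ⟨_, (admSlack h0 h1).mul _ _ (mem_exp_mu_y) ((admSlack h0 h1).mul _ _
      ((admSlack h0 h1).const (C * C' * A * 8 ^ a * 8 ^ b) (by positivity))
      (mem_one_add_y (n + m))), fun i x => ?_⟩
    have hy : 0 ≤ i.1.y := by linarith [i.y_pos h0 h1]
    have key := hA' i.1 x hy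
    have hdd := abs_add_abs_eq i.1.y (x - i.1.y1) hy
    have e : x - i.1.y1 + i.1.y = x - i.1.y2 := by rw [Par.y]; ring
    rw [e] at hdd
    have sm := i.small
    have b1 := hb i.1.m1 (by linarith [sm.1]) (x - i.1.y1)
    have b2 := hb' i.1.m2 (by linarith [sm.2]) (x - i.1.y2)
    have e1 := i.abs_m1_le h0 h1
    have e2 := i.abs_m2_le h0 h1
    have p1 : |i.1.m1| ^ a ≤ 8 ^ a * eta lam i.1 ^ a := by rw [← mul_pow]; gcongr
    have p2 : |i.1.m2| ^ b ≤ 8 ^ b * eta lam i.1 ^ b := by rw [← mul_pow]; gcongr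
    have p0 := eta_pos lam i.1
    have hexp : Real.exp (-((1 - |i.1.m1|) * |x - i.1.y1|))
        * Real.exp (-((1 - |i.1.m2|) * |x - i.1.y2|))
        ≤ Real.exp (2 * i.1.mu0 * i.1.y) * (Real.exp (-i.1.y)
          * Real.exp (-dst i.1.y (x - i.1.y1))) := by
      rw [← Real.exp_add, ← Real.exp_add, ← Real.exp_add]
      refine Real.exp_le_exp.2 ?_
      obtain ⟨K, hK, hi⟩ := i.2
      have q1 := hi.m1_le; have q2 := hi.m2_le; have q3 := hi.small; have q4 := hi.pos
      have r1 := abs_nonneg (x - i.1.y1)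
      have r2 := abs_nonneg (x - i.1.y2)
      have r3 : 0 ≤ dst i.1.y (x - i.1.y1) :=
        add_nonneg (le_max_right _ _) (le_max_right _ _)
      nlinarith [mul_le_mul_of_nonneg_right q1 r1, mul_le_mul_of_nonneg_right q2 r2]
    simp only [Function.iterate_zero, id_eq, Sm.coe_mul', sh_apply, abs_mul]
    simp only [Function.iterate_zero, id_eq] at b1 b2
    calc _ ≤ _ := mul_le_mul b1 b2 (abs_nonneg _) ((abs_nonneg _).trans b1)
      _ = C * C' * |i.1.m1| ^ a * |i.1.m2| ^ b
          * ((1 + |x - i.1.y1|) ^ n * (1 + |x - i.1.y2|) ^ m)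
          * (Real.exp (-((1 - |i.1.m1|) * |x - i.1.y1|))
        * Real.exp (-((1 - |i.1.m2|) * |x - i.1.y2|))) := by ring
      _ ≤ C * C' * (8 ^ a * eta lam i.1 ^ a) * (8 ^ b * eta lam i.1 ^ b)
          * ((1 + |x - i.1.y1|) ^ n * (1 + |x - i.1.y2|) ^ m)
          * (Real.exp (2 * i.1.mu0 * i.1.y) * (Real.exp (-i.1.y)
          * Real.exp (-dst i.1.y (x - i.1.y1)))) := by gcongr
      _ = C * C' * (8 ^ a * eta lam i.1 ^ a) * (8 ^ b * eta lam i.1 ^ b)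
          * Real.exp (2 * i.1.mu0 * i.1.y) * Real.exp (-i.1.y)
          * ((1 + |x - i.1.y1|) ^ n * (1 + |x - i.1.y2|) ^ m
          * Real.exp (-dst i.1.y (x - i.1.y1))) := by ring
      _ ≤ C * C' * (8 ^ a * eta lam i.1 ^ a) * (8 ^ b * eta lam i.1 ^ b)
          * Real.exp (2 * i.1.mu0 * i.1.y) * Real.exp (-i.1.y)
          * (A * (1 + i.1.y) ^ (n + m) * om i.1 x) := by gcongr
      _ = _ := by unfold gauge eps; ring
  | succ k ih =>
    obtain ⟨s, hs, hb⟩ := ih (hderiv hF) hG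
    obtain ⟨t, ht, hc⟩ := ih hF (hderiv hG)
    refine ⟨_, (admSlack h0 h1).add _ _ hs ht, fun i x => ?_⟩
    rw [Function.iterate_succ_apply, D_mul, add_comm, mul_comm (sh i.1.y2 (G i.1.m2)), iter_D_add,
      Sm.coe_add', add_mul, D_sh, D_sh]
    exact (abs_add_le _ _).trans (add_le_add (hb i x) (hc i x))

end

/-! ### The approximate solution, its parameter derivatives and its residual. -/

/-- Smooth profiles and constants. -/
structure SData where
  A1 : Sm
  A2 : Sm
  B1 : Sm
  B2 : Sm
  D1 : Sm
  D2 : Sm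
  α : ℝ
  β : ℝ
  δ : ℝ
  a : ℝ
  b1 : ℝ
  b2 : ℝ
  d1 : ℝ
  d2 : ℝ

/-- The tangent profile `∂_μ Q_μ` at `μ = 0`. -/
abbrev lamP (lam : ℝ) : Sm := lamQ ((1 - lam) / 2)

namespace SData

variable (S : SData) (lam : ℝ) (p : Par)

/-- `M₁` -/
def M1 : ℝ := S.α * eps p + S.β * p.m1 * p.y * eps p + S.δ * p.m1 * eps p
/-- `M₂` -/
def M2 : ℝ := -S.α * eps p - S.β * p.m2 * p.y * eps p - S.δ * p.m2 * eps p
/-- `N₁` -/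
def N1 : ℝ := S.a * eps p + S.b1 * p.m1 * p.y * eps p + S.d1 * p.m1 * eps p
/-- `N₂` -/
def N2 : ℝ := S.a * eps p + S.b2 * p.m2 * p.y * eps p + S.d2 * p.m2 * eps p

/-- The correction to the sum of two solitons. -/
def W : Sm :=
  cst (eps p) * (sh p.y1 S.A1 + sh p.y2 S.A2)
  + cst (theta lam) * cst (p.m1 - p.m2) * (zz * (sh p.y1 qq * sh p.y2 qq))
  + cst p.y * cst (eps p) * (cst p.m1 * sh p.y1 S.B1 + cst p.m2 * sh p.y2 S.B2)
  + cst (eps p) * (cst p.m1 * sh p.y1 S.D1 + cst p.m2 * sh p.y2 S.D2)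

/-- The approximate solution. -/
def V : Sm := sh p.y1 (Rs lam p.m1) + sh p.y2 (Rs lam p.m2) + S.W lam p

/-- The derivative of the correction in `μ₁`. -/
def Wm1 : Sm := cst (theta lam) * (zz * (sh p.y1 qq * sh p.y2 qq))
  + cst p.y * cst (eps p) * sh p.y1 S.B1 + cst (eps p) * sh p.y1 S.D1

/-- The derivative of the correction in `μ₂`. -/
def Wm2 : Sm := -cst (theta lam) * (zz * (sh p.y1 qq * sh p.y2 qq))
  + cst p.y * cst (eps p) * sh p.y2 S.B2 + cst (eps p) * sh p.y2 S.D2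

/-- The higher order part of the derivative of the correction in `y₁`. -/
def Wy1' : Sm :=
  -(cst (theta lam) * cst (p.m1 - p.m2) * (zz * (sh p.y1 (D qq) * sh p.y2 qq)))
  + (1 - cst p.y) * cst (eps p) * (cst p.m1 * sh p.y1 S.B1 + cst p.m2 * sh p.y2 S.B2)
  - cst p.y * cst (eps p) * (cst p.m1 * sh p.y1 (D S.B1))
  - cst (eps p) * (cst p.m1 * sh p.y1 S.D1 + cst p.m2 * sh p.y2 S.D2)
  - cst (eps p) * (cst p.m1 * sh p.y1 (D S.D1))

/-- The higher order part of the derivative of the correction in `y₂`. -/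
def Wy2' : Sm :=
  -(cst (theta lam) * cst (p.m1 - p.m2) * (zz * (sh p.y1 qq * sh p.y2 (D qq))))
  - (1 - cst p.y) * cst (eps p) * (cst p.m1 * sh p.y1 S.B1 + cst p.m2 * sh p.y2 S.B2)
  - cst p.y * cst (eps p) * (cst p.m2 * sh p.y2 (D S.B2))
  + cst (eps p) * (cst p.m1 * sh p.y1 S.D1 + cst p.m2 * sh p.y2 S.D2)
  - cst (eps p) * (cst p.m2 * sh p.y2 (D S.D2))

/-- The derivative of the correction in `y₁`. -/
def Wy1 : Sm := -(cst (eps p) * (sh p.y1 S.A1 + sh p.y2 S.A2)) - cst (eps p) * sh p.y1 (D S.A1)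
  + S.Wy1' lam p

/-- The derivative of the correction in `y₂`. -/
def Wy2 : Sm := cst (eps p) * (sh p.y1 S.A1 + sh p.y2 S.A2) - cst (eps p) * sh p.y2 (D S.A2)
  + S.Wy2' lam p

/-- The error of the approximate solution. -/
def E0 : Sm := D (D (D (S.V lam p)) - S.V lam p + S.V lam p ^ 2)
  + cst (S.M1 p) * H lam (sh p.y1 (Rmu lam p.m1) + S.Wm1 lam p)
  + cst (S.M2 p) * H lam (sh p.y2 (Rmu lam p.m2) + S.Wm2 lam p)
  + cst (p.m1 - S.N1 p) * H lam (-sh p.y1 (D (Rs lam p.m1)) + S.Wy1 lam p)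
  + cst (p.m2 - S.N2 p) * H lam (-sh p.y2 (D (Rs lam p.m2)) + S.Wy2 lam p)

/-- Each soliton solves its own equation exactly, which removes the terms `μ_j H R_j'`. What remains
is the interaction `2R₁R₂`, terms involving the correction `W`, and the modulation coefficients. -/
theorem E0_eq {lam : ℝ} (h0 : 0 ≤ lam) (h1 : lam < 1) {p : Par} (s1 : |p.m1| ≤ 1 / 50)
    (s2 : |p.m2| ≤ 1 / 50) :
    S.E0 lam p = D (2 * (sh p.y1 (Rs lam p.m1) * sh p.y2 (Rs lam p.m2)))
      + (D (D (D (S.W lam p))) - D (S.W lam p)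
        + D (2 * ((sh p.y1 (Rs lam p.m1) + sh p.y2 (Rs lam p.m2)) * S.W lam p)))
      + D (S.W lam p * S.W lam p)
      + cst (S.M1 p) * H lam (sh p.y1 (Rmu lam p.m1)) + cst (S.M1 p) * H lam (S.Wm1 lam p)
      + cst (S.M2 p) * H lam (sh p.y2 (Rmu lam p.m2)) + cst (S.M2 p) * H lam (S.Wm2 lam p)
      + cst (S.N1 p) * H lam (sh p.y1 (D (Rs lam p.m1)))
      + cst (S.N2 p) * H lam (sh p.y2 (D (Rs lam p.m2)))
      + cst p.m1 * H lam (S.Wy1 lam p) - cst (S.N1 p) * H lam (S.Wy1 lam p)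
      + cst p.m2 * H lam (S.Wy2 lam p) - cst (S.N2 p) * H lam (S.Wy2 lam p) := by
  have hs : ∀ {m : ℝ}, |m| ≤ 1 / 50 → ∀ y, D (D (D (sh y (Rs lam m))) - sh y (Rs lam m)
      + sh y (Rs lam m) ^ 2) = cst m * H lam (sh y (D (Rs lam m))) := by
    intro m hm y
    have hm' := abs_le.1 hm
    have := congrArg (sh y) (soliton_eq h0 h1 (mu := m) ⟨by linarith, by linarith⟩)
    rw [← D_sh] at this
    simpa only [D_sh, map_sub, map_add, map_pow, map_mul, sh_cst, H_sh] using this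
  have e1 := hs s1 p.y1
  have e2 := hs s2 p.y2
  have hV : S.V lam p ^ 2 = sh p.y1 (Rs lam p.m1) ^ 2 + sh p.y2 (Rs lam p.m2) ^ 2
      + 2 * (sh p.y1 (Rs lam p.m1) * sh p.y2 (Rs lam p.m2))
      + 2 * ((sh p.y1 (Rs lam p.m1) + sh p.y2 (Rs lam p.m2)) * S.W lam p)
      + S.W lam p * S.W lam p := by unfold V; ring
  rw [E0, hV]
  simp only [V, map_add, map_sub, H_add, H_neg, cst_sub] at e1 e2 ⊢
  linear_combination e1 + e2

end SData

/-! ### Algebra modulo admissible errors, and the product of two ground states. -/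

section
variable {lam : ℝ} {h0 : 0 ≤ lam} {h1 : lam < 1}

/-- Sums of products of functions of `x - y₁` and `x - y₂` of polynomial growth. -/
inductive Bd : (Adm lam → Sm) → Prop
  | cst (r : ℝ) : Bd fun _ => cst r
  | of1 {f : Sm} : Gr w1 f → Bd fun i => sh i.1.y1 f
  | of2 {f : Sm} : Gr w1 f → Bd fun i => sh i.1.y2 f
  | add {E F : Adm lam → Sm} : Bd E → Bd F → Bd (E + F)
  | mul {E F : Adm lam → Sm} : Bd E → Bd F → Bd (E * F)

/-- Sums of products of a function of `x - y₁` decaying on the left and a function of `x - y₂`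
decaying on the right. -/
inductive Pr : (Adm lam → Sm) → Prop
  | pair {f g : Sm} : Gr wL f → Gr wR g → Pr fun i => sh i.1.y1 f * sh i.1.y2 g
  | add {E F : Adm lam → Sm} : Pr E → Pr F → Pr (E + F)

/-- Factors of polynomial growth in `z₁` or `z₂` can be moved into the matching factor of each pair,
so smallness survives multiplication by polynomials in `z_j` and `φ_j`. -/
theorem Pr.mul_bd {E F : Adm lam → Sm} (hE : Pr E) (hF : Bd F) : Pr (E * F) := by
  induction hF generalizing E with
  | cst r =>
    induction hE with
    | @pair f g hf hg =>
      convert Pr.pair (hf.cst_mul r) hg using 2 with i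
      simp only [Pi.mul_apply, map_mul, sh_cst]; ring
    | add _ _ h1 h2 => rw [add_mul]; exact h1.add h2
  | @of1 h hh =>
    induction hE with
    | @pair f g hf hg =>
      convert Pr.pair (hf.mul_one hh) hg using 2 with i
      simp only [Pi.mul_apply, map_mul]; ring
    | add _ _ h1 h2 => rw [add_mul]; exact h1.add h2
  | @of2 h hh =>
    induction hE with
    | @pair f g hf hg =>
      convert Pr.pair hf (hg.mul_one hh) using 2 with i
      simp only [Pi.mul_apply, map_mul]; ring
    | add _ _ h1 h2 => rw [add_mul]; exact h1.add h2
  | add _ _ h1 h2 => rw [mul_add]; exact (h1 hE).add (h2 hE)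
  | mul _ _ h1 h2 => rw [← mul_assoc]; exact h2 (h1 hE)

theorem Pr.toO {E : Adm lam → Sm} (hE : Pr E) : O h0 h1 0 1 1 E := by
  induction hE with
  | pair hf hg => exact O_pair hf hg
  | add _ _ h1 h2 => exact h1.add h2

theorem O.congr {a b c : ℕ} {E F : Adm lam → Sm} (hE : O h0 h1 a b c E) (h : ∀ i, F i = E i) :
    O h0 h1 a b c F := by rwa [show F = E from funext h]

/-- Equality up to the admissible error. -/
def Eqv (h0 : 0 ≤ lam) (h1 : lam < 1) (E F : Adm lam → Sm) : Prop :=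
  O h0 h1 2 1 1 fun i => E i - F i

namespace Eqv
variable {E F G E' F' : Adm lam → Sm}

theorem trans (h : Eqv h0 h1 E F) (h' : Eqv h0 h1 F G) : Eqv h0 h1 E G :=
  (O.add h h').congr fun i => by ring

theorem add (h : Eqv h0 h1 E F) (h' : Eqv h0 h1 E' F') :
    Eqv h0 h1 (fun i => E i + E' i) (fun i => F i + F' i) :=
  (O.add h h').congr fun i => by ring

theorem deriv (h : Eqv h0 h1 E F) : Eqv h0 h1 (fun i => D (E i)) (fun i => D (F i)) :=
  (O.deriv h).congr fun i => by simp

theorem mul {a b c : ℕ} (hG : O h0 h1 a b c G) (h : Eqv h0 h1 E F) :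
    Eqv h0 h1 (fun i => G i * E i) (fun i => G i * F i) :=
  (O.mul hG h).congr fun i => by ring

theorem congr (h : Eqv h0 h1 E F) (h1' : ∀ i, E' i = E i) (h2' : ∀ i, F' i = F i) :
    Eqv h0 h1 E' F' := O.congr h fun i => by rw [h1', h2']

theorem cst_mul (r : ℝ) (h : Eqv h0 h1 E F) :
    Eqv h0 h1 (fun i => BBM.cst r * E i) (fun i => BBM.cst r * F i) :=
  (O.cst_mul r h).congr fun i => by ring

theorem refl (E : Adm lam → Sm) : Eqv h0 h1 E E :=
  (O.mul (a'' := 2) (b'' := 1) (c'' := 1) (O.mul O_m1 O_m1 (a'' := 2) (b'' := 0) (c'' := 0))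
    (O_pair Gr.zero Gr.zero)).congr fun i => by simp

end Eqv

/-- The product of the two ground states. -/
def Par.P (p : Par) : Sm := sh p.y1 qq * sh p.y2 qq

/-- The leading part of the product of the ground states, divided by `e^{-y}`. -/
def Par.Ψ (p : Par) : Sm := 9 * (sh p.y2 ph - sh p.y1 ph) ^ 2

/-- With `e^{-y}` written as `e^{z₁}/e^{z₂}` this is a rational identity in the two exponentials.
The right side is `(1 - e^{-y})² Q₁Q₂`. -/
theorem Par.Ψ_eq (p : Par) :
    cst (eps p) * p.Ψ = p.P - (2 * cst (eps p) - cst (eps p) ^ 2) * p.P := by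
  apply Sm.ext'; intro x
  have e1 := Real.exp_pos (x - p.y1)
  have e2 := Real.exp_pos (x - p.y2)
  have e3 : eps p = Real.exp (x - p.y1) / Real.exp (x - p.y2) := by
    rw [← Real.exp_sub, eps, Par.y]; congr 1; ring
  simp only [Par.Ψ, Par.P, Sm.coe_mul', Sm.coe_sub', Sm.coe_pow', cst_apply, sh_apply, qq_eval, ph_eq,
    Sm.coe_ofNat', e3]
  field_simp
  ring

theorem pr_P : Pr (lam := lam) (fun i => i.1.P) := Pr.pair gr_qq.toL gr_qq.toR

/-- The relative error in `Ψ_eq` is `O(e^{-y})`, and `Q₁Q₂X` is already `O(e^{-y})`, so the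
discrepancy is of second order in `e^{-y}`. -/
theorem eqv_P {X : Adm lam → Sm} (hX : Bd X) :
    Eqv h0 h1 (fun i => i.1.P * X i) (fun i => cst (eps i.1) * (i.1.Ψ * X i)) := by
  have h := (pr_P.mul_bd hX).toO (h0 := h0) (h1 := h1)
  have h' := (O_eps (h0 := h0) (h1 := h1)).mul (a'' := 2) (b'' := 1) (c'' := 1) h
  have h'' := (O_eps (h0 := h0) (h1 := h1)).mul (a'' := 2) (b'' := 1) (c'' := 1) h'
  refine ((h'.cst_mul 2).sub h'').congr fun i => ?_
  have := i.1.Ψ_eq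
  simp only [Pi.mul_apply, cst_ofNat]
  linear_combination -X i * this

end

/-- This relation is the reason for the value of `θ`: it cancels the terms of order `μ_j e^{-y}`
that do not decay away from the solitons. -/
theorem thetaA_eq {lam : ℝ} (h0 : 0 ≤ lam) (h1 : lam < 1) :
    thetaA lam = 36 * ((1 - lam) / 2) - 18 * theta lam := by
  have := den_pos h0 h1
  unfold thetaA theta
  field_simp
  unfold den
  ring

theorem gr_D_Lo {f : Sm} (h : Gr wY (D f)) : Gr wY (D (Lo f)) := by
  have h1 : Gr wY (qq * f) := gr_qq.mul_one (gr_w1_of_deriv h.Y1)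
  have : D (Lo f) = D f - D (D (D f)) - cst 2 * D (qq * f) := by
    simp only [Lo, map_sub, D_mul, mul_assoc, D_ofNat, cst_ofNat]; ring
  rw [this]
  exact (h.sub wY_pos h.deriv.deriv).sub wY_pos (h1.deriv.cst_mul 2)

namespace SData

/-- Behaviour of the profiles at infinity. -/
structure Good (S : SData) (lam τ : ℝ) : Prop where
  gA1 : Gr wY (D S.A1)
  gA2 : Gr wY (D S.A2)
  gB1 : Gr wY (D S.B1)
  gB2 : Gr wY (D S.B2)
  gD1 : Gr wY (D S.D1)
  gD2 : Gr wY (D S.D2)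
  A1_top : Tendsto S.A1.1 atTop (𝓝 (-thetaA lam))
  A1_bot : Tendsto S.A1.1 atBot (𝓝 (thetaA lam))
  A2_top : Tendsto S.A2.1 atTop (𝓝 (thetaA lam))
  A2_bot : Tendsto S.A2.1 atBot (𝓝 (-thetaA lam))
  B1_top : Tendsto S.B1.1 atTop (𝓝 0)
  B1_bot : Tendsto S.B1.1 atBot (𝓝 (2 * thetaB lam))
  B2_top : Tendsto S.B2.1 atTop (𝓝 0)
  B2_bot : Tendsto S.B2.1 atBot (𝓝 (-2 * thetaB lam))
  D1_top : Tendsto S.D1.1 atTop (𝓝 0)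
  D1_bot : Tendsto S.D1.1 atBot (𝓝 (2 * τ))
  D2_top : Tendsto S.D2.1 atTop (𝓝 0)
  D2_bot : Tendsto S.D2.1 atBot (𝓝 (-2 * τ))

end SData

theorem gr_R_sub {f : Sm} (h : Gr wY (D f)) {l : ℝ} (h0 : Tendsto f.1 atTop (𝓝 l)) :
    Gr wR (f - cst l) := by
  refine gr_R_of_deriv (by simpa using h.toR) ?_
  have : Tendsto (fun x => f.1 x - l) atTop (𝓝 (l - l)) := h0.sub_const l
  rw [sub_self] at this; exact this

theorem gr_L_sub {f : Sm} (h : Gr wY (D f)) {l : ℝ} (h0 : Tendsto f.1 atBot (𝓝 l)) :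
    Gr wL (f - cst l) := by
  refine gr_L_of_deriv (by simpa using h.toL) ?_
  have : Tendsto (fun x => f.1 x - l) atBot (𝓝 (l - l)) := h0.sub_const l
  rw [sub_self] at this; exact this

theorem halfDecay_sub {f : Sm} (h : Gr wY (D f)) {l l' : ℝ} (h0 : Tendsto f.1 atTop (𝓝 l))
    (h1 : Tendsto f.1 atBot (𝓝 l')) : HalfDecay (f - cst l) := by
  refine HalfDecay.of_gr (l := l' - l) (by simpa using h) (h1.sub_const l) ?_
  have : Tendsto (fun x => f.1 x - l) atTop (𝓝 (l - l)) := h0.sub_const l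
  rw [sub_self] at this; exact this

section
variable {lam : ℝ} {h0 : 0 ≤ lam} {h1 : lam < 1}

/-- Write `x = z₁ + y₁`: the first part is absorbed in the polynomial weight of `f`, and `y₁` is
bounded by a power of `Y₀`. -/
theorem O_zzP {f g : Sm} (hf : Gr wY f) (hg : Gr wY g) :
    O h0 h1 0 1 1 fun i => zz * (sh i.1.y1 f * sh i.1.y2 g) := by
  have a := O_pair (h0 := h0) (h1 := h1) ((gr_zz.one_mul hf).toL) hg.toR
  have b := (O_y1 (h0 := h0) (h1 := h1)).mul (a'' := 0) (b'' := 1) (c'' := 1)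
    (O_pair hf.toL hg.toR)
  refine (a.add b).congr fun i => ?_
  simp only [map_mul, sh_zz]; ring

theorem O_my {j : Adm lam → ℝ} (hj : O h0 h1 1 0 0 fun i => cst (j i)) (s0 s1 s2 : ℝ) :
    O h0 h1 0 1 0 fun i =>
      cst (s0 * eps i.1 + s1 * j i * i.1.y * eps i.1 + s2 * j i * eps i.1) := by
  have e := O_eps (h0 := h0) (h1 := h1)
  have m := hj.weaken (a' := 0) (b' := 0) (c' := 0)
  have my := m.mul (a'' := 0) (b'' := 0) (c'' := 0) O_y
  have a := e.cst_mul s0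
  have b := (my.mul (a'' := 0) (b'' := 1) (c'' := 0) e).cst_mul s1
  have c := (m.mul (a'' := 0) (b'' := 1) (c'' := 0) e).cst_mul s2
  refine ((a.add b).add c).congr fun i => ?_
  simp only [cst_add, cst_mul]; ring

/-- The effect of a modulation coefficient on a family of profiles around the first soliton. -/
theorem eqv_mod1 {F : ℝ → Sm} {F₁ : Sm} (hF : Tay F F₁) (g1 : Gr wY F₁) (s0 s1 s2 : ℝ) :
    Eqv h0 h1 (fun i => cst (s0 * eps i.1 + s1 * i.1.m1 * i.1.y * eps i.1 + s2 * i.1.m1 * eps i.1)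
        * H lam (sh i.1.y1 (F i.1.m1)))
      (fun i => cst (eps i.1) * ((cst s0 + cst s1 * cst i.1.m1 * cst i.1.y + cst s2 * cst i.1.m1)
        * sh i.1.y1 (H lam (F 0)) + cst s0 * cst i.1.m1 * sh i.1.y1 (H lam F₁))) := by
  have t1 := (O_my (h0 := h0) (h1 := h1) O_m1 s0 s1 s2).mul (a'' := 2) (b'' := 1) (c'' := 1)
    (O_fam1 hF.fam).H
  have t3 := (O_m1 (h0 := h0) (h1 := h1)).mul (a'' := 2) (b'' := 0) (c'' := 0) O_m1
  have t4 := (O_half1 (h0 := h0) (h1 := h1) g1.halfDecay).H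
  have e := O_eps (h0 := h0) (h1 := h1)
  have u1 := ((t3.mul (a'' := 2) (b'' := 0) (c'' := 0) O_y).mul (a'' := 2) (b'' := 1) (c'' := 0)
    e).mul (a'' := 2) (b'' := 1) (c'' := 1) t4 |>.cst_mul s1
  have u2 := (t3.mul (a'' := 2) (b'' := 1) (c'' := 0)
    e).mul (a'' := 2) (b'' := 1) (c'' := 1) t4 |>.cst_mul s2
  refine ((t1.add u1).add u2).congr fun i => ?_
  simp only [map_sub, map_mul, sh_cst, H_sub, H_cst_mul, H_sh, cst_add, cst_mul]; ring

theorem eqv_mod2 {F : ℝ → Sm} {F₁ : Sm} (hF : Tay F F₁) (g1 : Gr wY F₁) (s0 s1 s2 : ℝ) :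
    Eqv h0 h1 (fun i => cst (s0 * eps i.1 + s1 * i.1.m2 * i.1.y * eps i.1 + s2 * i.1.m2 * eps i.1)
        * H lam (sh i.1.y2 (F i.1.m2)))
      (fun i => cst (eps i.1) * ((cst s0 + cst s1 * cst i.1.m2 * cst i.1.y + cst s2 * cst i.1.m2)
        * sh i.1.y2 (H lam (F 0)) + cst s0 * cst i.1.m2 * sh i.1.y2 (H lam F₁))) := by
  have t1 := (O_my (h0 := h0) (h1 := h1) O_m2 s0 s1 s2).mul (a'' := 2) (b'' := 1) (c'' := 1)
    (O_fam2 hF.fam).H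
  have t3 := (O_m2 (h0 := h0) (h1 := h1)).mul (a'' := 2) (b'' := 0) (c'' := 0) O_m2
  have t4 := (O_half2 (h0 := h0) (h1 := h1) g1.halfDecay).H
  have e := O_eps (h0 := h0) (h1 := h1)
  have u1 := ((t3.mul (a'' := 2) (b'' := 0) (c'' := 0) O_y).mul (a'' := 2) (b'' := 1) (c'' := 0)
    e).mul (a'' := 2) (b'' := 1) (c'' := 1) t4 |>.cst_mul s1
  have u2 := (t3.mul (a'' := 2) (b'' := 1) (c'' := 0)
    e).mul (a'' := 2) (b'' := 1) (c'' := 1) t4 |>.cst_mul s2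
  refine ((t1.add u1).add u2).congr fun i => ?_
  simp only [map_sub, map_mul, sh_cst, H_sub, H_cst_mul, H_sh, cst_add, cst_mul]; ring

/-! ### The interaction of the solitons -/

theorem sh_zz_add (p : Par) : sh p.y2 zz = sh p.y1 zz + cst p.y := by
  simp only [sh_zz, Par.y, cst_sub]; ring

/-- First order expansion of both factors. The three discarded pieces are the second order remainder
of `R₁` times `R₂`, the affine part of `R₁` times the second order remainder of `R₂`, and
`μ₁μ₂Λ₁Λ₂`. -/
theorem eqv_RR : Eqv h0 h1
    (fun i => sh i.1.y1 (Rs lam i.1.m1) * sh i.1.y2 (Rs lam i.1.m2))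
    (fun i => i.1.P + cst i.1.m1 * (sh i.1.y1 (lamP lam) * sh i.1.y2 qq)
      + cst i.1.m2 * (sh i.1.y1 qq * sh i.1.y2 (lamP lam))) := by
  have hT := tay_Rs h0 h1
  have gΛ : Gr wY (lamP lam) := gr_lamQ _
  have hR0 : Gr wY (Rs lam 0) := by rw [Rs_zero]; exact gr_qq
  have t1 := O_fam_pair (h0 := h0) (h1 := h1) hT.fam (hT.fam0 gΛ hR0)
  have t2 := O_fam_pair (h0 := h0) (h1 := h1)
    ((Fam.of_gr gr_qq).add ((Fam.of_gr gΛ).mu_mul.weaken (b := 0) (by norm_num))) hT.fam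
  have t3 := O_fam_pair (h0 := h0) (h1 := h1) (Fam.of_gr gΛ).mu_mul (Fam.of_gr gΛ).mu_mul
  refine ((t1.add (t2.weaken (a' := 2))).add (t3.weaken (a' := 2))).congr fun i => ?_
  simp only [map_sub, map_add, map_mul, sh_cst, Par.P, Rs_zero]; ring

/-- The polynomial `z₂φ₂ - z₁φ₁`. -/
def Par.X (p : Par) : Sm := sh p.y2 (zz * ph) - sh p.y1 (zz * ph)

theorem bd_X : Bd (lam := lam) (fun i => i.1.X) := by
  have h : Gr w1 (zz * ph) := gr_zz.one_mul gr_ph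
  convert (Bd.of2 h).add ((Bd.cst (-1)).mul (Bd.of1 h)) using 2 with i
  simp [Par.X, cst_neg]; ring

/-- As `Λ = Q(1 - ((1 - λ)/2) zφ)`, replacing `μ₂` by `-μ₁` makes the two first order terms collapse
into `Q₁Q₂` times `((1 - λ)/2) μ₁ (z₂φ₂ - z₁φ₁)`. -/
theorem eqv_RR' : Eqv h0 h1
    (fun i => sh i.1.y1 (Rs lam i.1.m1) * sh i.1.y2 (Rs lam i.1.m2))
    (fun i => cst (eps i.1) * (i.1.Ψ * 1) + cst ((1 - lam) / 2) *
      (cst i.1.m1 * (cst (eps i.1) * (i.1.Ψ * i.1.X)))) := by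
  refine eqv_RR.trans ?_
  have hX := bd_X (lam := lam)
  refine Eqv.trans (F := fun i => i.1.P * 1 + cst ((1 - lam) / 2) * (cst i.1.m1 *
    (i.1.P * i.1.X))) ?_ ?_
  · have hz : Bd (lam := lam) (fun i => sh i.1.y2 (zz * ph)) := Bd.of2 (gr_zz.one_mul gr_ph)
    have a := (O_m_sum (h0 := h0) (h1 := h1)).mul (a'' := 2) (b'' := 1) (c'' := 1) pr_P.toO
    have b := (O_m_sum (h0 := h0) (h1 := h1)).mul (a'' := 2) (b'' := 1) (c'' := 1)
      (pr_P.mul_bd hz).toO |>.cst_mul ((1 - lam) / 2)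
    refine (a.sub b).congr fun i => ?_
    simp only [lamP, lamQ, map_mul, map_sub, map_one, sh_cst, Par.P, Par.X, cst_add, Pi.mul_apply]
    ring
  · have one : Bd (lam := lam) (fun _ => 1) := by simpa using Bd.cst (lam := lam) 1
    exact (eqv_P one).add (((eqv_P hX).mul O_m1).cst_mul _)

theorem gr_one_sub_ph' : Gr w1 (1 - ph) := gr_one_sub_ph.R1
theorem gr_one_add_ph' : Gr w1 (1 + ph) := gr_one_add_ph.L1

/-- Products with a factor `(1 + φ₁)(1 - φ₂)` are small. -/
theorem pr_uv {X : Adm lam → Sm} (hX : Bd X) :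
    Pr fun i => sh i.1.y1 (1 + ph) * sh i.1.y2 (1 - ph) * X i :=
  (Pr.pair gr_one_add_ph gr_one_sub_ph).mul_bd hX

theorem eqv_eps_pr {E F X : Adm lam → Sm} (hX : Pr X) (h : ∀ i, E i - F i = X i) :
    Eqv h0 h1 (fun i => cst (eps i.1) * E i) (fun i => cst (eps i.1) * F i) := by
  refine (O_eps.mul (a'' := 2) (b'' := 1) (c'' := 1) hX.toO).congr fun i => ?_
  rw [← h]; ring

/-- The separation of variables is the identity `(v - u)² = (1 - u)² + (1 + v)² - 4 + 2(1 + u)(1 -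
v)` with `u = φ₁`, `v = φ₂`; its last term is negligible. -/
theorem eqv_Ψ : Eqv h0 h1 (fun i => cst (eps i.1) * (i.1.Ψ * 1))
    (fun i => cst (eps i.1) * (9 * (sh i.1.y1 ((1 - ph) ^ 2) + sh i.1.y2 ((1 + ph) ^ 2) - 4))) := by
  refine eqv_eps_pr (pr_uv (Bd.cst 18)) fun i => ?_
  simp only [Par.Ψ, map_pow, map_sub, map_add, map_one, cst_ofNat]; ring

theorem bd_uvz (c1 c2 c3 c4 c5 c6 : ℝ) : Bd (lam := lam) fun i =>
    sh i.1.y1 zz * (cst c1 + cst c2 * sh i.1.y1 ph + cst c3 * sh i.1.y2 ph)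
      + sh i.1.y2 zz * (cst c4 + cst c5 * sh i.1.y1 ph + cst c6 * sh i.1.y2 ph) :=
  ((Bd.of1 gr_zz).mul (((Bd.cst c1).add ((Bd.cst c2).mul (Bd.of1 gr_ph))).add
    ((Bd.cst c3).mul (Bd.of2 gr_ph)))).add ((Bd.of2 gr_zz).mul (((Bd.cst c4).add
      ((Bd.cst c5).mul (Bd.of1 gr_ph))).add ((Bd.cst c6).mul (Bd.of2 gr_ph))))

/-- The same separation modulo `(1 + φ₁)(1 - φ₂)`. The listed coefficients are those of the quotient
polynomial, and `z₂ = z₁ + y` trades a mixed `z_j` for the explicit factor `y`. -/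
theorem eqv_ΨX : Eqv h0 h1 (fun i => cst (eps i.1) * (i.1.Ψ * i.1.X))
    (fun i => cst (eps i.1) * (9 * (sh i.1.y1 (zz * (1 - ph) ^ 3) + sh i.1.y2 (zz * (1 + ph) ^ 3)
      + cst i.1.y * sh i.1.y1 ((1 - ph) ^ 2) - cst i.1.y * sh i.1.y2 ((1 + ph) ^ 2)
      - 4 * (sh i.1.y1 zz + sh i.1.y2 zz)))) := by
  refine eqv_eps_pr (pr_uv (bd_uvz 27 (-18) 9 27 (-9) 18)) fun i => ?_
  have := sh_zz_add i.1
  simp only [Par.Ψ, Par.X, map_mul, map_pow, map_sub, map_add, map_one, cst_ofNat, cst_neg, this]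
  ring

theorem eqv_pair : Eqv h0 h1
    (fun i => D (2 * (sh i.1.y1 (Rs lam i.1.m1) * sh i.1.y2 (Rs lam i.1.m2))))
    (fun i => cst (eps i.1) * (18 * sh i.1.y1 (D ((1 - ph) ^ 2)) + 18 * sh i.1.y2 (D ((1 + ph) ^ 2)))
      + cst ((1 - lam) / 2) * (cst i.1.m1 * (cst (eps i.1) * (18 *
        (sh i.1.y1 (D (zz * (1 - ph) ^ 3)) + sh i.1.y2 (D (zz * (1 + ph) ^ 3))
      + cst i.1.y * sh i.1.y1 (D ((1 - ph) ^ 2)) - cst i.1.y * sh i.1.y2 (D ((1 + ph) ^ 2)) - 8))))) := by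
  have h := ((eqv_RR' (h0 := h0) (h1 := h1)).trans
    (eqv_Ψ.add ((eqv_ΨX.mul O_m1).cst_mul ((1 - lam) / 2)))).cst_mul 2 |>.deriv
  refine h.congr (fun i => by rw [cst_ofNat]) fun i => ?_
  have z1 : D (sh i.1.y1 zz) = 1 := by rw [D_sh, D_zz, map_one]
  have z2 : D (sh i.1.y2 zz) = 1 := by rw [D_sh, D_zz, map_one]
  simp only [cst_ofNat, ← D_sh]
  generalize sh i.1.y1 ((1 - ph) ^ 2) = a1
  generalize sh i.1.y2 ((1 + ph) ^ 2) = a2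
  generalize sh i.1.y1 (zz * (1 - ph) ^ 3) = a3
  generalize sh i.1.y2 (zz * (1 + ph) ^ 3) = a4
  simp only [D_mul, map_add, map_sub, D_ofNat, D_cst, z1, z2]
  ring

end

/-! ### The linearized operator applied to the correction. -/

/-- The linearization around the sum of the ground states. -/
def Par.Lf (p : Par) (X : Sm) : Sm :=
  D (D (D X)) - D X + D (2 * ((sh p.y1 qq + sh p.y2 qq) * X))

namespace Par
variable (p : Par)

theorem Lf_add (X Y : Sm) : p.Lf (X + Y) = p.Lf X + p.Lf Y := by
  simp only [Lf, map_add, mul_add]; ring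

theorem Lf_sub (X Y : Sm) : p.Lf (X - Y) = p.Lf X - p.Lf Y := by
  simp only [Lf, map_sub, mul_sub]; ring

theorem Lf_cst_mul (c : ℝ) (X : Sm) : p.Lf (cst c * X) = cst c * p.Lf X := by
  have e : 2 * ((sh p.y1 qq + sh p.y2 qq) * (cst c * X))
      = cst c * (2 * ((sh p.y1 qq + sh p.y2 qq) * X)) := by ring
  have hD : ∀ Y : Sm, D (cst c * Y) = cst c * D Y := fun Y => by simp
  simp only [Lf, e, hD]; ring

/-- Near its own soliton a profile sees `-(Lf)'`; the other soliton contributes only the cross term.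
-/
theorem Lf_sh1 (f : Sm) :
    p.Lf (sh p.y1 f) = -sh p.y1 (D (Lo f)) + D (2 * (sh p.y1 f * sh p.y2 qq)) := by
  simp only [Lf, Lo, ← D_sh, map_sub, map_mul, Sm.map_ofNat', add_mul, mul_add, map_add,
    mul_comm (sh p.y2 qq) (sh p.y1 f), mul_assoc]
  ring

theorem Lf_sh2 (f : Sm) :
    p.Lf (sh p.y2 f) = -sh p.y2 (D (Lo f)) + D (2 * (sh p.y1 qq * sh p.y2 f)) := by
  simp only [Lf, Lo, ← D_sh, map_sub, map_mul, Sm.map_ofNat', add_mul, mul_add, map_add,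
    mul_assoc]
  ring

end Par

section
variable {lam : ℝ} {h0 : 0 ≤ lam} {h1 : lam < 1}

theorem O_qq12 : O h0 h1 0 0 1 fun i => sh i.1.y1 qq + sh i.1.y2 qq :=
  (O_half1 gr_qq.halfDecay).add (O_half2 gr_qq.halfDecay)

theorem O.Lf {a b c : ℕ} {X : Adm lam → Sm} (h : O h0 h1 a b c X) :
    O h0 h1 a b c fun i => i.1.Lf (X i) := by
  refine ((h.deriv.deriv.deriv.sub h.deriv).add
    ((O_qq12.mul (a'' := a) (b'' := b) (c'' := c) h).cst_mul 2).deriv).congr fun i => ?_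
  rw [Par.Lf, cst_ofNat]

theorem Eqv.Lf {E F : Adm lam → Sm} (h : Eqv h0 h1 E F) :
    Eqv h0 h1 (fun i => i.1.Lf (E i)) (fun i => i.1.Lf (F i)) :=
  (O.Lf h).congr fun i => by rw [Par.Lf_sub]

/-- `(f(z₁) - f(-∞)) Q(z₂)` -/
theorem pr_left {f : Sm} (h : Gr wY (D f)) {l : ℝ} (hl : Tendsto f.1 atBot (𝓝 l)) {g : Sm}
    (hg : Gr wY g) : Pr (lam := lam) fun i => sh i.1.y1 (f - cst l) * sh i.1.y2 g :=
  Pr.pair (gr_L_sub h hl) hg.toR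

theorem pr_right {f : Sm} (h : Gr wY (D f)) {l : ℝ} (hl : Tendsto f.1 atTop (𝓝 l)) {g : Sm}
    (hg : Gr wY g) : Pr (lam := lam) fun i => sh i.1.y1 g * sh i.1.y2 (f - cst l) :=
  Pr.pair hg.toL (gr_R_sub h hl)

theorem O_eps_D {E : Adm lam → Sm} (h : Pr E) :
    O h0 h1 2 1 1 fun i => cst (eps i.1) * D (2 * E i) := by
  refine (O_eps.mul (a'' := 2) (b'' := 1) (c'' := 1)
    ((h.toO (h0 := h0) (h1 := h1)).cst_mul 2).deriv).congr fun i => ?_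
  rw [cst_ofNat]

variable {S : SData} {τ : ℝ}

/-- In the cross terms each `A_j` may be replaced by its limit on the side of the other soliton.
Both limits, of `A₁` at `-∞` and of `A₂` at `+∞`, equal `θ_A`, whence the term `2θ_A Q'` at both
solitons. -/
theorem eqv_Lf_A (g : S.Good lam τ) :
    Eqv h0 h1 (fun i => i.1.Lf (cst (eps i.1) * (sh i.1.y1 S.A1 + sh i.1.y2 S.A2)))
      (fun i => cst (eps i.1) * (-sh i.1.y1 (D (Lo S.A1)) - sh i.1.y2 (D (Lo S.A2))
        + cst (2 * thetaA lam) * (sh i.1.y1 (D qq) + sh i.1.y2 (D qq)))) := by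
  have a := O_eps_D (h0 := h0) (h1 := h1) (pr_left g.gA1 g.A1_bot gr_qq)
  have b := O_eps_D (h0 := h0) (h1 := h1) (pr_right g.gA2 g.A2_top gr_qq)
  refine (a.add b).congr fun i => ?_
  simp only [Par.Lf_cst_mul, Par.Lf_add, Par.Lf_sh1, Par.Lf_sh2, cst_mul, cst_ofNat, map_sub,
    sh_cst, ← D_sh, sub_mul, mul_sub]
  have e1 : D (2 * (cst (thetaA lam) * sh i.1.y2 qq))
      = 2 * cst (thetaA lam) * D (sh i.1.y2 qq) := by
    rw [← mul_assoc, ← cst_ofNat, ← BBM.cst_mul]; simp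
  have e2 : D (2 * (sh i.1.y1 qq * cst (thetaA lam)))
      = 2 * cst (thetaA lam) * D (sh i.1.y1 qq) := by
    rw [mul_comm (sh i.1.y1 qq), ← mul_assoc, ← cst_ofNat, ← BBM.cst_mul]; simp
  rw [e1, e2]; ring

/-- The contribution of a pair of profiles multiplied by the soliton parameters. -/
theorem eqv_Lf_mu {F1 F2 : Sm} {l2 : ℝ} (g1 : Gr wY (D F1)) (g2 : Gr wY (D F2))
    (hb : Tendsto F1.1 atBot (𝓝 (2 * l2))) (ht : Tendsto F2.1 atTop (𝓝 0))
    {s : Adm lam → ℝ} (hs : O h0 h1 0 0 0 fun i => cst (s i)) :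
    Eqv h0 h1 (fun i => i.1.Lf (cst (s i) * cst (eps i.1) *
        (cst i.1.m1 * sh i.1.y1 F1 + cst i.1.m2 * sh i.1.y2 F2)))
      (fun i => cst (s i) * cst (eps i.1) * (cst i.1.m1 * -sh i.1.y1 (D (Lo F1))
        - cst i.1.m2 * (sh i.1.y2 (D (Lo F2)) + cst (4 * l2) * sh i.1.y2 (D qq)))) := by
  have a := (hs.mul (a'' := 1) (b'' := 0) (c'' := 0) O_m1).mul (a'' := 2) (b'' := 1) (c'' := 1)
    (O_eps_D (h0 := h0) (h1 := h1) (pr_left g1 hb gr_qq))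
  have b := (hs.mul (a'' := 1) (b'' := 0) (c'' := 0) O_m2).mul (a'' := 2) (b'' := 1) (c'' := 1)
    (O_eps_D (h0 := h0) (h1 := h1) (pr_right g2 ht gr_qq))
  -- The left limit of `F1` is felt by the second soliton with coefficient `μ₁`; this term pays for
  -- writing it with `-μ₂`. The first soliton feels nothing, as `F2` vanishes at `+∞`.
  have c := ((hs.mul (a'' := 2) (b'' := 0) (c'' := 0) O_m_sum).mul (a'' := 2) (b'' := 1) (c'' := 0)
    O_eps).mul (a'' := 2) (b'' := 1) (c'' := 1) (O_half2 gr_D_qq.halfDecay) |>.cst_mul (4 * l2)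
  refine ((a.add b).add c).congr fun i => ?_
  have e1 : D (2 * (cst (2 * l2) * sh i.1.y2 qq))
      = 2 * cst (2 * l2) * D (sh i.1.y2 qq) := by
    rw [← mul_assoc, ← cst_ofNat, ← BBM.cst_mul]; simp
  have e3 : ∀ X : Sm, cst (s i) * cst (eps i.1) * X = cst (s i) * (cst (eps i.1) * X) :=
    fun X => by ring
  simp only [e3, Par.Lf_cst_mul, Par.Lf_add, Par.Lf_sh1, Par.Lf_sh2, map_sub, cst_add, cst_zero,
    sh_cst, ← D_sh, sub_mul, mul_sub, e1, sub_zero]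
  have e4 : (4 : Sm) = 2 * 2 := by norm_num
  simp only [cst_mul, cst_ofNat, e4]; ring

theorem Par.Lf_cst_mul2 (p : Par) (X : Sm) : p.Lf (2 * X) = 2 * p.Lf X := by
  have := p.Lf_cst_mul 2 X; rwa [cst_ofNat] at this

/-- Here `μ₁ - μ₂` becomes `2μ₁` and `2x` becomes `z₁ + z₂`, the latter thanks to the smallness of
`y₁ + y₂`. The square `(φ₂ - φ₁)²` is then separated as before. -/
theorem eqv_zzP : Eqv h0 h1
    (fun i => cst (theta lam) * cst (i.1.m1 - i.1.m2) * (zz * (sh i.1.y1 qq * sh i.1.y2 qq)))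
    (fun i => cst (theta lam) * (cst i.1.m1 * (cst (eps i.1) * (18 *
      (sh i.1.y1 (zz * (1 - ph) ^ 2) + cst (1 / 2) * (cst i.1.y * sh i.1.y1 ((1 - ph) ^ 2))
      + sh i.1.y2 (zz * (1 + ph) ^ 2) - cst (1 / 2) * (cst i.1.y * sh i.1.y2 ((1 + ph) ^ 2))
      - 2 * (sh i.1.y1 zz + sh i.1.y2 zz)))))) := by
  have hB : Bd (lam := lam) fun i => sh i.1.y1 zz + sh i.1.y2 zz :=
    (Bd.of1 gr_zz).add (Bd.of2 gr_zz)
  have a := (O_m_sum (h0 := h0) (h1 := h1)).mul (a'' := 2) (b'' := 1) (c'' := 1)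
    (O_zzP gr_qq gr_qq) |>.cst_mul (theta lam)
  have b := ((O_m1 (h0 := h0) (h1 := h1)).mul (a'' := 2) (b'' := 0) (c'' := 0) O_y_sum).mul
    (a'' := 2) (b'' := 1) (c'' := 1) pr_P.toO |>.cst_mul (theta lam)
  have c : Eqv h0 h1
      (fun i => cst (theta lam) * cst (i.1.m1 - i.1.m2) * (zz * (sh i.1.y1 qq * sh i.1.y2 qq)))
      (fun i => cst (theta lam) * (cst i.1.m1 * (i.1.P * (sh i.1.y1 zz + sh i.1.y2 zz)))) := by
    refine (b.sub a).congr fun i => ?_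
    simp only [Par.P, sh_zz, cst_sub, cst_add]; ring
  refine c.trans ((((eqv_P hB).trans ?_).mul O_m1).cst_mul _)
  refine eqv_eps_pr (pr_uv ((Bd.cst 18).mul hB)) fun i => ?_
  have := sh_zz_add i.1
  have e : (1 : Sm) = 2 * cst (1 / 2) := by
    rw [← cst_ofNat, ← BBM.cst_mul]; norm_num
  simp only [Par.Ψ, map_mul, map_pow, map_sub, map_add, map_one, cst_ofNat, this, Pi.mul_apply]
  generalize sh i.1.y1 zz = z
  generalize cst i.1.y = y
  generalize sh i.1.y1 ph = u at *
  generalize sh i.1.y2 ph = v at *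
  linear_combination (9 * y * (1 - u) ^ 2 - 9 * y * (1 + v) ^ 2) * e

/-- Once `x Q₁Q₂` is separated, `L` acts on each piece alone. The cross terms add up to `z₁ + z₂`
times `(1 + φ₁)Q₂` and `Q₁(1 - φ₂)` with polynomial coefficients, hence are negligible. -/
theorem eqv_Lf_zzP : Eqv h0 h1
    (fun i => i.1.Lf (cst (theta lam) * cst (i.1.m1 - i.1.m2)
      * (zz * (sh i.1.y1 qq * sh i.1.y2 qq))))
    (fun i => cst (theta lam) * (cst i.1.m1 * (cst (eps i.1) * (18 *
      (-sh i.1.y1 (D (Lo (zz * (1 - ph) ^ 2)))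
      - cst (1 / 2) * (cst i.1.y * sh i.1.y1 (D (Lo ((1 - ph) ^ 2))))
      - sh i.1.y2 (D (Lo (zz * (1 + ph) ^ 2)))
      + cst (1 / 2) * (cst i.1.y * sh i.1.y2 (D (Lo ((1 + ph) ^ 2)))) + 4))))) := by
  refine (eqv_zzP.Lf).trans ?_
  have h : ∀ (c1 c2 : ℝ), Gr w1 (cst c1 + cst c2 * ph) := fun c1 c2 =>
    (Gr.cst c1).add w1_pos (gr_ph.cst_mul c2)
  have b1 : Bd (lam := lam) fun i => (sh i.1.y1 zz + sh i.1.y2 zz)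
      * sh i.1.y1 (cst (-27) + cst 9 * ph) :=
    ((Bd.of1 gr_zz).add (Bd.of2 gr_zz)).mul (Bd.of1 (h _ _))
  have b2 : Bd (lam := lam) fun i => (sh i.1.y1 zz + sh i.1.y2 zz)
      * sh i.1.y2 (cst (-27) + cst (-9) * ph) :=
    ((Bd.of1 gr_zz).add (Bd.of2 gr_zz)).mul (Bd.of2 (h _ _))
  have p1 := (Pr.pair (lam := lam) gr_one_add_ph gr_qq.toR).mul_bd b1
  have p2 := (Pr.pair (lam := lam) gr_qq.toL gr_one_sub_ph).mul_bd b2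
  have := (O_m1.mul (a'' := 2) (b'' := 1) (c'' := 1)
    (O_eps_D (h0 := h0) (h1 := h1) (p1.add p2))).cst_mul (theta lam)
  refine this.congr fun i => ?_
  have e18 : (18 : Sm) = cst 18 := (cst_ofNat 18).symm
  have hl : ∀ X, i.1.Lf (18 * X) = 18 * i.1.Lf X := fun X => by rw [e18, Par.Lf_cst_mul]
  have z1 : D (sh i.1.y1 zz) = 1 := by rw [D_sh, D_zz, map_one]
  have z2 : D (sh i.1.y2 zz) = 1 := by rw [D_sh, D_zz, map_one]
  -- The sum `z₁ + z₂` is affine, so only `-D` contributes besides the potential; this is the origin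
  -- of the constant `4`.
  have key : i.1.Lf (sh i.1.y1 zz + sh i.1.y2 zz) =
      -2 + D (2 * ((sh i.1.y1 qq + sh i.1.y2 qq) * (sh i.1.y1 zz + sh i.1.y2 zz))) := by
    unfold Par.Lf; simp only [map_add, z1, z2]; simp only [← cst_one, D_cst, map_zero]
    rw [cst_one]; ring
  simp only [Par.Lf_cst_mul, hl, Par.Lf_add, Par.Lf_sub, Par.Lf_cst_mul2, Par.Lf_sh1, Par.Lf_sh2] 
  rw [Par.Lf_add, Par.Lf_sh1, Par.Lf_sh2] at key
  have hDc : ∀ (c : ℝ) (Y : Sm), cst c * D Y = D (cst c * Y) := fun c Y => by simp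
  have hcancel : ∀ A B : Sm, D A = B → B - D A = 0 := fun A B h => by rw [h, sub_self]
  have e2' : ∀ Y : Sm, (2 : Sm) * D Y = D (2 * Y) := fun Y => by simp
  have hal : ∀ X : Sm, cst (1 / 2) * (2 * X) = X := fun X => by
    rw [← mul_assoc, ← cst_ofNat, ← BBM.cst_mul]; simp
  -- Since `z₁ + y/2 = z₂ - y/2 = (z₁ + z₂)/2`, the common factor `z₁ + z₂` comes out, and `(1 - u)²
  -- - 4 = -(1 + u)(3 - u)`, `(1 + v)² - 4 = -(1 - v)(3 + v)` exhibit the small factors.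
  have hmain : 18 * (D (2 * (sh i.1.y1 (zz * (1 - ph) ^ 2) * sh i.1.y2 qq))
      + cst (1 / 2) * (cst i.1.y * D (2 * (sh i.1.y1 ((1 - ph) ^ 2) * sh i.1.y2 qq)))
      + D (2 * (sh i.1.y1 qq * sh i.1.y2 (zz * (1 + ph) ^ 2)))
      - cst (1 / 2) * (cst i.1.y * D (2 * (sh i.1.y1 qq * sh i.1.y2 ((1 + ph) ^ 2))))
      - 2 * D (2 * ((sh i.1.y1 qq + sh i.1.y2 qq) * (sh i.1.y1 zz + sh i.1.y2 zz)))) =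
      D (2 * (sh i.1.y1 (1 + ph) * sh i.1.y2 qq * ((sh i.1.y1 zz + sh i.1.y2 zz)
        * sh i.1.y1 (cst (-27) + cst 9 * ph)) + sh i.1.y1 qq * sh i.1.y2 (1 - ph)
        * ((sh i.1.y1 zz + sh i.1.y2 zz) * sh i.1.y2 (cst (-27) + cst (-9) * ph)))) := by
    rw [e18]
    simp only [hDc, e2', ← map_add, ← map_sub]
    congr 1
    have := sh_zz_add i.1
    simp only [map_mul, map_pow, map_sub, map_add, map_one, cst_neg, cst_ofNat, map_neg,
      Sm.map_ofNat', this]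
    have e : (1 : Sm) = 2 * cst (1 / 2) := by
      rw [← cst_ofNat, ← BBM.cst_mul]; norm_num
    generalize sh i.1.y1 zz = z
    generalize cst i.1.y = y
    generalize sh i.1.y1 ph = u at *
    generalize sh i.1.y2 ph = v at *
    generalize sh i.1.y1 qq = q1 at *
    generalize sh i.1.y2 qq = q2 at *
    linear_combination (-18 * y * (1 - u) ^ 2 * q2 + 18 * y * q1 * (1 + v) ^ 2) * e
  simp only [Pi.add_apply, Pi.mul_apply]
  linear_combination cst (theta lam) * cst i.1.m1 * cst (eps i.1) * (hmain - 36 * key)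

end

/-! ### The six profile equations, and the sizes of the correction and its derivatives. -/

namespace SData

variable (S : SData) (lam τ : ℝ) (Ξ : Sm)

/-- The leading order equation of `A₁`. -/
def EA1 : Sm := -D (Lo S.A1) + cst (2 * thetaA lam) * D qq + 18 * D ((1 - ph) ^ 2)
  + cst S.α * H lam (lamP lam) + cst S.a * H lam (D qq)
/-- The leading order equation of `A₂`. -/
def EA2 : Sm := -D (Lo S.A2) + cst (2 * thetaA lam) * D qq + 18 * D ((1 + ph) ^ 2)
  - cst S.α * H lam (lamP lam) + cst S.a * H lam (D qq)

/-- The source terms of the equations of `B_j`. -/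
def H1 : Sm := cst (18 * ((1 - lam) / 2)) * D ((1 - ph) ^ 2)
  - cst (9 * theta lam) * D (Lo ((1 - ph) ^ 2))
def H2 : Sm := -cst (18 * ((1 - lam) / 2)) * D ((1 + ph) ^ 2)
  + cst (9 * theta lam) * D (Lo ((1 + ph) ^ 2))

/-- The equation of `B₁`. -/
def EB1 : Sm := -D (Lo S.B1) + H1 lam + cst S.β * H lam (lamP lam) + cst S.b1 * H lam (D qq)
/-- The equation of `B₂`. -/
def EB2 : Sm := -D (Lo S.B2) - H2 lam - cst S.β * H lam (lamP lam) + cst S.b2 * H lam (D qq)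
  - cst (4 * thetaB lam) * D qq

/-- The source terms of the equations of `D_j`. -/
def G1 : Sm := cst (18 * ((1 - lam) / 2)) * D (zz * (1 - ph) ^ 3)
  - cst (18 * theta lam) * D (Lo (zz * (1 - ph) ^ 2)) - 2 * H lam (S.A1 + cst (thetaA lam))
def G2 : Sm := cst (18 * ((1 - lam) / 2)) * D (zz * (1 + ph) ^ 3)
  - cst (18 * theta lam) * D (Lo (zz * (1 + ph) ^ 2)) - 2 * H lam (S.A2 + cst (thetaA lam))

/-- The equation of `D₁`. -/
def ED1 : Sm := -D (Lo S.D1) + S.G1 lam + 2 * D (lamP lam * (S.A1 + cst (thetaA lam)))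
  + cst S.α * H lam Ξ + cst S.δ * H lam (lamP lam) + cst S.d1 * H lam (D qq)
  + cst S.a * H lam (D (lamP lam)) - H lam (D S.A1)
/-- The equation of `D₂`. -/
def ED2 : Sm := -D (Lo S.D2) - S.G2 lam + 2 * D (lamP lam * (S.A2 + cst (thetaA lam)))
  - cst S.α * H lam Ξ - cst S.δ * H lam (lamP lam) + cst S.d2 * H lam (D qq)
  + cst S.a * H lam (D (lamP lam)) - H lam (D S.A2) - cst (4 * τ) * D qq

/-- The main part of the error of the approximate solution. -/
def Main (p : Par) : Sm := cst (eps p) * (sh p.y1 (S.EA1 lam) + sh p.y2 (S.EA2 lam)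
  + cst p.y * (cst p.m1 * sh p.y1 (S.EB1 lam) + cst p.m2 * sh p.y2 (S.EB2 lam))
  + (cst p.m1 * sh p.y1 (S.ED1 lam Ξ) + cst p.m2 * sh p.y2 (S.ED2 lam τ Ξ)))

/-- The higher order part of the correction. -/
def Wrest (p : Par) : Sm :=
  cst (theta lam) * cst (p.m1 - p.m2) * (zz * (sh p.y1 qq * sh p.y2 qq))
  + cst p.y * cst (eps p) * (cst p.m1 * sh p.y1 S.B1 + cst p.m2 * sh p.y2 S.B2)
  + cst (1 : ℝ) * cst (eps p) * (cst p.m1 * sh p.y1 S.D1 + cst p.m2 * sh p.y2 S.D2)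

theorem W_eq (p : Par) :
    S.W lam p = cst (eps p) * (sh p.y1 S.A1 + sh p.y2 S.A2) + S.Wrest lam p := by
  rw [W, Wrest, cst_one]; ring

end SData

theorem HalfDecay.of_zero {f : Sm} {l : ℝ} (h : Gr wY (D f)) (h0 : Tendsto f.1 atTop (𝓝 0))
    (h1 : Tendsto f.1 atBot (𝓝 l)) : HalfDecay f := HalfDecay.of_gr h h1 h0

section
variable {lam : ℝ} {h0 : 0 ≤ lam} {h1 : lam < 1} {S : SData} {τ : ℝ}

theorem O_m_diff : O h0 h1 1 0 0 fun i => cst (i.1.m1 - i.1.m2) :=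
  (O_m1.sub O_m2).congr fun _ => cst_sub _ _

/-- Neither `A_j` decays at `+∞`, but their limits there are opposite, so the sum carries the weight
`ω`. -/
theorem O_A (g : S.Good lam τ) : O h0 h1 0 0 1 fun i => sh i.1.y1 S.A1 + sh i.1.y2 S.A2 := by
  refine ((O_half1 (halfDecay_sub g.gA1 g.A1_top g.A1_bot)).add
    (O_half2 (halfDecay_sub g.gA2 g.A2_top g.A2_bot))).congr fun i => ?_
  simp only [map_sub, map_neg, sh_cst, cst_neg]; ring

/-- Products `s e^{-y} (μ₁ f₁(z₁) + μ₂ f₂(z₂))`. -/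
theorem O_mu_pair {f1 f2 : Sm} (hf1 : HalfDecay f1) (hf2 : HalfDecay f2) {s : Adm lam → Sm}
    (hs : O h0 h1 0 0 0 s) : O h0 h1 1 1 1 fun i => s i * cst (eps i.1) *
      (cst i.1.m1 * sh i.1.y1 f1 + cst i.1.m2 * sh i.1.y2 f2) := by
  have a := (O_m1 (h0 := h0) (h1 := h1)).mul (a'' := 1) (b'' := 0) (c'' := 1) (O_half1 hf1)
  have b := (O_m2 (h0 := h0) (h1 := h1)).mul (a'' := 1) (b'' := 0) (c'' := 1) (O_half2 hf2)
  exact (hs.mul (a'' := 0) (b'' := 1) (c'' := 0) O_eps).mul (a.add b)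

theorem O_mu1 {f : Sm} (hf : HalfDecay f) {s : Adm lam → Sm}
    (hs : O h0 h1 0 0 0 s) : O h0 h1 1 1 1 fun i => s i * cst (eps i.1) *
      (cst i.1.m1 * sh i.1.y1 f) := by
  have a := (O_m1 (h0 := h0) (h1 := h1)).mul (a'' := 1) (b'' := 0) (c'' := 1) (O_half1 hf)
  exact (hs.mul (a'' := 0) (b'' := 1) (c'' := 0) O_eps).mul a

theorem O_mu2 {f : Sm} (hf : HalfDecay f) {s : Adm lam → Sm}
    (hs : O h0 h1 0 0 0 s) : O h0 h1 1 1 1 fun i => s i * cst (eps i.1) *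
      (cst i.1.m2 * sh i.1.y2 f) := by
  have a := (O_m2 (h0 := h0) (h1 := h1)).mul (a'' := 1) (b'' := 0) (c'' := 1) (O_half2 hf)
  exact (hs.mul (a'' := 0) (b'' := 1) (c'' := 0) O_eps).mul a

theorem O_one : O h0 h1 0 0 0 fun _ => 1 := by simpa using O.const (h0 := h0) (h1 := h1) 1

theorem O_one_sub_y : O h0 h1 0 0 0 fun i => 1 - cst i.1.y := O_one.sub O_y

theorem O_zzP' {f g : Sm} (hf : Gr wY f) (hg : Gr wY g) : O h0 h1 1 1 1 fun i =>
    cst (theta lam) * cst (i.1.m1 - i.1.m2) * (zz * (sh i.1.y1 f * sh i.1.y2 g)) :=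
  ((O.const (theta lam)).mul (a'' := 1) (b'' := 0) (c'' := 0) O_m_diff).mul (O_zzP hf hg)

namespace SData
theorem O_M1 : O h0 h1 0 1 0 fun i => cst (S.M1 i.1) := O_my O_m1 S.α S.β S.δ
theorem O_M2 : O h0 h1 0 1 0 fun i => cst (S.M2 i.1) :=
  (O_my O_m2 (-S.α) (-S.β) (-S.δ)).congr fun i => by congr 1; unfold SData.M2; ring
theorem O_N1 : O h0 h1 0 1 0 fun i => cst (S.N1 i.1) := O_my O_m1 S.a S.b1 S.d1
theorem O_N2 : O h0 h1 0 1 0 fun i => cst (S.N2 i.1) := O_my O_m2 S.a S.b2 S.d2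

end SData

namespace SData.Good
variable (g : S.Good lam τ)
include g

theorem hB1 : HalfDecay S.B1 := .of_zero g.gB1 g.B1_top g.B1_bot
theorem hB2 : HalfDecay S.B2 := .of_zero g.gB2 g.B2_top g.B2_bot
theorem hD1 : HalfDecay S.D1 := .of_zero g.gD1 g.D1_top g.D1_bot
theorem hD2 : HalfDecay S.D2 := .of_zero g.gD2 g.D2_top g.D2_bot

theorem O_Wrest : O h0 h1 1 1 1 fun i => S.Wrest lam i.1 :=
  ((O_zzP' gr_qq gr_qq).add (O_mu_pair g.hB1 g.hB2 O_y)).add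
    (O_mu_pair g.hD1 g.hD2 (O.const 1))

theorem O_epsA : O h0 h1 0 1 1 fun i => cst (eps i.1) * (sh i.1.y1 S.A1 + sh i.1.y2 S.A2) :=
  O_eps.mul (O_A g)

theorem O_W : O h0 h1 0 1 1 fun i => S.W lam i.1 :=
  (g.O_epsA.add g.O_Wrest.weaken).congr fun i => S.W_eq lam i.1

theorem O_Wm1 : O h0 h1 0 1 1 fun i => S.Wm1 lam i.1 := by
  have a := (O.const (h0 := h0) (h1 := h1) (theta lam)).mul (a'' := 0) (b'' := 1) (c'' := 1)
    (O_zzP gr_qq gr_qq)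
  have b := (O_y.mul (a'' := 0) (b'' := 1) (c'' := 0) O_eps).mul (a'' := 0) (b'' := 1) (c'' := 1)
    (O_half1 (h0 := h0) (h1 := h1) g.hB1)
  have c := (O_eps (h0 := h0) (h1 := h1)).mul (a'' := 0) (b'' := 1) (c'' := 1) (O_half1 g.hD1)
  exact (a.add b).add c

theorem O_Wm2 : O h0 h1 0 1 1 fun i => S.Wm2 lam i.1 := by
  have a := (O.const (h0 := h0) (h1 := h1) (theta lam)).neg.mul (a'' := 0) (b'' := 1) (c'' := 1)
    (O_zzP gr_qq gr_qq)
  have b := (O_y.mul (a'' := 0) (b'' := 1) (c'' := 0) O_eps).mul (a'' := 0) (b'' := 1) (c'' := 1)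
    (O_half2 (h0 := h0) (h1 := h1) g.hB2)
  have c := (O_eps (h0 := h0) (h1 := h1)).mul (a'' := 0) (b'' := 1) (c'' := 1) (O_half2 g.hD2)
  exact (a.add b).add c

theorem O_Wy1' : O h0 h1 1 1 1 fun i => S.Wy1' lam i.1 := by
  refine (((((O_zzP' gr_D_qq gr_qq).neg.add (O_mu_pair g.hB1 g.hB2 O_one_sub_y)).sub
    (O_mu1 g.gB1.halfDecay O_y)).sub (O_mu_pair g.hD1 g.hD2 O_one)).sub
    (O_mu1 g.gD1.halfDecay O_one)).congr fun i => ?_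
  simp only [SData.Wy1']; ring

theorem O_Wy2' : O h0 h1 1 1 1 fun i => S.Wy2' lam i.1 := by
  refine (((((O_zzP' gr_qq gr_D_qq).neg.sub (O_mu_pair g.hB1 g.hB2 O_one_sub_y)).sub
    (O_mu2 g.gB2.halfDecay O_y)).add (O_mu_pair g.hD1 g.hD2 O_one)).sub
    (O_mu2 g.gD2.halfDecay O_one)).congr fun i => ?_
  simp only [SData.Wy2']; ring

theorem O_Wy1 : O h0 h1 0 1 1 fun i => S.Wy1 lam i.1 :=
  ((g.O_epsA.neg).sub (O_eps.mul (O_half1 g.gA1.halfDecay))).add g.O_Wy1'.weaken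

theorem O_Wy2 : O h0 h1 0 1 1 fun i => S.Wy2 lam i.1 :=
  ((g.O_epsA).sub (O_eps.mul (O_half2 g.gA2.halfDecay))).add g.O_Wy2'.weaken

/-- The linear terms in the correction. -/
theorem eqv_W : Eqv h0 h1
    (fun i => D (D (D (S.W lam i.1))) - D (S.W lam i.1)
        + D (2 * ((sh i.1.y1 (Rs lam i.1.m1) + sh i.1.y2 (Rs lam i.1.m2)) * S.W lam i.1)))
    (fun i => i.1.Lf (S.W lam i.1) + cst (eps i.1) *
      (cst i.1.m1 * sh i.1.y1 (2 * D (lamP lam * (S.A1 + cst (thetaA lam))))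
      + cst i.1.m2 * sh i.1.y2 (2 * D (lamP lam * (S.A2 + cst (thetaA lam)))))) := by
  have hT := tay_Rs h0 h1
  have gΛ : Gr wY (lamP lam) := gr_lamQ _
  have r1 := O_fam1 (h0 := h0) (h1 := h1) hT.fam
  have r2 := O_fam2 (h0 := h0) (h1 := h1) hT.fam
  have q1 := O_fam1 (h0 := h0) (h1 := h1) (hT.fam1 gΛ)
  have q2 := O_fam2 (h0 := h0) (h1 := h1) (hT.fam1 gΛ)
  have a := ((q1.add q2).mul (a'' := 2) (b'' := 1) (c'' := 1) g.O_Wrest).cst_mul 2 |>.deriv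
  have b := ((r1.add r2).mul (a'' := 2) (b'' := 1) (c'' := 1) g.O_epsA).cst_mul 2 |>.deriv
  -- In the products with `Λ₁` and `Λ₂`, the profile `A_j` of the other soliton is replaced by its
  -- limit `θ_A`, which produces `A_j + θ_A`.
  have c := (O_m1 (h0 := h0) (h1 := h1)).mul (a'' := 2) (b'' := 1) (c'' := 1)
    (O_eps_D (h0 := h0) (h1 := h1) (pr_right g.gA2 g.A2_top gΛ))
  have d := (O_m2 (h0 := h0) (h1 := h1)).mul (a'' := 2) (b'' := 1) (c'' := 1)
    (O_eps_D (h0 := h0) (h1 := h1) (pr_left g.gA1 g.A1_bot gΛ))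
  refine (((a.add b).add c).add d).congr fun i => ?_
  have e2' : ∀ Y : Sm, (2 : Sm) * D Y = D (2 * Y) := fun Y => by simp
  have hDc : ∀ (c : ℝ) (Y : Sm), cst c * D Y = D (cst c * Y) := fun c Y => by simp
  simp only [Par.Lf, e2', ← D_sh, hDc, ← map_add, ← map_sub]
  congr 1
  simp only [S.W_eq, map_mul, map_add, map_sub, sh_cst, cst_ofNat, Rs_zero, Sm.map_ofNat']
  ring

theorem eqv_Lf_W : Eqv h0 h1 (fun i => i.1.Lf (S.W lam i.1))
    (fun i => cst (eps i.1) * (-sh i.1.y1 (D (Lo S.A1)) - sh i.1.y2 (D (Lo S.A2))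
        + cst (2 * thetaA lam) * (sh i.1.y1 (D qq) + sh i.1.y2 (D qq)))
      + (cst (theta lam) * (cst i.1.m1 * (cst (eps i.1) * (18 *
      (-sh i.1.y1 (D (Lo (zz * (1 - ph) ^ 2)))
      - cst (1 / 2) * (cst i.1.y * sh i.1.y1 (D (Lo ((1 - ph) ^ 2))))
      - sh i.1.y2 (D (Lo (zz * (1 + ph) ^ 2)))
      + cst (1 / 2) * (cst i.1.y * sh i.1.y2 (D (Lo ((1 + ph) ^ 2)))) + 4))))
      + cst i.1.y * cst (eps i.1) * (cst i.1.m1 * -sh i.1.y1 (D (Lo S.B1))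
        - cst i.1.m2 * (sh i.1.y2 (D (Lo S.B2)) + cst (4 * thetaB lam) * sh i.1.y2 (D qq)))
      + cst 1 * cst (eps i.1) * (cst i.1.m1 * -sh i.1.y1 (D (Lo S.D1))
        - cst i.1.m2 * (sh i.1.y2 (D (Lo S.D2)) + cst (4 * τ) * sh i.1.y2 (D qq))))) := by
  have e2 := eqv_Lf_mu (h0 := h0) (h1 := h1) g.gB1 g.gB2 g.B1_bot g.B2_top (s := fun i => i.1.y) O_y
  have e3 := eqv_Lf_mu (h0 := h0) (h1 := h1) g.gD1 g.gD2 g.D1_bot g.D2_top (s := fun _ => 1)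
    (O.const 1)
  refine ((eqv_Lf_A g).add ((eqv_Lf_zzP.add e2).add e3)).congr (fun i => ?_) fun i => rfl
  simp only [S.W_eq, SData.Wrest, Par.Lf_add]

end SData.Good

end

/-! ### Decay of the source terms. -/

theorem D_one_sub_ph_sq : D ((1 - ph) ^ 2) = -(cst (2 / 3) * ((1 - ph) * qq)) := by
  have e : cst (2 / 3) = 2 * cst (1 / 3) := by rw [← cst_ofNat, ← cst_mul]; norm_num
  rw [pow_two, D_mul, map_sub, D_one, D_ph, e]; ring

theorem D_one_add_ph_sq : D ((1 + ph) ^ 2) = cst (2 / 3) * ((1 + ph) * qq) := by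
  have e : cst (2 / 3) = 2 * cst (1 / 3) := by rw [← cst_ofNat, ← cst_mul]; norm_num
  rw [pow_two, D_mul, map_add, D_one, D_ph, e]; ring

theorem gr_D_one_sub_ph_sq : Gr wY (D ((1 - ph) ^ 2)) := by
  rw [D_one_sub_ph_sq]; exact ((gr_one_sub_ph.R1.one_mul gr_qq).cst_mul _).neg

theorem gr_D_one_add_ph_sq : Gr wY (D ((1 + ph) ^ 2)) := by
  rw [D_one_add_ph_sq]; exact (gr_one_add_ph.L1.one_mul gr_qq).cst_mul _

namespace SData

theorem gr_H1 (lam : ℝ) : Gr wY (H1 lam) :=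
  (gr_D_one_sub_ph_sq.cst_mul _).sub wY_pos ((gr_D_Lo gr_D_one_sub_ph_sq).cst_mul _)

theorem gr_H2 (lam : ℝ) : Gr wY (H2 lam) := by
  have := (gr_D_one_add_ph_sq.cst_mul (-(18 * ((1 - lam) / 2)))).add wY_pos
    ((gr_D_Lo gr_D_one_add_ph_sq).cst_mul (9 * theta lam))
  rw [cst_neg] at this
  exact this

/-- The sources of the equations of `D_j` without their affine part. -/
theorem G_aux (lam r : ℝ) (s A : Sm) (hr : 36 * ((1 - lam) / 2) - 18 * theta lam = r)
    : cst (18 * ((1 - lam) / 2)) * D (zz * s ^ 3)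
      - cst (18 * theta lam) * D (Lo (zz * s ^ 2)) - 2 * H lam (A + cst r)
    = cst (18 * ((1 - lam) / 2)) * D (zz * (s ^ 3 - 8))
      - cst (18 * theta lam) * D (Lo (zz * (s ^ 2 - 4)))
      + cst (144 * theta lam) * D (zz * qq) - 2 * H lam (A - cst r) := by
  have e1 : zz * (s ^ 3 - 8) = zz * s ^ 3 - cst 8 * zz := by rw [cst_ofNat]; ring
  have e2 : zz * (s ^ 2 - 4) = zz * s ^ 2 - cst 4 * zz := by rw [cst_ofNat]; ring
  have e3 : D (Lo (zz * (s ^ 2 - 4)))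
      = D (Lo (zz * s ^ 2)) - 4 + 8 * D (zz * qq) := by
    rw [e2, Lo_sub, Lo_cst_mul, map_sub]
    simp only [Lo, D_zz, D_one, cst_ofNat, D_mul, map_sub, sub_zero, D_ofNat]; ring
  have e4 : D (zz * (s ^ 3 - 8)) = D (zz * s ^ 3) - 8 := by
    rw [e1, map_sub]; simp
  have hr' : 36 * cst ((1 - lam) / 2) - 18 * cst (theta lam) = cst r := by
    rw [← hr]; simp only [cst_sub, cst_mul, cst_ofNat]
  have f1 : H lam (A + cst r) = H lam A + cst r := by rw [H_add, H_cst]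
  have f2 : H lam (A - cst r) = H lam A - cst r := by rw [H_sub, H_cst]
  rw [e3, e4, f1, f2, cst_mul 18, cst_mul 18, cst_mul 144]
  simp only [cst_ofNat]
  linear_combination 4 * hr'

variable {S : SData} {lam τ : ℝ}

/-- At `+∞` every term decays separately. At `-∞` the first two terms tend to constants and `A₁ +
θ_A` tends to `2θ_A`; these constants cancel by the relation between `θ` and `θ_A`, as the rewritten
form in `G_aux` shows. -/
theorem gr_G1 (h0 : 0 ≤ lam) (h1 : lam < 1) (g : S.Good lam τ) : Gr wY (S.G1 lam) := by
  have hz3 : Gr w1 (zz * (1 - ph) ^ 2) := gr_zz.one_mul (gr_one_sub_ph'.pow 2)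
  have hz2 : Gr w1 (zz * (1 - ph)) := gr_zz.one_mul gr_one_sub_ph'
  refine gr_Y_of_LR ?_ ?_
  · rw [G1, G_aux lam _ _ _ (thetaA_eq h0 h1).symm]
    have hA := ((gr_L_sub g.gA1 g.A1_bot).H wL_pos lam).cst_mul 2
    rw [cst_ofNat] at hA
    have a3 : Gr wL (zz * ((1 - ph) ^ 3 - 8)) := by
      have e : zz * ((1 - ph) ^ 3 - 8) = (zz * (-(7 : Sm) + 4 * ph - ph ^ 2)) * (1 + ph) := by ring
      rw [e]
      refine Gr.one_mul (gr_zz.one_mul ?_) gr_one_add_ph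
      exact (((Gr.ofNat 7).neg).add w1_pos ((Gr.ofNat 4).one_mul gr_ph)).sub w1_pos (gr_ph.pow 2)
    have a2 : Gr wL (zz * ((1 - ph) ^ 2 - 4)) := by
      have e : zz * ((1 - ph) ^ 2 - 4) = (zz * (ph - 3)) * (1 + ph) := by ring
      rw [e]
      exact Gr.one_mul (gr_zz.one_mul (gr_ph.sub w1_pos (Gr.ofNat 3))) gr_one_add_ph
    exact ((((a3.deriv.cst_mul _).sub wL_pos ((a2.Lo wL_pos).deriv.cst_mul _)).add wL_pos
      ((gr_zz.one_mul gr_qq).toL.deriv.cst_mul _))).sub wL_pos hA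
  · have hA := ((gr_R_sub g.gA1 g.A1_top).H wR_pos lam).cst_mul 2
    rw [cst_ofNat, cst_neg, sub_neg_eq_add] at hA
    have a3 : Gr wR (zz * (1 - ph) ^ 3) := by
      have e : zz * (1 - ph) ^ 3 = zz * (1 - ph) ^ 2 * (1 - ph) := by ring
      rw [e]; exact hz3.one_mul gr_one_sub_ph
    have a2 : Gr wR (zz * (1 - ph) ^ 2) := by
      have e : zz * (1 - ph) ^ 2 = zz * (1 - ph) * (1 - ph) := by ring
      rw [e]; exact hz2.one_mul gr_one_sub_ph
    exact ((a3.deriv.cst_mul _).sub wR_pos ((a2.Lo wR_pos).deriv.cst_mul _)).sub wR_pos hA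

theorem gr_G2 (h0 : 0 ≤ lam) (h1 : lam < 1) (g : S.Good lam τ) : Gr wY (S.G2 lam) := by
  have hz3 : Gr w1 (zz * (1 + ph) ^ 2) := gr_zz.one_mul (gr_one_add_ph'.pow 2)
  have hz2 : Gr w1 (zz * (1 + ph)) := gr_zz.one_mul gr_one_add_ph'
  refine gr_Y_of_LR ?_ ?_
  · have hA := ((gr_L_sub g.gA2 g.A2_bot).H wL_pos lam).cst_mul 2
    rw [cst_ofNat, cst_neg, sub_neg_eq_add] at hA
    have a3 : Gr wL (zz * (1 + ph) ^ 3) := by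
      have e : zz * (1 + ph) ^ 3 = zz * (1 + ph) ^ 2 * (1 + ph) := by ring
      rw [e]; exact hz3.one_mul gr_one_add_ph
    have a2 : Gr wL (zz * (1 + ph) ^ 2) := by
      have e : zz * (1 + ph) ^ 2 = zz * (1 + ph) * (1 + ph) := by ring
      rw [e]; exact hz2.one_mul gr_one_add_ph
    exact ((a3.deriv.cst_mul _).sub wL_pos ((a2.Lo wL_pos).deriv.cst_mul _)).sub wL_pos hA
  · rw [G2, G_aux lam _ _ _ (thetaA_eq h0 h1).symm]
    have hA := ((gr_R_sub g.gA2 g.A2_top).H wR_pos lam).cst_mul 2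
    rw [cst_ofNat] at hA
    have a3 : Gr wR (zz * ((1 + ph) ^ 3 - 8)) := by
      have e : zz * ((1 + ph) ^ 3 - 8) = (zz * (-(7 : Sm) - 4 * ph - ph ^ 2)) * (1 - ph) := by ring
      rw [e]
      refine Gr.one_mul (gr_zz.one_mul ?_) gr_one_sub_ph
      exact (((Gr.ofNat 7).neg).sub w1_pos ((Gr.ofNat 4).one_mul gr_ph)).sub w1_pos (gr_ph.pow 2)
    have a2 : Gr wR (zz * ((1 + ph) ^ 2 - 4)) := by
      have e : zz * ((1 + ph) ^ 2 - 4) = (zz * (-ph - 3)) * (1 - ph) := by ring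
      rw [e]
      exact Gr.one_mul (gr_zz.one_mul (gr_ph.neg.sub w1_pos (Gr.ofNat 3))) gr_one_sub_ph
    exact ((((a3.deriv.cst_mul _).sub wR_pos ((a2.Lo wR_pos).deriv.cst_mul _)).add wR_pos
      ((gr_zz.one_mul gr_qq).toR.deriv.cst_mul _))).sub wR_pos hA

end SData

/-! ### The expansion of the residual. -/

section
variable {lam : ℝ} {h0 : 0 ≤ lam} {h1 : lam < 1} {S : SData} {τ : ℝ} {Ξ : Sm}

theorem eqv_mod1_deriv {F : ℝ → Sm} {F₁ : Sm} (hF : Tay F F₁) (g1 : Gr wY F₁) (s0 s1 s2 : ℝ) :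
    Eqv h0 h1 (fun i => cst (s0 * eps i.1 + s1 * i.1.m1 * i.1.y * eps i.1 + s2 * i.1.m1 * eps i.1)
        * H lam (sh i.1.y1 (D (F i.1.m1))))
      (fun i => cst (eps i.1) * ((cst s0 + cst s1 * cst i.1.m1 * cst i.1.y + cst s2 * cst i.1.m1)
        * sh i.1.y1 (H lam (D (F 0))) + cst s0 * cst i.1.m1 * sh i.1.y1 (H lam (D F₁)))) := by
  refine (eqv_mod1 hF g1 s0 s1 s2).deriv.congr (fun i => ?_) fun i => ?_
  · simp only [D_mul, D_cst, mul_zero, add_zero, D_H, D_sh]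
  · simp only [D_mul, D_cst, mul_zero, add_zero, D_H, D_sh, map_add]

theorem eqv_mod2_deriv {F : ℝ → Sm} {F₁ : Sm} (hF : Tay F F₁) (g1 : Gr wY F₁) (s0 s1 s2 : ℝ) :
    Eqv h0 h1 (fun i => cst (s0 * eps i.1 + s1 * i.1.m2 * i.1.y * eps i.1 + s2 * i.1.m2 * eps i.1)
        * H lam (sh i.1.y2 (D (F i.1.m2))))
      (fun i => cst (eps i.1) * ((cst s0 + cst s1 * cst i.1.m2 * cst i.1.y + cst s2 * cst i.1.m2)
        * sh i.1.y2 (H lam (D (F 0))) + cst s0 * cst i.1.m2 * sh i.1.y2 (H lam (D F₁)))) := by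
  refine (eqv_mod2 hF g1 s0 s1 s2).deriv.congr (fun i => ?_) fun i => ?_
  · simp only [D_mul, D_cst, mul_zero, add_zero, D_H, D_sh]
  · simp only [D_mul, D_cst, mul_zero, add_zero, D_H, D_sh, map_add]

namespace SData.Good
variable (g : S.Good lam τ)
include g

/-- Differentiating `e^{-y}` in `y₁` and `y₂` gives opposite signs, so the two contributions combine
with coefficient `-(μ₁ - μ₂)`, which is `-2μ₁` up to the small sum. Writing `A_j + θ_A` leaves the
constant `2θ_A` to be subtracted. -/
theorem eqv_Wy : Eqv h0 h1 (fun i => cst i.1.m1 * H lam (S.Wy1 lam i.1)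
      + cst i.1.m2 * H lam (S.Wy2 lam i.1))
    (fun i => cst (eps i.1) * (-2 * (cst i.1.m1 * (sh i.1.y1 (H lam (S.A1 + cst (thetaA lam)))
        + sh i.1.y2 (H lam (S.A2 + cst (thetaA lam))) - cst (2 * thetaA lam)))
      - cst i.1.m1 * sh i.1.y1 (H lam (D S.A1)) - cst i.1.m2 * sh i.1.y2 (H lam (D S.A2)))) := by
  have a := O_m1.mul (a'' := 2) (b'' := 1) (c'' := 1) (g.O_Wy1' (h0 := h0) (h1 := h1)).H
  have b := O_m2.mul (a'' := 2) (b'' := 1) (c'' := 1) (g.O_Wy2' (h0 := h0) (h1 := h1)).H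
  have c := O_m_sum.mul (a'' := 2) (b'' := 1) (c'' := 1) (g.O_epsA (h0 := h0) (h1 := h1)).H
  refine ((a.add b).add c).congr fun i => ?_
  simp only [SData.Wy1, SData.Wy2, H_add, H_sub, H_neg, H_cst_mul, H_sh, map_add, sh_cst, H_cst,
    cst_add, cst_mul, cst_ofNat]
  ring

/-- The error of the approximate solution up to admissible terms. -/
theorem eqv_E0 (hΞ : Gr wY Ξ) (tΞ : Tay (Rmu lam) Ξ) :
    Eqv h0 h1 (fun i => S.E0 lam i.1) (fun i => S.Main lam τ Ξ i.1) := by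
  have gΛ : Gr wY (lamP lam) := gr_lamQ _
  have t1 := eqv_pair (h0 := h0) (h1 := h1)
  have t2 := (g.eqv_W (h0 := h0) (h1 := h1)).trans (g.eqv_Lf_W.add (Eqv.refl _))
  have t3 := g.eqv_Wy (h0 := h0) (h1 := h1)
  have k1 := eqv_mod1 (h0 := h0) (h1 := h1) tΞ hΞ S.α S.β S.δ
  have k2 := eqv_mod2 (h0 := h0) (h1 := h1) tΞ hΞ (-S.α) (-S.β) (-S.δ)
  have k3 := eqv_mod1_deriv (h0 := h0) (h1 := h1) (tay_Rs h0 h1) gΛ S.a S.b1 S.d1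
  have k4 := eqv_mod2_deriv (h0 := h0) (h1 := h1) (tay_Rs h0 h1) gΛ S.a S.b2 S.d2
  have T : O h0 h1 2 1 1 _ := ((((((t1.add t2).add t3).add k1).add k2).add k3).add k4)
  have w := (g.O_W (h0 := h0) (h1 := h1)).mul (a'' := 2) (b'' := 1) (c'' := 1) g.O_W |>.deriv
  have m1 := (S.O_M1 (h0 := h0) (h1 := h1)).mul (a'' := 2) (b'' := 1) (c'' := 1) g.O_Wm1.H
  have m2 := (S.O_M2 (h0 := h0) (h1 := h1)).mul (a'' := 2) (b'' := 1) (c'' := 1) g.O_Wm2.H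
  have n1 := (S.O_N1 (h0 := h0) (h1 := h1)).mul (a'' := 2) (b'' := 1) (c'' := 1) g.O_Wy1.H
  have n2 := (S.O_N2 (h0 := h0) (h1 := h1)).mul (a'' := 2) (b'' := 1) (c'' := 1) g.O_Wy2.H
  -- The expansion attaches `μ₁` to the sources `G2` and `H2` at the second soliton, while the
  -- equations are written with `-μ₂`. The difference carries `μ₁ + μ₂` and is admissible because
  -- both sources decay.
  have gG := (O_m_sum.mul (a'' := 2) (b'' := 1) (c'' := 0) O_eps).mul (a'' := 2) (b'' := 1)
    (c'' := 1) (O_half2 (h0 := h0) (h1 := h1) (SData.gr_G2 h0 h1 g).halfDecay)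
  have gH := ((O_m_sum.mul (a'' := 2) (b'' := 1) (c'' := 0) O_eps).mul (a'' := 2) (b'' := 1)
    (c'' := 0) O_y).mul (a'' := 2) (b'' := 1)
    (c'' := 1) (O_half2 (h0 := h0) (h1 := h1) (SData.gr_H2 lam).halfDecay)
  refine (((((((T.add w).add m1).add m2).sub n1).sub n2).add gG).add gH).congr fun i => ?_
  have hθ : cst (thetaA lam) = 36 * cst ((1 - lam) / 2) - 18 * cst (theta lam) := by
    rw [thetaA_eq h0 h1]; simp only [cst_sub, cst_mul, cst_ofNat]
  have hm2 : S.M2 i.1 = -S.α * eps i.1 + -S.β * i.1.m2 * i.1.y * eps i.1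
      + -S.δ * i.1.m2 * eps i.1 := by unfold SData.M2; ring
  have hm1 : S.M1 i.1 = S.α * eps i.1 + S.β * i.1.m1 * i.1.y * eps i.1
      + S.δ * i.1.m1 * eps i.1 := rfl
  have hn1 : S.N1 i.1 = S.a * eps i.1 + S.b1 * i.1.m1 * i.1.y * eps i.1
      + S.d1 * i.1.m1 * eps i.1 := rfl
  have hn2 : S.N2 i.1 = S.a * eps i.1 + S.b2 * i.1.m2 * i.1.y * eps i.1
      + S.d2 * i.1.m2 * eps i.1 := rfl
  have hh : (9 : Sm) = 18 * cst (1 / 2) := by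
    rw [← cst_ofNat, ← cst_ofNat, ← BBM.cst_mul]; norm_num
  beta_reduce
  rw [S.E0_eq h0 h1 i.small.1 i.small.2, ← hm2, ← hm1, ← hn1, ← hn2]
  simp only [SData.Main, SData.EA1, SData.EA2, SData.EB1, SData.EB2, SData.ED1, SData.ED2,
    SData.G1, SData.G2, SData.H1, SData.H2, Rs_zero, Rmu_zero, map_add, map_sub, map_neg, map_mul,
    sh_cst, Sm.map_ofNat', cst_mul, cst_add, cst_neg, cst_ofNat, cst_one, hθ, hh, lamP]
  ring

end SData.Good

end

/-! ### Differentiation along parameter curves and cancellation of the time derivatives. -/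

namespace SData
variable (S : SData) (lam : ℝ) (p : Par)

/-- The profiles as plain functions. -/
def toApprox : ApproxData where
  A₁ := S.A1.1
  A₂ := S.A2.1
  B₁ := S.B1.1
  B₂ := S.B2.1
  D₁ := S.D1.1
  D₂ := S.D2.1
  α := S.α
  β := S.β
  δ := S.δ
  a := S.a
  b₁ := S.b1
  b₂ := S.b2
  d₁ := S.d1
  d₂ := S.d2

theorem toApprox_V₀ (x : ℝ) :
    S.toApprox.V₀ lam p.m1 p.m2 p.y1 p.y2 x = (S.V lam p).1 x := by
  simp only [ApproxData.V₀, V, W, Sm.coe_add', Sm.coe_mul', sh_apply, cst_apply, zz_apply, Rs_coe,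
    toApprox, eps, Par.y, qq_apply]
  ring

/-- The derivatives of the approximate solution in its parameters. -/
def Vm1 : Sm := sh p.y1 (Rmu lam p.m1) + S.Wm1 lam p
def Vm2 : Sm := sh p.y2 (Rmu lam p.m2) + S.Wm2 lam p
def Vy1 : Sm := -sh p.y1 (D (Rs lam p.m1)) + S.Wy1 lam p
def Vy2 : Sm := -sh p.y2 (D (Rs lam p.m2)) + S.Wy2 lam p

end SData

theorem D_Rs_apply (lam mu x : ℝ) :
    (D (Rs lam mu)).1 x = (1 + mu) * (kap lam mu * (D qq).1 (kap lam mu * x)) := by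
  simp only [Rs, D_mul, D_cst, mul_zero, add_zero, D_sc, Sm.coe_mul', cst_apply]
  rfl

section
variable {lam : ℝ} {I : Set ℝ} {t : ℝ}

theorem hasDerivWithinAt_comp_shift (f : Sm) {y : ℝ → ℝ} {y' : ℝ}
    (hy : HasDerivWithinAt y y' I t) (z : ℝ) :
    HasDerivWithinAt (fun s => f.1 (z - y s)) (-y' * (D f).1 (z - y t)) I t :=
  ((hasDerivAt f (z - y t)).comp_hasDerivWithinAt t (hy.const_sub z)).congr_deriv (by ring)

theorem hasDerivWithinAt_Rs (h0 : 0 ≤ lam) (h1 : lam < 1) {m y : ℝ → ℝ} {m' y' : ℝ}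
    (hm : HasDerivWithinAt m m' I t) (hy : HasDerivWithinAt y y' I t)
    (hI : m t ∈ Set.Ioo (-1 : ℝ) 1) (z : ℝ) :
    HasDerivWithinAt (fun s => (Rs lam (m s)).1 (z - y s))
      (m' * (Rmu lam (m t)).1 (z - y t) - y' * (D (Rs lam (m t))).1 (z - y t)) I t := by
  have d1 : HasDerivWithinAt (fun s => 1 + m s) m' I t := hm.const_add 1
  have d2 := (hasDerivAt_kap h0 h1 hI).comp_hasDerivWithinAt t hm
  have d3 := (hasDerivAt qq (kap lam (m t) * (z - y t))).comp_hasDerivWithinAt t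
    (d2.mul (hy.const_sub z))
  refine (d1.mul d3).congr_deriv ?_
  rw [D_Rs_apply]
  simp [Rmu]
  ring

/-- Differentiation of the approximate solution along a curve of parameters. -/
theorem SData.hasDerivWithinAt_V (S : SData) (h0 : 0 ≤ lam) (h1 : lam < 1) {mu0 : ℝ}
    {m1 m2 y1 y2 : ℝ → ℝ} {m1' m2' y1' y2' : ℝ}
    (hm1 : HasDerivWithinAt m1 m1' I t) (hm2 : HasDerivWithinAt m2 m2' I t)
    (hy1 : HasDerivWithinAt y1 y1' I t) (hy2 : HasDerivWithinAt y2 y2' I t)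
    (hI1 : m1 t ∈ Set.Ioo (-1 : ℝ) 1) (hI2 : m2 t ∈ Set.Ioo (-1 : ℝ) 1) (z : ℝ) :
    HasDerivWithinAt (fun s => S.toApprox.V₀ lam (m1 s) (m2 s) (y1 s) (y2 s) z)
      ((cst m1' * S.Vm1 lam ⟨mu0, m1 t, m2 t, y1 t, y2 t⟩
        + cst m2' * S.Vm2 lam ⟨mu0, m1 t, m2 t, y1 t, y2 t⟩
        + cst y1' * S.Vy1 lam ⟨mu0, m1 t, m2 t, y1 t, y2 t⟩
        + cst y2' * S.Vy2 lam ⟨mu0, m1 t, m2 t, y1 t, y2 t⟩).1 z) I t := by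
  have hR1 := hasDerivWithinAt_Rs h0 h1 hm1 hy1 hI1 z
  have hR2 := hasDerivWithinAt_Rs h0 h1 hm2 hy2 hI2 z
  have hy := hy1.sub hy2
  have he : HasDerivWithinAt (fun s => Real.exp (-(y1 s - y2 s))) _ I t := hy.neg.exp
  have hA := (hasDerivWithinAt_comp_shift S.A1 hy1 z).add (hasDerivWithinAt_comp_shift S.A2 hy2 z)
  have hB := (hm1.mul (hasDerivWithinAt_comp_shift S.B1 hy1 z)).add
    (hm2.mul (hasDerivWithinAt_comp_shift S.B2 hy2 z))
  have hD := (hm1.mul (hasDerivWithinAt_comp_shift S.D1 hy1 z)).add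
    (hm2.mul (hasDerivWithinAt_comp_shift S.D2 hy2 z))
  have hQ := ((((hm1.sub hm2).const_mul (theta lam)).mul_const z).mul
    (hasDerivWithinAt_comp_shift qq hy1 z)).mul (hasDerivWithinAt_comp_shift qq hy2 z)
  have h := ((((hR1.add hR2).add (he.mul hA)).add hQ).add ((hy.mul he).mul hB)).add (he.mul hD)
  refine h.congr_deriv ?_
  simp only [SData.Vm1, SData.Vm2, SData.Vy1, SData.Vy2, SData.Wm1, SData.Wm2, SData.Wy1,
    SData.Wy2, SData.Wy1', SData.Wy2', eps, Par.y, Sm.coe_add', Sm.coe_sub', Sm.coe_neg',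
    Sm.coe_mul', Sm.coe_one', cst_apply, sh_apply, zz_apply]
  simp
  ring

end

section
variable {lam : ℝ} (S : SData) (h0 : 0 ≤ lam) (h1 : lam < 1) {p : Par}
  (hI1 : p.m1 ∈ Set.Ioo (-1 : ℝ) 1) (hI2 : p.m2 ∈ Set.Ioo (-1 : ℝ) 1)
include h0 h1 hI1 hI2

theorem SData.deriv_V_m1 :
    (fun z => deriv (fun m => S.toApprox.V₀ lam m p.m2 p.y1 p.y2 z) p.m1) = (S.Vm1 lam p).1 := by
  funext z
  have := S.hasDerivWithinAt_V (I := Set.univ) (t := p.m1) (mu0 := p.mu0) h0 h1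
    (hasDerivWithinAt_id _ _) (hasDerivWithinAt_const _ _ p.m2) (hasDerivWithinAt_const _ _ p.y1)
    (hasDerivWithinAt_const _ _ p.y2) hI1 hI2 z
  rw [hasDerivWithinAt_univ] at this
  simpa using this.deriv

theorem SData.deriv_V_m2 :
    (fun z => deriv (fun m => S.toApprox.V₀ lam p.m1 m p.y1 p.y2 z) p.m2) = (S.Vm2 lam p).1 := by
  funext z
  have := S.hasDerivWithinAt_V (I := Set.univ) (t := p.m2) (mu0 := p.mu0) h0 h1
    (hasDerivWithinAt_const _ _ p.m1) (hasDerivWithinAt_id _ _) (hasDerivWithinAt_const _ _ p.y1)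
    (hasDerivWithinAt_const _ _ p.y2) hI1 hI2 z
  rw [hasDerivWithinAt_univ] at this
  simpa using this.deriv

theorem SData.deriv_V_y1 :
    (fun z => deriv (fun y => S.toApprox.V₀ lam p.m1 p.m2 y p.y2 z) p.y1) = (S.Vy1 lam p).1 := by
  funext z
  have := S.hasDerivWithinAt_V (I := Set.univ) (t := p.y1) (mu0 := p.mu0) h0 h1
    (hasDerivWithinAt_const _ _ p.m1) (hasDerivWithinAt_const _ _ p.m2) (hasDerivWithinAt_id _ _)
    (hasDerivWithinAt_const _ _ p.y2) hI1 hI2 z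
  rw [hasDerivWithinAt_univ] at this
  simpa using this.deriv

theorem SData.deriv_V_y2 :
    (fun z => deriv (fun y => S.toApprox.V₀ lam p.m1 p.m2 p.y1 y z) p.y2) = (S.Vy2 lam p).1 := by
  funext z
  have := S.hasDerivWithinAt_V (I := Set.univ) (t := p.y2) (mu0 := p.mu0) h0 h1
    (hasDerivWithinAt_const _ _ p.m1) (hasDerivWithinAt_const _ _ p.m2)
    (hasDerivWithinAt_const _ _ p.y1) (hasDerivWithinAt_id _ _) hI1 hI2 z
  rw [hasDerivWithinAt_univ] at this
  simpa using this.deriv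

end

/-- The time derivatives of the parameters cancel in the error. -/
theorem SData.bbmLhs_eq (S : SData) {lam : ℝ} (h0 : 0 ≤ lam) (h1 : lam < 1) {I : Set ℝ}
    (hI : I.OrdConnected) (hn : I.Nontrivial) (mu0 : ℝ) {m1 m2 y1 y2 : ℝ → ℝ}
    {t : ℝ} (ht : t ∈ I)
    (hm1 : DifferentiableWithinAt ℝ m1 I t) (hm2 : DifferentiableWithinAt ℝ m2 I t)
    (hy1 : DifferentiableWithinAt ℝ y1 I t) (hy2 : DifferentiableWithinAt ℝ y2 I t)
    (hI1 : m1 t ∈ Set.Ioo (-1 : ℝ) 1) (hI2 : m2 t ∈ Set.Ioo (-1 : ℝ) 1) (x : ℝ) :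
    bbmLhs lam I (fun s z => S.toApprox.V₀ lam (m1 s) (m2 s) (y1 s) (y2 s) z) t x =
      S.toApprox.modTerm lam I m1 m2 y1 y2 t x
        + (S.E0 lam ⟨mu0, m1 t, m2 t, y1 t, y2 t⟩).1 x := by
  have hU : UniqueDiffWithinAt ℝ I t :=
    uniqueDiffOn_convex hI.convex (hI.convex.nontrivial_iff_nonempty_interior.1 hn) t ht
  set p : Par := ⟨mu0, m1 t, m2 t, y1 t, y2 t⟩ with hp
  have e1 : (fun z => derivWithin (fun s => S.toApprox.V₀ lam (m1 s) (m2 s) (y1 s) (y2 s) z) I t)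
      = (cst (derivWithin m1 I t) * S.Vm1 lam p + cst (derivWithin m2 I t) * S.Vm2 lam p
        + cst (derivWithin y1 I t) * S.Vy1 lam p + cst (derivWithin y2 I t) * S.Vy2 lam p).1 := by
    funext z
    exact (S.hasDerivWithinAt_V h0 h1 hm1.hasDerivWithinAt hm2.hasDerivWithinAt
      hy1.hasDerivWithinAt hy2.hasDerivWithinAt hI1 hI2 z).derivWithin hU
  have e2 : (fun z => S.toApprox.V₀ lam (m1 t) (m2 t) (y1 t) (y2 t) z) = (S.V lam p).1 :=
    funext fun z => S.toApprox_V₀ lam p z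
  have e3 : (fun z => iteratedDeriv 2 (S.V lam p).1 z - (S.V lam p).1 z + (S.V lam p).1 z ^ 2)
      = (D (D (S.V lam p)) - S.V lam p + S.V lam p ^ 2).1 := by
    funext z
    rw [← iter_D_coe]; simp
  have f1 := S.deriv_V_m1 h0 h1 (p := p) hI1 hI2
  have f2 := S.deriv_V_m2 h0 h1 (p := p) hI1 hI2
  have f3 := S.deriv_V_y1 h0 h1 (p := p) hI1 hI2
  have f4 := S.deriv_V_y2 h0 h1 (p := p) hI1 hI2
  have g1 : S.toApprox.M₁ (m1 t) (y1 t - y2 t) = S.M1 p := rfl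
  have g2 : S.toApprox.M₂ (m2 t) (y1 t - y2 t) = S.M2 p := rfl
  have g3 : S.toApprox.N₁ (m1 t) (y1 t - y2 t) = S.N1 p := rfl
  have g4 : S.toApprox.N₂ (m2 t) (y1 t - y2 t) = S.N2 p := rfl
  simp only [bbmLhs, ApproxData.modTerm, e1, e2, e3, g1, g2, g3, g4]
  rw [f1, f2, f3, f4]
  simp only [helm_coe, ← D_apply, H_add, H_cst_mul]
  simp only [SData.E0, SData.Vm1, SData.Vm2, SData.Vy1, SData.Vy2, Sm.coe_add', Sm.coe_mul',
    cst_apply]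
  simp only [hp]
  ring

/-! ### The equations of the profiles imply the bound on the error -/

theorem SData.Good.solvesApprox {lam : ℝ} (h0 : 0 ≤ lam) (h1 : lam < 1) {S : SData} {τ : ℝ}
    {Ξ : Sm} (g : S.Good lam τ) (hΞ : Gr wY Ξ) (tΞ : Tay (Rmu lam) Ξ)
    (hA1 : S.EA1 lam = 0) (hA2 : S.EA2 lam = 0) (hB1 : S.EB1 lam = 0) (hB2 : S.EB2 lam = 0)
    (hD1 : S.ED1 lam Ξ = 0) (hD2 : S.ED2 lam τ Ξ = 0) : S.toApprox.SolvesApprox lam := by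
  have hE : O h0 h1 2 1 1 fun i => S.E0 lam i.1 :=
    O.congr (g.eqv_E0 hΞ tΞ) fun i => by
      simp only [SData.Main, hA1, hA2, hB1, hB2, hD1, hD2, map_zero]; ring
  obtain ⟨s, ⟨hs0, σ, hs⟩, hb⟩ := hE 0
  -- Adding `3` only ensures that the exponent is at least `3`; it is harmless as `Y₀ ≥ 2`. The
  -- value `1/100` is the smallness threshold built into `Dom`.
  refine ⟨((σ + 3 : ℕ) : ℝ), 1 / 100, by push_cast; linarith [(Nat.cast_nonneg σ : (0:ℝ) ≤ σ)],
    by norm_num, by norm_num, fun K hK => ?_⟩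
  obtain ⟨C, hC, hs⟩ := hs K hK
  refine ⟨C + 1, by linarith, fun mu0 hm0 hms I hI hn m1 m2 y1 y2 hadm => ?_⟩
  have hdom : ∀ t ∈ I, Dom lam K ⟨mu0, m1 t, m2 t, y1 t, y2 t⟩ := fun t ht =>
    ⟨hm0, hms, hadm.dist_lower t ht, hadm.dist_upper t ht, hadm.mu₁_le t ht, hadm.mu₂_le t ht,
      hadm.mu_sum t ht, hadm.y_sum t ht⟩
  refine ⟨fun t x => (S.E0 lam ⟨mu0, m1 t, m2 t, y1 t, y2 t⟩).1 x, fun t ht x => ?_,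
    fun t ht x => ?_⟩
  · have b1 := abs_le.1 (hadm.mu₁_le t ht)
    have b2 := abs_le.1 (hadm.mu₂_le t ht)
    have d1 : ∀ {f : ℝ → ℝ}, ContDiffOn ℝ 1 f I → DifferentiableWithinAt ℝ f I t :=
      fun hf => hf.differentiableOn one_ne_zero t ht
    exact S.bbmLhs_eq h0 h1 hI hn mu0 ht (d1 hadm.c1_mu₁) (d1 hadm.c1_mu₂) (d1 hadm.c1_y₁)
      (d1 hadm.c1_y₂) ⟨by linarith, by linarith⟩ ⟨by linarith, by linarith⟩ x
  · set i : Adm lam := ⟨⟨mu0, m1 t, m2 t, y1 t, y2 t⟩, K, hK, hdom t ht⟩ with hi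
    have e1 := hb i x
    have e2 := hs i (hdom t ht) x
    have hY := two_le_Y₀ h0 h1 hm0 hms
    have hg := gauge_nonneg 2 1 1 i x
    simp only [Function.iterate_zero, id_eq] at e1
    have e3 : (1 + Real.exp ((x - y1 t) / 2)) * gauge 2 1 1 i x
        = Real.exp (-Y₀ lam mu0) * Real.exp (-(y1 t - y2 t)) := by
      have hp := Real.exp_pos ((x - y1 t) / 2)
      have e4 : eta lam i.1 ^ 2 = Real.exp (-Y₀ lam mu0) := by
        rw [eta, ← Real.exp_nat_mul]; congr 1; push_cast; ring
      rw [gauge, e4, om, eps, Par.y, pow_one, pow_one, show i.1.y1 = y1 t from rfl,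
        show i.1.y2 = y2 t from rfl]
      field_simp
    rw [Real.rpow_natCast]
    calc _ ≤ (1 + Real.exp ((x - y1 t) / 2)) * ((C * Y₀ lam mu0 ^ σ) * gauge 2 1 1 i x) := by
          gcongr
          exact e1.trans (by gcongr)
      _ = C * Y₀ lam mu0 ^ σ * (Real.exp (-Y₀ lam mu0) * Real.exp (-(y1 t - y2 t))) := by
          rw [← e3]; ring
      _ ≤ (C + 1) * Y₀ lam mu0 ^ (σ + 3) * (Real.exp (-Y₀ lam mu0) * Real.exp (-(y1 t - y2 t))) := by
          gcongr
          · linarith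
          · linarith
          · omega
      _ = _ := by ring

/-! ### The bound on the error implies the equations of the profiles -/

/-- Functions of size `e^{-Y}` up to powers of `Y`. -/
def Negl (f : ℝ → ℝ) : Prop := ∃ (C : ℝ) (n : ℕ), ∀ᶠ Y in atTop, |f Y| ≤ C * Y ^ n * Real.exp (-Y)

namespace Negl
variable {f g : ℝ → ℝ}

theorem add (hf : Negl f) (hg : Negl g) : Negl fun Y => f Y + g Y := by
  obtain ⟨C, n, hf⟩ := hf
  obtain ⟨C', m, hg⟩ := hg
  refine ⟨|C| + |C'|, n + m, ?_⟩
  filter_upwards [hf, hg, eventually_ge_atTop 1] with Y h1 h2 h3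
  have e1 : Y ^ n ≤ Y ^ (n + m) := pow_le_pow_right₀ h3 (by omega)
  have e2 : Y ^ m ≤ Y ^ (n + m) := pow_le_pow_right₀ h3 (by omega)
  have p1 : 0 ≤ Y ^ n := by positivity
  have p2 : 0 ≤ Y ^ m := by positivity
  calc _ ≤ C * Y ^ n * Real.exp (-Y) + C' * Y ^ m * Real.exp (-Y) :=
        (abs_add_le _ _).trans (add_le_add h1 h2)
    _ ≤ |C| * Y ^ (n + m) * Real.exp (-Y) + |C'| * Y ^ (n + m) * Real.exp (-Y) := by
        gcongr
        · exact le_abs_self _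
        · exact le_abs_self _
    _ = _ := by ring

theorem mul_bdd (hf : Negl f) {b : ℝ} (hg : ∀ᶠ Y in atTop, |g Y| ≤ b) :
    Negl fun Y => g Y * f Y := by
  obtain ⟨C, n, hf⟩ := hf
  refine ⟨b * C, n, ?_⟩
  filter_upwards [hf, hg] with Y h1 h2
  rw [abs_mul]
  calc _ ≤ b * (C * Y ^ n * Real.exp (-Y)) :=
        mul_le_mul h2 h1 (abs_nonneg _) ((abs_nonneg _).trans h2)
    _ = _ := by ring

theorem congr (hf : Negl f) (h : ∀ᶠ Y in atTop, g Y = f Y) : Negl g := by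
  obtain ⟨C, n, hf⟩ := hf
  refine ⟨C, n, ?_⟩
  filter_upwards [hf, h] with Y h1 h2
  rwa [h2]

theorem neg (hf : Negl f) : Negl fun Y => -f Y := by
  obtain ⟨C, n, hf⟩ := hf
  exact ⟨C, n, by simpa using hf⟩

theorem of_gr {f : Sm} (hf : Gr wY f) (z : ℝ) : Negl fun Y => f.1 (z + Y) := by
  obtain ⟨C, n, hC, hb⟩ := hf.bound fun x => (wY_pos x).le
  refine ⟨C * (2 + |z|) ^ n * Real.exp |z|, n, ?_⟩
  filter_upwards [eventually_ge_atTop 1] with Y hY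
  refine (hb (z + Y)).trans ?_
  have a1 := abs_add_le z Y
  rw [abs_of_nonneg (by linarith : 0 ≤ Y)] at a1
  have a2 : Y - |z| ≤ |z + Y| := by have := neg_abs_le z; have := le_abs_self (z + Y); linarith
  have a3 : 1 + |z + Y| ≤ (2 + |z|) * Y := by nlinarith [abs_nonneg z]
  have a4 : wY (z + Y) ≤ Real.exp |z| * Real.exp (-Y) := by
    rw [wY, ← Real.exp_add]; exact Real.exp_le_exp.2 (by linarith)
  calc _ ≤ C * ((2 + |z|) * Y) ^ n * (Real.exp |z| * Real.exp (-Y)) :=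
        mul_le_mul (by gcongr) a4 (wY_pos _).le (by positivity)
    _ = _ := by rw [mul_pow]; ring

theorem of_gr' {f : Sm} (hf : Gr wY f) (z : ℝ) : Negl fun Y => f.1 (z - Y) := by
  have := of_gr hf.rflY (-z)
  refine this.congr (Eventually.of_forall fun Y => ?_)
  change f.1 (z - Y) = f.1 (-(-z + Y))
  rw [neg_add, neg_neg, sub_eq_add_neg]

end Negl

theorem tendsto_pow_mul_exp_half (n : ℕ) :
    Tendsto (fun Y : ℝ => Y ^ n * Real.exp (-(1 / 2 * Y))) atTop (𝓝 0) := by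
  have h := (Real.tendsto_pow_mul_exp_neg_atTop_nhds_zero n).comp
    (tendsto_id.const_mul_atTop (by norm_num : (0 : ℝ) < 1 / 2))
  have h2 := h.const_mul ((2 : ℝ) ^ n)
  rw [mul_zero] at h2
  refine h2.congr fun Y => ?_
  simp only [Function.comp, id]
  rw [mul_pow, ← mul_assoc, ← mul_assoc, ← mul_pow]; norm_num

/-- The three orders are peeled off successively: `a` is the limit of the expression. After division
by `s e^{-Y/2}` the remainder still tends to `0`, so `Yb + c → 0`, which gives `b = 0` and then `c =
0`. -/
theorem eq_zero_of_negl {a b c s : ℝ} (hs : 0 < s)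
    (h : Negl fun Y => a + Y * (s * Real.exp (-(1 / 2 * Y))) * b
      + s * Real.exp (-(1 / 2 * Y)) * c) : a = 0 ∧ b = 0 ∧ c = 0 := by
  obtain ⟨C, n, h⟩ := h
  have t1 := tendsto_pow_mul_exp_half 1
  have t0 := tendsto_pow_mul_exp_half 0
  simp only [pow_one, pow_zero, one_mul] at t1 t0
  have tn := tendsto_pow_mul_exp_half n
  have hexp : ∀ Y : ℝ, Real.exp (-Y) = Real.exp (-(1 / 2 * Y)) * Real.exp (-(1 / 2 * Y)) :=
    fun Y => by rw [← Real.exp_add]; congr 1; ring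
  have ha : a = 0 := by
    have l1 : Tendsto (fun Y => a + Y * (s * Real.exp (-(1 / 2 * Y))) * b
        + s * Real.exp (-(1 / 2 * Y)) * c) atTop (𝓝 a) := by
      have := ((t1.mul_const (s * b)).const_add a).add (t0.mul_const (s * c))
      simp only [zero_mul, add_zero] at this
      refine this.congr fun Y => by ring
    have l2 : Tendsto (fun Y => C * Y ^ n * Real.exp (-Y)) atTop (𝓝 0) := by
      have := (tn.mul t0).const_mul C
      simp only [mul_zero] at this
      refine this.congr fun Y => by rw [hexp Y]; ring
    exact tendsto_nhds_unique l1 (squeeze_zero_norm' h l2)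
  have hbc : ∀ᶠ Y in atTop, |Y * b + c| ≤ C / s * (Y ^ n * Real.exp (-(1 / 2 * Y))) := by
    filter_upwards [h] with Y h
    have hp := Real.exp_pos (-(1 / 2 * Y))
    rw [ha, show 0 + Y * (s * Real.exp (-(1 / 2 * Y))) * b + s * Real.exp (-(1 / 2 * Y)) * c
      = s * Real.exp (-(1 / 2 * Y)) * (Y * b + c) by ring, abs_mul,
      abs_of_pos (by positivity), hexp Y] at h
    rw [div_mul_eq_mul_div, le_div_iff₀ hs]
    refine le_of_mul_le_mul_right ?_ hp
    linarith
  have l3 : Tendsto (fun Y => Y * b + c) atTop (𝓝 0) := by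
    refine squeeze_zero_norm' hbc ?_
    simpa using tn.const_mul (C / s)
  have hb : b = 0 := by
    have l4 : Tendsto (fun Y : ℝ => Y⁻¹ * (Y * b + c)) atTop (𝓝 (0 * 0)) :=
      tendsto_inv_atTop_zero.mul l3
    have l5 : Tendsto (fun Y : ℝ => b + Y⁻¹ * c) atTop (𝓝 (b + 0 * c)) :=
      (tendsto_inv_atTop_zero.mul_const c).const_add b
    rw [mul_zero] at l4
    rw [zero_mul, add_zero] at l5
    refine tendsto_nhds_unique l5 (l4.congr' ?_)
    filter_upwards [eventually_gt_atTop 0] with Y hY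
    field_simp
  refine ⟨ha, hb, ?_⟩
  rw [hb] at l3
  simp only [mul_zero, zero_add] at l3
  exact tendsto_nhds_unique tendsto_const_nhds l3

section
variable {lam : ℝ} {S : SData} {τ : ℝ} {Ξ : Sm} (g : S.Good lam τ)
include g

theorem SData.Good.gr_EA1 : Gr wY (S.EA1 lam) := by
  have e := gr_D_one_sub_ph_sq.cst_mul 18
  rw [cst_ofNat] at e
  exact (((((gr_D_Lo g.gA1).neg.add wY_pos (gr_D_qq.cst_mul _)).add wY_pos e).add wY_pos
    (((gr_lamQ _).H wY_pos lam).cst_mul _)).add wY_pos ((gr_D_qq.H wY_pos lam).cst_mul _))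

theorem SData.Good.gr_EA2 : Gr wY (S.EA2 lam) := by
  have e := gr_D_one_add_ph_sq.cst_mul 18
  rw [cst_ofNat] at e
  exact (((((gr_D_Lo g.gA2).neg.add wY_pos (gr_D_qq.cst_mul _)).add wY_pos e).sub wY_pos
    (((gr_lamQ _).H wY_pos lam).cst_mul _)).add wY_pos ((gr_D_qq.H wY_pos lam).cst_mul _))

theorem SData.Good.gr_EB1 : Gr wY (S.EB1 lam) :=
  ((((gr_D_Lo g.gB1).neg.add wY_pos (SData.gr_H1 lam)).add wY_pos
    (((gr_lamQ _).H wY_pos lam).cst_mul _)).add wY_pos ((gr_D_qq.H wY_pos lam).cst_mul _))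

theorem SData.Good.gr_EB2 : Gr wY (S.EB2 lam) :=
  (((((gr_D_Lo g.gB2).neg.sub wY_pos (SData.gr_H2 lam)).sub wY_pos
    (((gr_lamQ _).H wY_pos lam).cst_mul _)).add wY_pos ((gr_D_qq.H wY_pos lam).cst_mul _))).sub
    wY_pos (gr_D_qq.cst_mul _)

theorem SData.Good.gr_ED1 (h0 : 0 ≤ lam) (h1 : lam < 1) (hΞ : Gr wY Ξ) :
    Gr wY (S.ED1 lam Ξ) := by
  have e := (((gr_lamQ ((1 - lam) / 2)).mul_one
    ((gr_w1_of_deriv g.gA1.Y1).add w1_pos (Gr.cst (thetaA lam)))).deriv).cst_mul 2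
  rw [cst_ofNat] at e
  exact ((((((((gr_D_Lo g.gD1).neg.add wY_pos (SData.gr_G1 h0 h1 g)).add wY_pos e).add wY_pos
    ((hΞ.H wY_pos lam).cst_mul _)).add wY_pos
    (((gr_lamQ _).H wY_pos lam).cst_mul _)).add wY_pos
    ((gr_D_qq.H wY_pos lam).cst_mul _))).add wY_pos
    (((gr_lamQ _).deriv.H wY_pos lam).cst_mul _)).sub wY_pos (g.gA1.H wY_pos lam)

theorem SData.Good.gr_ED2 (h0 : 0 ≤ lam) (h1 : lam < 1) (hΞ : Gr wY Ξ) :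
    Gr wY (S.ED2 lam τ Ξ) := by
  have e := (((gr_lamQ ((1 - lam) / 2)).mul_one
    ((gr_w1_of_deriv g.gA2.Y1).add w1_pos (Gr.cst (thetaA lam)))).deriv).cst_mul 2
  rw [cst_ofNat] at e
  exact (((((((((gr_D_Lo g.gD2).neg.sub wY_pos (SData.gr_G2 h0 h1 g)).add wY_pos e).sub wY_pos
    ((hΞ.H wY_pos lam).cst_mul _)).sub wY_pos
    (((gr_lamQ _).H wY_pos lam).cst_mul _)).add wY_pos
    ((gr_D_qq.H wY_pos lam).cst_mul _))).add wY_pos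
    (((gr_lamQ _).deriv.H wY_pos lam).cst_mul _)).sub wY_pos (g.gA2.H wY_pos lam)).sub
    wY_pos (gr_D_qq.cst_mul _)

end

/-- Symmetric parameters with `Y₀ = y = Y`. -/
def symPar (lam Y : ℝ) : Par where
  mu0 := Real.sqrt (alphaVal lam) * Real.exp (-(1 / 2 * Y))
  m1 := Real.sqrt (alphaVal lam) * Real.exp (-(1 / 2 * Y))
  m2 := -(Real.sqrt (alphaVal lam) * Real.exp (-(1 / 2 * Y)))
  y1 := Y / 2
  y2 := -(Y / 2)

section
variable {lam : ℝ} (h0 : 0 ≤ lam) (h1 : lam < 1)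
include h0 h1

theorem Y₀_symPar {Y : ℝ} (hY : 0 ≤ Y) : Y₀ lam (symPar lam Y).mu0 = Y := by
  obtain ⟨ha, hb⟩ := alphaVal_bounds h0 h1
  have e : (symPar lam Y).mu0 ^ 2 / alphaVal lam = Real.exp (-Y) := by
    rw [symPar, mul_pow, Real.sq_sqrt (by linarith), ← Real.exp_nat_mul,
      mul_div_cancel_left₀ _ (by linarith)]
    congr 1; push_cast; ring
  rw [Y₀, e, Real.log_exp, abs_neg, abs_of_nonneg hY]

theorem dom_symPar : ∀ m : ℝ, 0 < m → ∀ᶠ Y in atTop,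
    Dom lam 2 (symPar lam Y) ∧ (symPar lam Y).mu0 < m := by
  intro m hm
  obtain ⟨ha, hb⟩ := alphaVal_bounds h0 h1
  have t0 := (tendsto_pow_mul_exp_half 0).const_mul (Real.sqrt (alphaVal lam))
  simp only [pow_zero, one_mul, mul_zero] at t0
  filter_upwards [t0.eventually (gt_mem_nhds (by norm_num : (0 : ℝ) < 1 / 100)),
    t0.eventually (gt_mem_nhds hm), eventually_ge_atTop 0] with Y e1 e2 hY
  have hp : 0 < (symPar lam Y).mu0 :=
    mul_pos (Real.sqrt_pos.2 (by linarith)) (Real.exp_pos _)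
  have hy : (symPar lam Y).y = Y := by simp [symPar, Par.y]
  have hY0 := Y₀_symPar h0 h1 hY
  refine ⟨⟨hp, e1, ?_, ?_, ?_, ?_, ?_, ?_⟩, e2⟩
  · rw [hY0, hy]; linarith
  · rw [hY0, hy]; linarith
  · change |(symPar lam Y).mu0| ≤ _
    rw [abs_of_pos hp]; linarith
  · change |-(symPar lam Y).mu0| ≤ _
    rw [abs_neg, abs_of_pos hp]; linarith
  · rw [hY0]; simp [symPar]; positivity
  · rw [hY0]; simp [symPar]; positivity

/-- The assumed bound gives a residual of size `e^{-2Y}` up to powers of `Y`, and the residual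
differs from its main part by as much. Multiplication by `e^Y` removes the common prefactor. The
point `x Y` is arbitrary because both bounds are uniform in space. -/
theorem SData.Good.main_negl {S : SData} {τ : ℝ}
    {Ξ : Sm} (g : S.Good lam τ) (hΞ : Gr wY Ξ) (tΞ : Tay (Rmu lam) Ξ)
    (hS : S.toApprox.SolvesApprox lam) (x : ℝ → ℝ) :
    Negl fun Y => Real.exp Y * (S.Main lam τ Ξ (symPar lam Y)).1 (x Y) := by
  obtain ⟨sigma, muStar, hs3, hm0, hm1, hK⟩ := hS
  obtain ⟨C, hC, hK⟩ := hK 2 (by norm_num)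
  obtain ⟨s, ⟨hs0, n, hs⟩, hb⟩ := g.eqv_E0 (h0 := h0) (h1 := h1) hΞ tΞ 0
  obtain ⟨C', hC', hs⟩ := hs 2 (by norm_num)
  have hE : Negl fun Y => Real.exp Y * (S.E0 lam (symPar lam Y)).1 (x Y) := by
    refine ⟨C, ⌈sigma⌉₊, ?_⟩
    filter_upwards [dom_symPar h0 h1 muStar hm0, eventually_ge_atTop 1] with Y hd hY
    obtain ⟨hd, hms⟩ := hd
    have hY0 := Y₀_symPar h0 h1 (by linarith : 0 ≤ Y)
    -- Parameters constant in time suffice: the residual depends only on the current parameters.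
    obtain ⟨E, he, hbd⟩ := hK (symPar lam Y).mu0 hd.pos hms Set.univ Set.ordConnected_univ
      Set.nontrivial_univ (fun _ => (symPar lam Y).m1) (fun _ => (symPar lam Y).m2)
      (fun _ => (symPar lam Y).y1) (fun _ => (symPar lam Y).y2)
      ⟨contDiffOn_const, contDiffOn_const, contDiffOn_const, contDiffOn_const,
        fun _ _ => hd.dist_lower, fun _ _ => hd.dist_upper, fun _ _ => hd.m1_le,
        fun _ _ => hd.m2_le, fun _ _ => hd.m_sum, fun _ _ => hd.y_sum⟩
    have b1 := abs_le.1 hd.m1_le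
    have b2 := abs_le.1 hd.m2_le
    have hsm := hd.small
    have e1 := S.bbmLhs_eq h0 h1 Set.ordConnected_univ Set.nontrivial_univ (symPar lam Y).mu0
      (m1 := fun _ => (symPar lam Y).m1) (m2 := fun _ => (symPar lam Y).m2)
      (y1 := fun _ => (symPar lam Y).y1) (y2 := fun _ => (symPar lam Y).y2) (Set.mem_univ (0 : ℝ))
      (differentiableWithinAt_const _) (differentiableWithinAt_const _)
      (differentiableWithinAt_const _) (differentiableWithinAt_const _)
      ⟨by linarith, by linarith⟩ ⟨by linarith, by linarith⟩ (x Y)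
    have e2 := he 0 (Set.mem_univ _) (x Y)
    have e3 : E 0 (x Y) = (S.E0 lam (symPar lam Y)).1 (x Y) := by
      have := e1.symm.trans e2; linarith
    have e4 := hbd 0 (Set.mem_univ _) (x Y)
    have hy : (symPar lam Y).y1 - (symPar lam Y).y2 = Y := by simp [symPar]
    rw [e3, hY0, hy] at e4
    have hp := Real.exp_pos ((x Y - (symPar lam Y).y1) / 2)
    have e5 : |(S.E0 lam (symPar lam Y)).1 (x Y)| ≤ C * Y ^ sigma * Real.exp (-Y) * Real.exp (-Y) :=
      le_trans (by nlinarith [abs_nonneg ((S.E0 lam (symPar lam Y)).1 (x Y))]) e4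
    have e6 : Y ^ sigma ≤ Y ^ ⌈sigma⌉₊ := by
      rw [← Real.rpow_natCast]
      exact Real.rpow_le_rpow_of_exponent_le hY (Nat.le_ceil _)
    have e7 : Real.exp Y * Real.exp (-Y) = 1 := by rw [← Real.exp_add]; simp
    rw [abs_mul, abs_of_pos (Real.exp_pos _)]
    calc _ ≤ Real.exp Y * (C * Y ^ ⌈sigma⌉₊ * Real.exp (-Y) * Real.exp (-Y)) := by
          gcongr; exact e5.trans (by gcongr)
      _ = C * Y ^ ⌈sigma⌉₊ * Real.exp (-Y) * (Real.exp Y * Real.exp (-Y)) := by ring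
      _ = _ := by rw [e7, mul_one]
  have hR : Negl fun Y => Real.exp Y *
      (S.E0 lam (symPar lam Y) - S.Main lam τ Ξ (symPar lam Y)).1 (x Y) := by
    refine ⟨C', n, ?_⟩
    filter_upwards [dom_symPar h0 h1 1 one_pos, eventually_ge_atTop 1] with Y hd hY
    have hY0 := Y₀_symPar h0 h1 (by linarith : 0 ≤ Y)
    have e1 := hb ⟨symPar lam Y, 2, by norm_num, hd.1⟩ (x Y)
    have e2 := hs ⟨symPar lam Y, 2, by norm_num, hd.1⟩ hd.1 (x Y)
    simp only [Function.iterate_zero, id_eq] at e1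
    have hy : (symPar lam Y).y = Y := by simp [symPar, Par.y]
    have e7 : Real.exp Y * Real.exp (-Y) = 1 := by rw [← Real.exp_add]; simp
    have e8 : eta lam (symPar lam Y) ^ 2 = Real.exp (-Y) := by
      rw [eta, hY0, ← Real.exp_nat_mul]; congr 1; push_cast; ring
    have e9 : gauge 2 1 1 (⟨symPar lam Y, 2, by norm_num, hd.1⟩ : Adm lam) (x Y)
        ≤ Real.exp (-Y) * Real.exp (-Y) := by
      have := om_le (symPar lam Y) (x Y)
      change eta lam (symPar lam Y) ^ 2 * eps (symPar lam Y) ^ 1 * om (symPar lam Y) (x Y) ^ 1 ≤ _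
      rw [e8, eps, hy, pow_one, pow_one]
      exact mul_le_of_le_one_right (by positivity) this
    rw [hY0] at e2
    rw [abs_mul, abs_of_pos (Real.exp_pos _)]
    calc _ ≤ Real.exp Y * ((C' * Y ^ n) * (Real.exp (-Y) * Real.exp (-Y))) := by
          gcongr
          refine e1.trans (mul_le_mul e2 e9 (gauge_nonneg _ _ _ _ _) (by positivity))
      _ = C' * Y ^ n * Real.exp (-Y) * (Real.exp Y * Real.exp (-Y)) := by ring
      _ = _ := by rw [e7, mul_one]
  refine (hE.add hR.neg).congr (Eventually.of_forall fun Y => ?_)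
  simp only [Sm.coe_sub']; ring

/-- The equations of the profiles are necessary. -/
theorem SData.Good.equations {S : SData} {τ : ℝ}
    {Ξ : Sm} (g : S.Good lam τ) (hΞ : Gr wY Ξ) (tΞ : Tay (Rmu lam) Ξ)
    (hS : S.toApprox.SolvesApprox lam) :
    (S.EA1 lam = 0 ∧ S.EB1 lam = 0 ∧ S.ED1 lam Ξ = 0) ∧
      (S.EA2 lam = 0 ∧ S.EB2 lam = 0 ∧ S.ED2 lam τ Ξ = 0) := by
  obtain ⟨ha, hb⟩ := alphaVal_bounds h0 h1
  set s := Real.sqrt (alphaVal lam) with hs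
  have hs0 : 0 < s := Real.sqrt_pos.2 (by linarith)
  have t0 := (tendsto_pow_mul_exp_half 0).const_mul s
  have t1 := (tendsto_pow_mul_exp_half 1).const_mul s
  simp only [pow_zero, pow_one, one_mul, mul_zero] at t0 t1
  have bd : ∀ {u : ℝ → ℝ}, Tendsto u atTop (𝓝 0) → ∀ᶠ Y in atTop, |u Y| ≤ 1 := fun h => by
    have := h.abs.eventually (gt_mem_nhds (by simp : |(0 : ℝ)| < 1))
    filter_upwards [this] with Y h using h.le
  have hexp : ∀ Y : ℝ, Real.exp Y * Real.exp (-Y) = 1 := fun Y => by rw [← Real.exp_add]; simp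
  have c1 : ∀ z, (S.EA1 lam).1 z = 0 ∧ (S.EB1 lam).1 z = 0 ∧ (S.ED1 lam Ξ).1 z = 0 := fun z => by
    refine eq_zero_of_negl hs0 ?_
    -- At this point `z₁ = z` is fixed while `z₂ = z + Y` escapes, so the three functions attached
    -- to the second soliton contribute only negligible terms.
    have m := g.main_negl h0 h1 hΞ tΞ hS fun Y => z + Y / 2
    have n1 := (Negl.of_gr g.gr_EA2 z).neg
    have n2 := (Negl.of_gr g.gr_EB2 z).mul_bdd (bd t1)
    have n3 := (Negl.of_gr (g.gr_ED2 h0 h1 hΞ) z).mul_bdd (bd t0)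
    refine (((m.add n1).add n2).add n3).congr (Eventually.of_forall fun Y => ?_)
    have e1 : z + Y / 2 - Y / 2 = z := by ring
    have e2 : z + Y / 2 - -(Y / 2) = z + Y := by ring
    simp only [SData.Main, symPar, eps, Par.y, Sm.coe_mul', Sm.coe_add', cst_apply, sh_apply, e1,
      e2, show Y / 2 - -(Y / 2) = Y by ring, ← hs]
    rw [← mul_assoc (Real.exp Y), hexp, one_mul]
    ring
  have c2 : ∀ z, (S.EA2 lam).1 z = 0 ∧ -(S.EB2 lam).1 z = 0 ∧ -(S.ED2 lam τ Ξ).1 z = 0 :=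
      fun z => by
    refine eq_zero_of_negl hs0 ?_
    have m := g.main_negl h0 h1 hΞ tΞ hS fun Y => z - Y / 2
    have n1 := (Negl.of_gr' g.gr_EA1 z).neg
    have n2 := ((Negl.of_gr' g.gr_EB1 z).mul_bdd (bd t1)).neg
    have n3 := ((Negl.of_gr' (g.gr_ED1 h0 h1 hΞ) z).mul_bdd (bd t0)).neg
    refine (((m.add n1).add n2).add n3).congr (Eventually.of_forall fun Y => ?_)
    have e1 : z - Y / 2 - Y / 2 = z - Y := by ring
    have e2 : z - Y / 2 - -(Y / 2) = z := by ring
    simp only [SData.Main, symPar, eps, Par.y, Sm.coe_mul', Sm.coe_add', cst_apply, sh_apply, e1,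
      e2, show Y / 2 - -(Y / 2) = Y by ring, ← hs]
    rw [← mul_assoc (Real.exp Y), hexp, one_mul]
    ring
  refine ⟨⟨Sm.ext' fun z => (c1 z).1, Sm.ext' fun z => (c1 z).2.1, Sm.ext' fun z => (c1 z).2.2⟩,
    Sm.ext' fun z => (c2 z).1, Sm.ext' fun z => ?_, Sm.ext' fun z => ?_⟩
  · exact neg_eq_zero.1 (c2 z).2.1
  · exact neg_eq_zero.1 (c2 z).2.2

end

/-! ### Construction of profiles -/

theorem gr_sub_Lo {f : Sm} (h : Gr wY (D f)) : Gr wY (D (D f) + 2 * qq * f) := by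
  have := (gr_qq.mul_one (gr_w1_of_deriv h.Y1)).cst_mul 2
  rw [cst_ofNat, ← mul_assoc] at this
  exact h.deriv.add wY_pos this

theorem Lo_eq (f : Sm) : Lo f = f - (D (D f) + 2 * qq * f) := by rw [Lo]; ring

theorem tendsto_Lo_top {f : Sm} (h : Gr wY (D f)) {l : ℝ} (hl : Tendsto f.1 atTop (𝓝 l)) :
    Tendsto (Lo f).1 atTop (𝓝 l) := by
  have := hl.sub (gr_sub_Lo h).toR.tendsto_top
  rw [sub_zero] at this
  rw [Lo_eq]; exact this

theorem tendsto_Lo_bot {f : Sm} (h : Gr wY (D f)) {l : ℝ} (hl : Tendsto f.1 atBot (𝓝 l)) :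
    Tendsto (Lo f).1 atBot (𝓝 l) := by
  have := hl.sub (gr_sub_Lo h).toL.tendsto_bot
  rw [sub_zero] at this
  rw [Lo_eq]; exact this

theorem intg_D_Lo {f : Sm} (h : Gr wY (D f)) {l l' : ℝ} (hl : Tendsto f.1 atBot (𝓝 l))
    (hl' : Tendsto f.1 atTop (𝓝 l')) : intg (D (Lo f)) = l' - l :=
  intg_D (gr_D_Lo h) (tendsto_Lo_bot h hl) (tendsto_Lo_top h hl')

theorem intg_H {f : Sm} (lam : ℝ) (h : Gr wY f) : intg (H lam f) = intg f := by
  rw [H, intg_sub h (h.deriv.deriv.cst_mul _), intg_cst_mul, intg_D_zero h.deriv]; ring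

theorem intg_lamP (lam : ℝ) : intg (lamP lam) = 3 * (1 + lam) := by
  have e : lamP lam = qq + cst ((1 - lam) / 2) * (zz * D qq) := by
    rw [lamP, lamQ, D_qq]; ring
  have hz : Gr wY (zz * D qq) := gr_zz.one_mul gr_D_qq
  rw [e, intg_add gr_qq (hz.cst_mul _), intg_cst_mul, intg_parts (gr_zz.one_mul gr_qq) hz, D_zz,
    one_mul, intg_qq]
  ring

theorem D_Lo_lamP (lam : ℝ) : D (Lo (lamP lam)) = -H lam (D qq) := by
  rw [Lo_lamQ, map_neg, D_H]

theorem Gr.mul_H {f g : Sm} (hf : Gr wY (D f)) (hg : Gr wY g) (lam : ℝ) : Gr wY (f * BBM.H lam g) :=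
  (gr_w1_of_deriv hf.Y1).one_mul (hg.H wY_pos lam)

section
variable {lam : ℝ} (h0 : 0 ≤ lam) (h1 : lam < 1)
include h0 h1

/-- Solution of the profile equation with the orthogonality conditions. -/
theorem exists_profile {F : Sm} (hF : Gr wY F) (ho : intg (F * qq) = 0) :
    ∃ (f : Sm) (b τ : ℝ), Gr wY (D f) ∧ Tendsto f.1 atTop (𝓝 0) ∧ Tendsto f.1 atBot (𝓝 (2 * τ)) ∧
      D (Lo f) = F + cst b * H lam (D qq) ∧ intg (f * H lam (D qq)) = 0 ∧
      intg (f * H lam qq) = 0 ∧ 2 * τ = -intg F := by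
  obtain ⟨f, τ, gf, ft, fb, he⟩ := exists_D_Lo_eq hF ho
  have hd := den_pos h0 h1
  have hI := intg_D_qq_H_pos h0 h1
  -- Subtracting `bΛ` restores orthogonality to `HQ` and, by `LΛ = -HQ`, creates the term `b HQ'`.
  -- Subtracting `kQ'` restores orthogonality to `HQ'` without changing the equation. Parity
  -- decouples the two choices.
  set b := intg (f * H lam qq) / (3 / 10 * den lam) with hb
  set k := intg (f * H lam (D qq)) / intg (D qq * H lam (D qq)) with hk
  have gΛ : Gr wY (lamP lam) := gr_lamQ _
  have gc : Gr wY (-(cst b * lamP lam) - cst k * D qq) :=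
    (gΛ.cst_mul b).neg.sub wY_pos (gr_D_qq.cst_mul k)
  have key : ∀ {g : Sm}, Gr wY g → intg ((f + (-(cst b * lamP lam) - cst k * D qq)) * H lam g)
      = intg (f * H lam g) - b * intg (lamP lam * H lam g) - k * intg (D qq * H lam g) := by
    intro g hg
    have e : (f + (-(cst b * lamP lam) - cst k * D qq)) * H lam g = f * H lam g
        - cst b * (lamP lam * H lam g) - cst k * (D qq * H lam g) := by ring
    have i1 := Gr.mul_H gf hg lam
    have i2 := (Gr.mul_H gΛ.deriv hg lam).cst_mul b
    have i3 := (Gr.mul_H gr_D_qq.deriv hg lam).cst_mul k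
    rw [e, intg_sub (i1.sub wY_pos i2) i3, intg_sub i1 i2, intg_cst_mul, intg_cst_mul]
  refine ⟨f + (-(cst b * lamP lam) - cst k * D qq), b, τ, ?_, ?_, ?_, ?_, ?_, ?_, ?_⟩
  · rw [map_add]; exact gf.add wY_pos gc.deriv
  · have := ft.add gc.toR.tendsto_top
    rw [add_zero] at this; exact this
  · have := fb.add gc.toL.tendsto_bot
    rw [add_zero] at this; exact this
  · rw [Lo_add, Lo_sub, Lo_neg, Lo_cst_mul, Lo_cst_mul, Lo_D_qq, mul_zero, sub_zero, map_add, he,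
      map_neg, D_mul, D_Lo_lamP, D_cst]
    ring
  · rw [key gr_D_qq, intg_lamQ_D_qq, hk, div_mul_cancel₀ _ hI.ne']; ring
  · rw [key gr_qq, intg_lamQ_H_den, intg_D_qq_H_qq, hb, div_mul_cancel₀ _ (by positivity)]; ring
  · rw [← he, intg_D_Lo gf fb ft]; ring

/-- The profile of the second soliton obtained from one of the first by reflection. -/
theorem reflect_profile {f : Sm} {τ : ℝ} (gf : Gr wY (D f)) (ft : Tendsto f.1 atTop (𝓝 0))
    (fb : Tendsto f.1 atBot (𝓝 (2 * τ))) (o1 : intg (f * H lam (D qq)) = 0)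
    (o2 : intg (f * H lam qq) = 0) :
    ∃ F : Sm, Gr wY (D F) ∧ Tendsto F.1 atTop (𝓝 0) ∧ Tendsto F.1 atBot (𝓝 (-2 * τ)) ∧
      D (Lo F) = -rfl' (D (Lo f)) - cst (4 * τ) * D qq
        + cst (40 * τ * (1 + lam) / den lam) * H lam (D qq) ∧
      intg (F * H lam (D qq)) = 0 ∧ intg ((F + cst (-2 * τ)) * H lam qq) = 0 := by
  have hd := den_pos h0 h1
  -- The value solves the orthogonality to `HQ`: `-24τ + 8τ(9 + 3λ)/2 + (3/10) κ den = 0`.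
  set κ := -(40 * τ * (1 + lam) / den lam) with hκ
  have gc : Gr wY (cst (8 * τ) * lamQ (1 / 2) + cst κ * lamP lam) :=
    ((gr_lamQ _).cst_mul _).add wY_pos ((gr_lamQ _).cst_mul _)
  have gr : Gr wY (D (rfl' f)) := by rw [D_rfl']; exact gf.rflY.neg
  -- Subtracting `2τ` puts the limits of the reflection right but adds `+4τQ'` to `(L·)'`. The term
  -- `8τ lamQ (1/2)` adds `-8τQ'`, leaving the required `-4τQ'`. The last term adjusts orthogonality
  -- and contributes only a multiple of `HQ'`.
  refine ⟨rfl' f - cst (2 * τ) + (cst (8 * τ) * lamQ (1 / 2) + cst κ * lamP lam),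
    ?_, ?_, ?_, ?_, ?_, ?_⟩
  · rw [map_add, map_sub, D_cst, sub_zero]; exact gr.add wY_pos gc.deriv
  · have := ((tendsto_rfl' fb).sub_const (2 * τ)).add gc.toR.tendsto_top
    rw [sub_self, add_zero] at this; exact this
  · have := ((tendsto_rfl'_bot ft).sub_const (2 * τ)).add gc.toL.tendsto_bot
    rw [add_zero, zero_sub, ← neg_mul] at this; exact this
  · have e1 : D (Lo (rfl' f)) = -rfl' (D (Lo f)) := by rw [Lo_rfl', D_rfl']
    have e2 : Lo (cst (2 * τ)) = cst (2 * τ) * (1 - 2 * qq) := by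
      rw [← Lo_one, ← Lo_cst_mul, mul_one]
    have e3 : D (Lo (cst (2 * τ))) = -(cst (4 * τ) * D qq) := by
      have e4 : (4 : ℝ) * τ = 2 * τ * 2 := by ring
      rw [e2, e4, cst_mul (2 * τ) 2, cst_ofNat]
      simp only [D_mul, map_sub, D_one, D_cst, D_ofNat]; ring
    have e5 : cst κ = -cst (40 * τ * (1 + lam) / den lam) := by rw [hκ, cst_neg]
    have e6 : cst (8 * τ) = 2 * cst (4 * τ) := by
      rw [← cst_ofNat, ← cst_mul]; congr 1; ring
    rw [Lo_add, Lo_sub, Lo_add, Lo_cst_mul, Lo_cst_mul, Lo_lamQ_half, map_add, map_sub, map_add, e1,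
      e3, D_mul, D_mul, D_Lo_lamP, D_cst, D_cst, map_neg, e5, e6]
    ring
  · have i1 : Gr wY (rfl' f * H lam (D qq)) := Gr.mul_H gr gr_D_qq lam
    have e1 : intg (rfl' f * H lam (D qq)) = 0 := by
      have : rfl' f * H lam (D qq) = -rfl' (f * H lam (D qq)) := by
        rw [map_mul, rfl'_H_D_qq]; ring
      rw [this, intg_neg, intg_rfl', o1, neg_zero]
    have e2 : (rfl' f - cst (2 * τ) + (cst (8 * τ) * lamQ (1 / 2) + cst κ * lamP lam))
        * H lam (D qq) = rfl' f * H lam (D qq) - cst (2 * τ) * H lam (D qq)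
        + (cst (8 * τ) * (lamQ (1 / 2) * H lam (D qq)) + cst κ * (lamP lam * H lam (D qq))) := by
      ring
    have i2 := (gr_D_qq.H wY_pos lam).cst_mul (2 * τ)
    have i3 := (Gr.mul_H (gr_lamQ (1 / 2)).deriv gr_D_qq lam).cst_mul (8 * τ)
    have i4 := (Gr.mul_H (gr_lamQ ((1 - lam) / 2)).deriv gr_D_qq lam).cst_mul κ
    rw [e2, intg_add (i1.sub wY_pos i2) (i3.add wY_pos i4), intg_sub i1 i2, intg_add i3 i4,
      intg_cst_mul, intg_cst_mul, intg_cst_mul, e1, intg_H_D_qq, intg_lamQ_D_qq, intg_lamQ_D_qq]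
    ring
  · have i1 : Gr wY (rfl' f * H lam qq) := Gr.mul_H gr gr_qq lam
    have e1 : intg (rfl' f * H lam qq) = 0 := by
      have : rfl' f * H lam qq = rfl' (f * H lam qq) := by rw [map_mul, rfl'_H_qq]
      rw [this, intg_rfl', o2]
    have e2 : (rfl' f - cst (2 * τ) + (cst (8 * τ) * lamQ (1 / 2) + cst κ * lamP lam)
        + cst (-2 * τ)) * H lam qq = rfl' f * H lam qq - cst (4 * τ) * H lam qq
        + (cst (8 * τ) * (lamQ (1 / 2) * H lam qq) + cst κ * (lamP lam * H lam qq)) := by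
      have : cst (4 * τ) = cst (2 * τ) - cst (-2 * τ) := by rw [← cst_sub]; congr 1; ring
      rw [this]; ring
    have i2 := (gr_qq.H wY_pos lam).cst_mul (4 * τ)
    have i3 := (Gr.mul_H (gr_lamQ (1 / 2)).deriv gr_qq lam).cst_mul (8 * τ)
    have i4 := (Gr.mul_H (gr_lamQ ((1 - lam) / 2)).deriv gr_qq lam).cst_mul κ
    rw [e2, intg_add (i1.sub wY_pos i2) (i3.add wY_pos i4), intg_sub i1 i2, intg_add i3 i4,
      intg_cst_mul, intg_cst_mul, intg_cst_mul, e1, intg_H_qq, intg_lamQ_H, intg_lamQ_H_den, hκ]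
    field_simp
    ring

end

theorem intg_qq_sq : intg (qq ^ 2) = 6 := by
  have e : D (D qq) = qq - qq ^ 2 := D_D_qq
  have gq : Gr wY (qq ^ 2) := by rw [pow_two]; exact gr_qq.mul_one gr_qq.Y1
  have := intg_D_zero gr_D_qq
  rw [e, intg_sub gr_qq gq, intg_qq] at this
  linarith

theorem intg_D_one_sub_ph_sq_mul : intg (D ((1 - ph) ^ 2) * qq) = -4 := by
  have gq : Gr wY (qq ^ 2) := by rw [pow_two]; exact gr_qq.mul_one gr_qq.Y1
  have e : D ((1 - ph) ^ 2) * qq = -(cst (2 / 3) * (qq ^ 2 - ph * qq ^ 2)) := by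
    rw [D_one_sub_ph_sq]; ring
  have o : intg (ph * qq ^ 2) = 0 := intg_odd (by rw [map_mul, map_pow, rfl'_ph, rfl'_qq]; ring)
  rw [e, intg_neg, intg_cst_mul, intg_sub gq (gr_ph.one_mul gq), o, intg_qq_sq]
  norm_num

theorem tendsto_one_sub_ph_sq_top : Tendsto ((1 - ph) ^ 2 : Sm).1 atTop (𝓝 0) := by
  have := (tendsto_ph_top.const_sub 1).pow 2
  norm_num at this
  refine this.congr fun x => by simp

theorem tendsto_one_sub_ph_sq_bot : Tendsto ((1 - ph) ^ 2 : Sm).1 atBot (𝓝 4) := by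
  have := (tendsto_ph_bot.const_sub 1).pow 2
  norm_num at this
  refine this.congr fun x => by simp

theorem intg_H_lamP_mul_qq (lam : ℝ) : intg (H lam (lamP lam) * qq) = 3 / 10 * den lam := by
  rw [intg_H_symm lam (gr_lamQ _) gr_qq.Y1, intg_lamQ_H_den]

theorem rfl'_H (lam : ℝ) (f : Sm) : rfl' (H lam f) = H lam (rfl' f) := (H_rfl' lam f).symm

theorem rfl'_Lo (f : Sm) : rfl' (Lo f) = Lo (rfl' f) := (Lo_rfl' f).symm

theorem rfl'_D (f : Sm) : rfl' (D f) = -D (rfl' f) := by rw [D_rfl', neg_neg]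

theorem SData.rfl'_H1 (lam : ℝ) : rfl' (SData.H1 lam) = SData.H2 lam := by
  simp only [SData.H1, SData.H2, rfl'_Lo, map_sub, map_mul, rfl'_cst, rfl'_D, map_pow, map_one,
    rfl'_ph, sub_neg_eq_add]
  ring

theorem SData.rfl'_G1 {S : SData} {lam : ℝ} (h : S.A2 = rfl' S.A1) :
    rfl' (S.G1 lam) = S.G2 lam := by
  have hn : ∀ X Y : Sm, -X * Y = -(X * Y) := fun _ _ => by ring
  simp only [SData.G1, SData.G2, h, rfl'_Lo, rfl'_H, map_sub, map_add, map_mul, rfl'_cst, rfl'_D,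
    map_pow, map_one, rfl'_ph, sub_neg_eq_add, rfl'_zz, hn, Lo_neg, map_neg, Sm.map_ofNat']
  ring

theorem gr_H_lamP (lam : ℝ) : Gr wY (H lam (lamP lam)) := (gr_lamQ _).H wY_pos lam

section
variable {lam : ℝ} (h0 : 0 ≤ lam) (h1 : lam < 1)
include h0 h1

/-- The equation is solved for `A₁ + θ_A`, which vanishes at `+∞`; the shift accounts for the term
`2θ_A Q'`. Solvability reads `18·(-4) + α (3/10) den = 0`, which is where `α = 240/den` comes from.
-/
theorem exists_A1 : ∃ (A : Sm) (a : ℝ), Gr wY (D A) ∧ Tendsto A.1 atTop (𝓝 (-thetaA lam)) ∧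
    Tendsto A.1 atBot (𝓝 (thetaA lam)) ∧
    D (Lo A) = cst (2 * thetaA lam) * D qq + 18 * D ((1 - ph) ^ 2)
      + cst (240 / den lam) * H lam (lamP lam) + cst a * H lam (D qq) ∧
    intg (A * H lam (D qq)) = 0 ∧ intg ((A + cst (thetaA lam)) * H lam qq) = 0 := by
  have hd := den_pos h0 h1
  have g1 : Gr wY (18 * D ((1 - ph) ^ 2)) := by
    have := gr_D_one_sub_ph_sq.cst_mul 18; rwa [cst_ofNat] at this
  have g2 := (gr_H_lamP lam).cst_mul (240 / den lam)
  have gs := g1.add wY_pos g2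
  have e18 : (18 : Sm) = cst 18 := (cst_ofNat 18).symm
  obtain ⟨f, a, τ, gf, ft, fb, he, o1, o2, hτ⟩ := exists_profile h0 h1 gs (by
    have e : (18 * D ((1 - ph) ^ 2) + cst (240 / den lam) * H lam (lamP lam)) * qq
        = cst 18 * (D ((1 - ph) ^ 2) * qq) + cst (240 / den lam) * (H lam (lamP lam) * qq) := by
      rw [← e18]; ring
    rw [e, intg_add ((gr_D_one_sub_ph_sq.mul_one gr_qq.Y1).cst_mul _)
      (((gr_H_lamP lam).mul_one gr_qq.Y1).cst_mul _), intg_cst_mul, intg_cst_mul,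
      intg_D_one_sub_ph_sq_mul, intg_H_lamP_mul_qq]
    field_simp; norm_num)
  -- The left limit is minus the integral of the source, `72 - 3α(1 + λ)`, and this equals `2θ_A`.
  have hτ' : 2 * τ = 2 * thetaA lam := by
    rw [hτ, intg_add g1 g2, intg_cst_mul, intg_H lam (gr_lamQ _), intg_lamP, e18, intg_cst_mul,
      intg_D gr_D_one_sub_ph_sq tendsto_one_sub_ph_sq_bot tendsto_one_sub_ph_sq_top, thetaA]
    field_simp
    unfold den
    ring
  refine ⟨f - cst (thetaA lam), a, by simpa using gf, ?_, ?_, ?_, ?_, ?_⟩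
  · have := ft.sub_const (thetaA lam); rw [zero_sub] at this; exact this
  · have := fb.sub_const (thetaA lam)
    rw [hτ', two_mul, add_sub_cancel_right] at this; exact this
  · have e2 : Lo (cst (thetaA lam)) = cst (thetaA lam) * (1 - 2 * qq) := by
      rw [← Lo_one, ← Lo_cst_mul, mul_one]
    rw [Lo_sub, e2, map_sub, he, cst_mul, cst_ofNat]
    simp only [D_mul, map_sub, D_one, D_cst, D_ofNat]; ring
  · rw [sub_mul, intg_sub (Gr.mul_H gf gr_D_qq lam) ((gr_D_qq.H wY_pos lam).cst_mul _),
      intg_cst_mul, intg_H_D_qq, o1]; ring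
  · rw [sub_add_cancel, o2]

/-- The part of the source involving `L` is orthogonal to `Q`, so solvability is `(1 - λ)/2` times
that of `A₁`, whence the same ratio between `β` and `α`. The prescribed left limit `2θ_B` is then
minus the integral of the source. -/
theorem exists_B1 : ∃ (B : Sm) (β b : ℝ), Gr wY (D B) ∧ Tendsto B.1 atTop (𝓝 0) ∧
    Tendsto B.1 atBot (𝓝 (2 * thetaB lam)) ∧
    D (Lo B) = SData.H1 lam + cst β * H lam (lamP lam) + cst b * H lam (D qq) ∧
    intg (B * H lam (D qq)) = 0 ∧ intg (B * H lam qq) = 0 := by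
  have hd := den_pos h0 h1
  set β := 240 / den lam * ((1 - lam) / 2) with hβ
  have g2 := (gr_H_lamP lam).cst_mul β
  have gs := (SData.gr_H1 lam).add wY_pos g2
  have p1 := gr_D_one_sub_ph_sq.cst_mul (18 * ((1 - lam) / 2))
  have p2 := (gr_D_Lo gr_D_one_sub_ph_sq).cst_mul (9 * theta lam)
  obtain ⟨f, b, τ, gf, ft, fb, he, o1, o2, hτ⟩ := exists_profile h0 h1 gs (by
    have e : (SData.H1 lam + cst β * H lam (lamP lam)) * qq
        = cst (18 * ((1 - lam) / 2)) * (D ((1 - ph) ^ 2) * qq)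
          - cst (9 * theta lam) * (D (Lo ((1 - ph) ^ 2)) * qq)
          + cst β * (H lam (lamP lam) * qq) := by
      rw [SData.H1]; ring
    have i1 := (gr_D_one_sub_ph_sq.mul_one gr_qq.Y1).cst_mul (18 * ((1 - lam) / 2))
    have i2 := ((gr_D_Lo gr_D_one_sub_ph_sq).mul_one gr_qq.Y1).cst_mul (9 * theta lam)
    rw [e, intg_add (i1.sub wY_pos i2) (((gr_H_lamP lam).mul_one gr_qq.Y1).cst_mul _),
      intg_sub i1 i2, intg_cst_mul, intg_cst_mul, intg_cst_mul, 
      intg_D_one_sub_ph_sq_mul, intg_H_lamP_mul_qq, intg_D_Lo_mul_qq (gr_one_sub_ph'.pow 2), hβ]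
    field_simp; ring)
  have hτ' : 2 * τ = 2 * thetaB lam := by
    have e : intg (SData.H1 lam) = 18 * ((1 - lam) / 2) * (0 - 4) - 9 * theta lam * (0 - 4) := by
      rw [SData.H1, intg_sub p1 p2, intg_cst_mul, intg_cst_mul,
        intg_D gr_D_one_sub_ph_sq tendsto_one_sub_ph_sq_bot tendsto_one_sub_ph_sq_top,
        intg_D_Lo gr_D_one_sub_ph_sq tendsto_one_sub_ph_sq_bot tendsto_one_sub_ph_sq_top]
    rw [hτ, intg_add (SData.gr_H1 lam) g2, intg_cst_mul, intg_H lam (gr_lamQ _), intg_lamP, e,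
      hβ, theta, thetaB]
    field_simp
    unfold den
    ring
  refine ⟨f, β, b, gf, ft, hτ' ▸ fb, he, o1, o2⟩

/-- All profiles and constants. -/
theorem exists_data {Ξ : Sm} (hΞ : Gr wY Ξ) (eΞ : rfl' Ξ = Ξ) : ∃ (S : SData) (τ : ℝ),
    S.Good lam τ ∧ (S.EA1 lam = 0 ∧ S.EB1 lam = 0 ∧ S.ED1 lam Ξ = 0) ∧
      (S.EA2 lam = 0 ∧ S.EB2 lam = 0 ∧ S.ED2 lam τ Ξ = 0) ∧
      (intg (S.A1 * H lam (D qq)) = 0 ∧ intg ((S.A1 + cst (thetaA lam)) * H lam qq) = 0) ∧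
      (intg (S.A2 * H lam (D qq)) = 0 ∧ intg ((S.A2 + cst (thetaA lam)) * H lam qq) = 0) ∧
      (intg (S.B1 * H lam (D qq)) = 0 ∧ intg ((S.B1 + cst 0) * H lam qq) = 0) ∧
      (intg (S.B2 * H lam (D qq)) = 0 ∧ intg ((S.B2 + cst (-2 * thetaB lam)) * H lam qq) = 0) ∧
      (intg (S.D1 * H lam (D qq)) = 0 ∧ intg ((S.D1 + cst 0) * H lam qq) = 0) ∧
      (intg (S.D2 * H lam (D qq)) = 0 ∧ intg ((S.D2 + cst (-2 * τ)) * H lam qq) = 0) ∧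
      S.α = 240 / den lam ∧ S.b2 = S.b1 + 40 * thetaB lam * (1 + lam) / den lam := by
  obtain ⟨A, a, gA, At, Ab, eA, oA1, oA2⟩ := exists_A1 h0 h1
  obtain ⟨B, β, b, gB, Bt, Bb, eB, oB1, oB2⟩ := exists_B1 h0 h1
  obtain ⟨B', gB', Bt', Bb', eB', oB1', oB2'⟩ := reflect_profile h0 h1 gB Bt Bb oB1 oB2
  have hd := den_pos h0 h1
  have gA2 : Gr wY (D (rfl' A)) := by rw [D_rfl']; exact gA.rflY.neg
  -- The source of the equation of `D₁` depends only on data already found, so placeholders `0` for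
  -- `D₁`, `D₂`, with left limit `0`, suffice to obtain its decay.
  set S0 : SData := ⟨A, rfl' A, B, B', 0, 0, 240 / den lam, β, 0, a, b,
    b + 40 * thetaB lam * (1 + lam) / den lam, 0, 0⟩ with hS0
  have g0 : S0.Good lam 0 := ⟨gA, gA2, gB, gB', by rw [hS0, map_zero]; exact Gr.zero,
    by rw [hS0, map_zero]; exact Gr.zero, At, Ab,
    tendsto_rfl' Ab, tendsto_rfl'_bot At, Bt, Bb, Bt', Bb', tendsto_const_nhds,
    by rw [mul_zero]; exact tendsto_const_nhds, tendsto_const_nhds,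
    by rw [mul_zero]; exact tendsto_const_nhds⟩
  set F : Sm := S0.G1 lam + 2 * D (lamP lam * (A + cst (thetaA lam)))
    + cst (240 / den lam) * H lam Ξ + cst a * H lam (D (lamP lam)) - H lam (D A) with hF
  have gF : Gr wY F := by
    have e := (((gr_lamQ ((1 - lam) / 2)).mul_one
      ((gr_w1_of_deriv gA.Y1).add w1_pos (Gr.cst (thetaA lam)))).deriv).cst_mul 2
    rw [cst_ofNat] at e
    exact ((((SData.gr_G1 h0 h1 g0).add wY_pos e).add wY_pos ((hΞ.H wY_pos lam).cst_mul _)).add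
      wY_pos (((gr_lamQ _).deriv.H wY_pos lam).cst_mul _)).sub wY_pos (gA.H wY_pos lam)
  -- `δ` is dictated by solvability, orthogonality of the full source to `Q`.
  set δ := -intg (F * qq) / (3 / 10 * den lam) with hδ
  obtain ⟨f, d, τ, gf, ft, fb, ef, of1, of2, -⟩ := exists_profile h0 h1
    (gF.add wY_pos ((gr_H_lamP lam).cst_mul δ)) (by
      have e : (F + cst δ * H lam (lamP lam)) * qq = F * qq + cst δ * (H lam (lamP lam) * qq) := by
        ring
      rw [e, intg_add (gF.mul_one gr_qq.Y1) (((gr_H_lamP lam).mul_one gr_qq.Y1).cst_mul _),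
        intg_cst_mul, intg_H_lamP_mul_qq, hδ, div_mul_cancel₀ _ (by positivity)]
      ring)
  obtain ⟨f', gf', ft', fb', ef', of1', of2'⟩ := reflect_profile h0 h1 gf ft fb of1 of2
  refine ⟨⟨A, rfl' A, B, B', f, f', 240 / den lam, β, δ, a, b,
    b + 40 * thetaB lam * (1 + lam) / den lam, d, d + 40 * τ * (1 + lam) / den lam⟩, τ,
    ⟨gA, gA2, gB, gB', gf, gf', At, Ab, tendsto_rfl' Ab, tendsto_rfl'_bot At, Bt, Bb, Bt', Bb', ft,
      fb, ft', fb'⟩, ⟨?_, ?_, ?_⟩, ⟨?_, ?_, ?_⟩, ⟨oA1, oA2⟩, ⟨?_, ?_⟩, ⟨oB1, by simpa using oB2⟩,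
      ⟨oB1', oB2'⟩, ⟨of1, by simpa using of2⟩, ⟨of1', of2'⟩, rfl, rfl⟩
  · simp only [SData.EA1, eA]; ring
  · simp only [SData.EB1, eB]; ring
  · simp only [SData.ED1, ef, hF]; simp only [SData.G1, hS0]; ring
  · have e : D (Lo (rfl' A)) = -rfl' (D (Lo A)) := by rw [← rfl'_Lo, D_rfl']
    simp only [SData.EA2, e, eA, map_add, map_mul, rfl'_cst, Sm.map_ofNat', rfl'_D, rfl'_H,
      rfl'_lamQ, lamP, rfl'_qq, map_pow, map_sub, map_one, rfl'_ph, sub_neg_eq_add, H_neg]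
    ring
  · simp only [SData.EB2, eB', eB, map_add, map_mul, rfl'_cst, SData.rfl'_H1, rfl'_D, rfl'_H,
      rfl'_lamQ, lamP, rfl'_qq, H_neg, cst_add]
    ring
  · have hG : rfl' (S0.G1 lam) = S0.G2 lam := SData.rfl'_G1 rfl
    simp only [SData.ED2, ef', ef, hF, map_add, map_sub, map_mul, rfl'_cst, hG, rfl'_D, rfl'_H,
      rfl'_lamQ, lamP, rfl'_qq, H_neg, cst_add, Sm.map_ofNat', eΞ]
    simp only [SData.G2, hS0]
    ring
  · have : rfl' A * H lam (D qq) = -rfl' (A * H lam (D qq)) := by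
      rw [map_mul, rfl'_H_D_qq]; ring
    rw [this, intg_neg, intg_rfl', oA1, neg_zero]
  · have : (rfl' A + cst (thetaA lam)) * H lam qq
        = rfl' ((A + cst (thetaA lam)) * H lam qq) := by
      rw [map_mul, map_add, rfl'_cst, rfl'_H_qq]
    rw [this, intg_rfl', oA2]

end

/-! ### Existence and uniqueness of the profiles -/

theorem orth_iff (lam c : ℝ) (f : Sm) : Orth lam c f.1 ↔
    intg (f * H lam (D qq)) = 0 ∧ intg ((f + cst c) * H lam qq) = 0 := by
  unfold Orth intg
  rw [show deriv Q = (D qq).1 from rfl, show Q = qq.1 from rfl, helm_coe, helm_coe]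
  rfl

theorem isProfile_of_gr {f : Sm} (h : Gr wY (D f)) {l l' : ℝ} (h0 : Tendsto f.1 atTop (𝓝 l))
    (h1 : Tendsto f.1 atBot (𝓝 l')) : IsProfile f.1 := by
  refine ⟨Sm.contDiff f, ?_, (mem_classY_iff (D f)).2 h⟩
  obtain ⟨C, hC, hb⟩ := halfDecay_sub h h0 h1 0
  refine memLp_top_of_bound (Sm.continuous f).aestronglyMeasurable (C + |l|)
    (Eventually.of_forall fun x => ?_)
  have h2 : |f.1 x - l| ≤ C :=
    (hb x).trans (mul_le_of_le_one_right hC (min_le_left _ _))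
  have h3 := abs_add_le (f.1 x - l) l
  rw [sub_add_cancel] at h3
  rw [Real.norm_eq_abs]
  linarith

theorem gr_of_isProfile {f : ℝ → ℝ} (h : IsProfile f) : Gr wY (D ⟨f, h.1⟩) :=
  (mem_classY_iff _).1 h.2.2

theorem two_thetaB (lam : ℝ) : 288 * lam ^ 2 / den lam = 2 * thetaB lam := by
  unfold thetaB; ring

namespace SData

/-- The orthogonality conditions of the profiles. -/
structure OrthAll (S : SData) (lam τ : ℝ) : Prop where
  A1 : Orth lam (thetaA lam) S.A1.1
  A2 : Orth lam (thetaA lam) S.A2.1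
  B1 : Orth lam 0 S.B1.1
  B2 : Orth lam (-2 * thetaB lam) S.B2.1
  D1 : Orth lam 0 S.D1.1
  D2 : Orth lam (-2 * τ) S.D2.1

theorem Good.profileProperties {S : SData} {lam τ : ℝ} (g : S.Good lam τ)
    (o : S.OrthAll lam τ) : S.toApprox.ProfileProperties lam where
  profile_A₁ := isProfile_of_gr g.gA1 g.A1_top g.A1_bot
  profile_A₂ := isProfile_of_gr g.gA2 g.A2_top g.A2_bot
  profile_B₁ := isProfile_of_gr g.gB1 g.B1_top g.B1_bot
  profile_B₂ := isProfile_of_gr g.gB2 g.B2_top g.B2_bot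
  profile_D₁ := isProfile_of_gr g.gD1 g.D1_top g.D1_bot
  profile_D₂ := isProfile_of_gr g.gD2 g.D2_top g.D2_bot
  A₁_top := g.A1_top
  A₁_bot := g.A1_bot
  A₂_top := g.A2_top
  A₂_bot := g.A2_bot
  B₁_top := g.B1_top
  B₁_bot := by rw [two_thetaB]; exact g.B1_bot
  B₂_top := g.B2_top
  B₂_bot := by rw [two_thetaB, ← neg_mul]; exact g.B2_bot
  D₁_top := g.D1_top
  D₂_top := g.D2_top
  orth_A₁ := o.A1
  orth_A₂ := o.A2
  orth_B₁ := o.B1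
  orth_B₂ := o.B2
  orth_D := ⟨τ, g.D1_bot, g.D2_bot, o.D1, o.D2⟩

end SData

theorem ApproxData.ProfileProperties.exists_good {P : ApproxData} {lam : ℝ}
    (h : P.ProfileProperties lam) :
    ∃ (S : SData) (τ : ℝ), S.toApprox = P ∧ S.Good lam τ ∧ S.OrthAll lam τ := by
  obtain ⟨τ, h1, h2, o1, o2⟩ := h.orth_D
  refine ⟨⟨⟨P.A₁, h.profile_A₁.1⟩, ⟨P.A₂, h.profile_A₂.1⟩, ⟨P.B₁, h.profile_B₁.1⟩,
    ⟨P.B₂, h.profile_B₂.1⟩, ⟨P.D₁, h.profile_D₁.1⟩, ⟨P.D₂, h.profile_D₂.1⟩,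
    P.α, P.β, P.δ, P.a, P.b₁, P.b₂, P.d₁, P.d₂⟩, τ, rfl,
    ⟨gr_of_isProfile h.profile_A₁, gr_of_isProfile h.profile_A₂, gr_of_isProfile h.profile_B₁,
      gr_of_isProfile h.profile_B₂, gr_of_isProfile h.profile_D₁, gr_of_isProfile h.profile_D₂,
      h.A₁_top, h.A₁_bot, h.A₂_top, h.A₂_bot, h.B₁_top, ?_, h.B₂_top, ?_, h.D₁_top, h1,
      h.D₂_top, h2⟩,
    ⟨h.orth_A₁, h.orth_A₂, h.orth_B₁, h.orth_B₂, o1, o2⟩⟩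
  · rw [← two_thetaB]; exact h.B₁_bot
  · rw [neg_mul, ← two_thetaB]; exact h.B₂_bot

/-- Two profiles solving equations with the same source coincide, together with their constants. -/
theorem profile_ext {lam : ℝ} (h0 : 0 ≤ lam) (h1 : lam < 1) {f f' : Sm} {p q t l l' c c' : ℝ}
    (hf : Gr wY (D f)) (hf' : Gr wY (D f')) (ht : Tendsto f.1 atTop (𝓝 t))
    (ht' : Tendsto f'.1 atTop (𝓝 t)) (hl : Tendsto f.1 atBot (𝓝 l))
    (hl' : Tendsto f'.1 atBot (𝓝 l')) (o : Orth lam c f.1) (o' : Orth lam c' f'.1)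
    (hc : l = l' → c = c')
    (he : -D (Lo (f - f')) + cst p * H lam (lamP lam) + cst q * H lam (D qq) = 0) :
    f = f' ∧ p = 0 ∧ q = 0 ∧ l = l' := by
  rw [orth_iff] at o o'
  have gD : Gr wY (D (f - f')) := by rw [map_sub]; exact hf.sub wY_pos hf'
  have tt : Tendsto (f - f').1 atTop (𝓝 0) := by rw [← sub_self t]; exact ht.sub ht'
  obtain ⟨e1, e2, e3, e4⟩ := profile_unique h0 h1 gD tt (hl.sub hl') he
    (by rw [sub_mul, intg_sub (hf.mul_H gr_D_qq lam) (hf'.mul_H gr_D_qq lam), o.1, o'.1, sub_zero])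
    (fun e => by
      have hcc := hc (sub_eq_zero.1 e)
      subst hcc
      have e5 : (f - f') * H lam qq = (f + cst c) * H lam qq - (f' + cst c) * H lam qq := by ring
      rw [e5, intg_sub (Gr.mul_H (by simpa using hf) gr_qq lam)
        (Gr.mul_H (by simpa using hf') gr_qq lam), o.2, o'.2, sub_zero])
  exact ⟨sub_eq_zero.1 e1, e2, e3, sub_eq_zero.1 e4⟩

/-- The system is triangular: the equation of `A₁` determines `α` and `a`, that of `B₁` determines
`β`, and the equations of `D_j` involve the `A_j`, `α` and `a` only as known sources. `D₁` comes
before `D₂` because its left limit identifies `τ`, which enters both the equation and the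
orthogonality condition of `D₂`. -/
theorem SData.Good.unique {lam : ℝ} (h0 : 0 ≤ lam) (h1 : lam < 1) {S S' : SData} {τ τ' : ℝ}
    {Ξ : Sm} (g : S.Good lam τ) (g' : S'.Good lam τ') (o : S.OrthAll lam τ)
    (o' : S'.OrthAll lam τ')
    (h : (S.EA1 lam = 0 ∧ S.EB1 lam = 0 ∧ S.ED1 lam Ξ = 0) ∧
      (S.EA2 lam = 0 ∧ S.EB2 lam = 0 ∧ S.ED2 lam τ Ξ = 0))
    (h' : (S'.EA1 lam = 0 ∧ S'.EB1 lam = 0 ∧ S'.ED1 lam Ξ = 0) ∧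
      (S'.EA2 lam = 0 ∧ S'.EB2 lam = 0 ∧ S'.ED2 lam τ' Ξ = 0)) : S = S' := by
  obtain ⟨⟨a1, b1, d1⟩, a2, b2, d2⟩ := h
  obtain ⟨⟨a1', b1', d1'⟩, a2', b2', d2'⟩ := h'
  obtain ⟨A1, A2, B1, B2, D1, D2, α, β, δ, a, β1, β2, δ1, δ2⟩ := S
  obtain ⟨A1', A2', B1', B2', D1', D2', α', β', δ', a', β1', β2', δ1', δ2'⟩ := S'
  simp only [EA1, EA2, EB1, EB2, ED1, ED2, G1, G2] at *
  obtain ⟨rfl, hα, ha, -⟩ := profile_ext h0 h1 (p := α - α') (q := a - a') g.gA1 g'.gA1 g.A1_top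
    g'.A1_top g.A1_bot g'.A1_bot o.A1 o'.A1 (fun _ => rfl) (by
      rw [Lo_sub, map_sub, cst_sub, cst_sub]; linear_combination a1 - a1')
  obtain rfl := sub_eq_zero.1 hα
  obtain rfl := sub_eq_zero.1 ha
  obtain ⟨rfl, -⟩ := profile_ext h0 h1 (p := 0) (q := 0) g.gA2 g'.gA2 g.A2_top
    g'.A2_top g.A2_bot g'.A2_bot o.A2 o'.A2 (fun _ => rfl) (by
      rw [Lo_sub, map_sub, cst_zero]; linear_combination a2 - a2')
  obtain ⟨rfl, hβ, hb, -⟩ := profile_ext h0 h1 (p := β - β') (q := β1 - β1') g.gB1 g'.gB1 g.B1_top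
    g'.B1_top g.B1_bot g'.B1_bot o.B1 o'.B1 (fun _ => rfl) (by
      rw [Lo_sub, map_sub, cst_sub, cst_sub]; linear_combination b1 - b1')
  obtain rfl := sub_eq_zero.1 hβ
  obtain rfl := sub_eq_zero.1 hb
  obtain ⟨rfl, -, hb, -⟩ := profile_ext h0 h1 (p := 0) (q := β2 - β2') g.gB2 g'.gB2 g.B2_top
    g'.B2_top g.B2_bot g'.B2_bot o.B2 o'.B2 (fun _ => rfl) (by
      rw [Lo_sub, map_sub, cst_zero, cst_sub]; linear_combination b2 - b2')
  obtain rfl := sub_eq_zero.1 hb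
  obtain ⟨rfl, hδ, hd, hτ⟩ := profile_ext h0 h1 (p := δ - δ') (q := δ1 - δ1') g.gD1 g'.gD1
    g.D1_top g'.D1_top g.D1_bot g'.D1_bot o.D1 o'.D1 (fun _ => rfl) (by
      rw [Lo_sub, map_sub, cst_sub, cst_sub]; linear_combination d1 - d1')
  obtain rfl := sub_eq_zero.1 hδ
  obtain rfl := sub_eq_zero.1 hd
  obtain rfl : τ = τ' := by linarith
  obtain ⟨rfl, -, hd, -⟩ := profile_ext h0 h1 (p := 0) (q := δ2 - δ2') g.gD2 g'.gD2 g.D2_top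
    g'.D2_top g.D2_bot g'.D2_bot o.D2 o'.D2 (fun _ => rfl) (by
      rw [Lo_sub, map_sub, cst_zero, cst_sub]; linear_combination d2 - d2')
  obtain rfl := sub_eq_zero.1 hd
  rfl

end BBM

end

theorem proposition2p1 (lam : ℝ) (hlam0 : 0 ≤ lam) (hlam1 : lam < 1) :
    ∃ P : BBM.ApproxData,
      (P.ProfileProperties lam ∧ P.SolvesApprox lam) ∧
      P.α = 240 / (15 + 10 * lam - lam ^ 2) ∧
      (P.b₁ = P.b₂ ↔ lam = 0) ∧
      ∀ P' : BBM.ApproxData, P'.ProfileProperties lam ∧ P'.SolvesApprox lam → P' = P := by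
  obtain ⟨Ξ, hΞ, eΞ, tΞ⟩ := BBM.exists_tay_Rmu hlam0 hlam1
  obtain ⟨S, τ, g, h1, h2, oA1, oA2, oB1, oB2, oD1, oD2, hα, hb⟩ :=
    BBM.exists_data hlam0 hlam1 hΞ eΞ
  simp only [← BBM.orth_iff] at oA1 oA2 oB1 oB2 oD1 oD2
  have o : S.OrthAll lam τ := ⟨oA1, oA2, oB1, oB2, oD1, oD2⟩
  have hd := BBM.den_pos hlam0 hlam1
  refine ⟨S.toApprox, ⟨g.profileProperties o, g.solvesApprox hlam0 hlam1 hΞ tΞ h1.1 h2.1 h1.2.1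
    h2.2.1 h1.2.2 h2.2.2⟩, hα, ?_, ?_⟩
  · change S.b1 = S.b2 ↔ lam = 0
    -- `b₂ - b₁` is a positive multiple of `θ_B`, hence of `λ²`.
    rw [hb, left_eq_add, BBM.thetaB]
    constructor
    · intro h
      by_contra hne
      have : 0 < lam := lt_of_le_of_ne hlam0 (Ne.symm hne)
      exact absurd h (by positivity)
    · rintro rfl
      simp
  · rintro P' ⟨hP, hS⟩
    obtain ⟨S', τ', rfl, g', o'⟩ := hP.exists_good
    rw [BBM.SData.Good.unique hlam0 hlam1 g' g o' o
      (g'.equations hlam0 hlam1 hΞ tΞ hS) ⟨h1, h2⟩]
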